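/- **Setting.** $\Gamma$ is a discrete group and all spaces are proper metric spaces of bounded geometry with a free and proper action of $\Gamma$ by isometries. A *space with cylindrical end* $(X,Y,\iota)$ is such a space $X$ with a $\Gamma$-invariant subset $Y$ and a $\Gamma$-equivariant isometric embedding $\iota:Y\times[0,\infty)\to X$ (product metric $\sqrt{d^2+|t-t'|^2}$) with $\iota(y,0)=y$ and $\operatorname{dist}(\iota(Y\times[R,\infty)),X\setminus Y_\infty)\to\infty$ as $R\to\infty$, where $Y_\infty=\iota(Y\times[0,\infty))$. A *coarse map of spaces with cylindrical ends* $f:(X,Y,\iota)\to(X',Y',\iota')$ is a $\Gamma$-equivariant coarse map (preimages of bounded sets are bounded; for each $R>0$ there is $S>0$ such that $d(x,y)<R$ implies $d(f(x),f(y))<S$) with $f(X\setminus Y_\infty)\subset X'\setminus Y'_\infty$, $f(Y)\subset Y'$ and $f(\iota(y,t))=\iota'(f(y),t)$. An *$X$-module* is a separable complex Hilbert space $H$ with a nondegenerate representation $\rho$ of $C_0(X)$ and a unitary representation $U$ of $\Gamma$ that are covariant, such that no nonzero $f\in C_0(X)$ acts as a compact operator. It is *tailored to the end* if it carries a strongly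 continuous family $(P_s)_{s\ge0}$ of partial isometries with $P_s^*P_s=\chi_{Y_\infty}$ and $P_sP_s^*=\chi_{\iota(Y\times[s,\infty))}$ for $s>0$, and $\rho(L_sg)P_s=P_s\rho(g)$ for $g\in C_0(Y_\infty)$, where $(L_sg)(\iota(y,t))=g(\iota(y,t-s))$ for $t\ge s$ and $0$ otherwise; and if for some $Y$-module $H_Y$ there is a $\Gamma$-equivariant unitary $W:\chi_{Y_\infty}H\to L^2(\mathbb R_+;H_Y)$ that covers the identity and satisfies $WP_s=P_s^{\mathrm{st}}W$, with $P^{\mathrm{st}}_s$ the translation by $s$. An operator $T:H\to H'$ *covers* a map $f$ if there is $R>0$ with $d(f(x),x')<R$ for all $(x',x)\in\operatorname{supp}T$. The *algebraic Roe algebra tailored to the end* consists of the locally compact, finite propagation, $\Gamma$-equivariant operators $T$ on $H$ with $\lim_{R\to\infty}\sup_{s>0}\|(P_s^*TP_s-T)\chi_{\iota(Y\times[R,\infty))}\|=0$. Its completion in the norm $\sup_N\|T_N\|$ is the $C^*$-algebra $C^*(X)^{\Gamma,\mathbb R_+}$ (quotient completion); here $N$ runs over the normal subgroups of $\Gamma$,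 and $T_N$ is the operator induced by $T$ on the $X/N$-module $H_N$, the completion of the space of compactly supported vectors of $H$ with respect to $\langle v,w\rangle_N=\sum_{n\in N}\langle v,U_nw\rangle$. $K_n(A)=K_0(C_0(\mathbb R^n,A))$, $n\ge0$, denotes complex K-theory of $C^*$-algebras. **Proposition.** Let $f:(X,Y,\iota)\to(X',Y',\iota')$ be a coarse map of spaces with cylindrical ends, and let $H$ and $H'$ be an $X$-module and an $X'$-module tailored to the ends, with partial isometries $P_s$ and $P'_s$. 1. There is a $\Gamma$-equivariant isometry $V:H\to H'$ that covers $f$ and satisfies $VP_s=P'_sV$ for all $s\ge0$. 2. For every such $V$, the map $T\mapsto VTV^*$ maps the algebraic Roe algebra of $X$ tailored to the end to that of $X'$ and extends uniquely to a $*$-homomorphism $\mathrm{Ad}_V:C^*(X)^{\Gamma,\mathbb R_+}\to C^*(X')^{\Gamma,\mathbb R_+}$. 3. For every $n\ge 0$, the homomorphism $K_n(C^*(X)^{\Gamma,\mathbb R_+})\to K_n(C^*(X')^{\Gamma,\mathbb R_+})$ induced by $\mathrm{Ad}_V$ is the same for all such $V$. 4. In particular, if $H$ and $H_2$ are two $X$-modules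 tailored to the end, then for every $n\ge0$ the groups $K_n(C^*(X)^{\Gamma,\mathbb R_+})$ formed with $H$ and with $H_2$ are canonically isomorphic: the homomorphism induced by every isometry $H\to H_2$ as in 1 covering $\mathrm{id}_X$ is one and the same isomorphism. -/

import Mathlib

open scoped ZeroAtInfty NNReal ENNReal InnerProductSpace

noncomputable section

/-! ## Complex operator K-theory -/

namespace KTheory

/-- Projections in matrix algebras over a `*`-ring. -/
abbrev Proj (B : Type*) [Ring B] [StarRing B] : Type _ :=
  Σ n : ℕ, {p : Matrix (Fin n) (Fin n) B // IsStarProjection p}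

/-- Murray--von Neumann equivalence of projections in matrix algebras. -/
def MvN {B : Type*} [Ring B] [StarRing B] (p q : Proj B) : Prop :=
  ∃ v : Matrix (Fin q.1) (Fin p.1) B,
    v.conjTranspose * v = p.2.1 ∧ v * v.conjTranspose = q.2.1

/-- The block sum of two projections. -/
def blockSum {B : Type*} [Ring B] [StarRing B] (p q : Proj B) : Proj B :=
  ⟨p.1 + q.1, Matrix.reindex finSumFinEquiv finSumFinEquiv (Matrix.fromBlocks p.2.1 0 0 q.2.1), by
    have hp := p.2.2
    have hq := q.2.2
    refine ⟨?_, ?_⟩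
    · have h1 := hp.isIdempotentElem.eq
      have h2 := hq.isIdempotentElem.eq
      simp only [IsIdempotentElem, Matrix.reindex_apply, Matrix.submatrix_mul_equiv,
        Matrix.fromBlocks_multiply, h1, h2]
      simp
    · have h1 := hp.isSelfAdjoint.star_eq
      have h2 := hq.isSelfAdjoint.star_eq
      rw [Matrix.star_eq_conjTranspose] at h1 h2
      simp only [IsSelfAdjoint, Matrix.star_eq_conjTranspose, Matrix.reindex_apply,
        Matrix.conjTranspose_submatrix, Matrix.fromBlocks_conjTranspose, h1, h2,
        Matrix.conjTranspose_zero]⟩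

/-- The relations `[p] = [q]` for Murray--von Neumann equivalent projections and
`[p ⊕ q] = [p] + [q]`. -/
def relSubgroup (B : Type*) [Ring B] [StarRing B] : AddSubgroup (FreeAbelianGroup (Proj B)) :=
  AddSubgroup.closure
    ({x | ∃ p q : Proj B, MvN p q ∧ x = FreeAbelianGroup.of p - FreeAbelianGroup.of q} ∪
     {x | ∃ p q : Proj B, x = FreeAbelianGroup.of (blockSum p q) -
        (FreeAbelianGroup.of p + FreeAbelianGroup.of q)})

/-- `K₀` of a unital `*`-algebra: the Grothendieck group of the monoid of Murray--von Neumann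
classes of projections in matrix algebras, given by generators and relations. -/
abbrev K0Unital (B : Type*) [Ring B] [StarRing B] : Type _ :=
  FreeAbelianGroup (Proj B) ⧸ relSubgroup B

section functoriality

variable {B C : Type*} [Ring B] [StarRing B] [Algebra ℂ B] [Ring C] [StarRing C] [Algebra ℂ C]

lemma conjTranspose_map' {m n : ℕ} (φ : B →⋆ₐ[ℂ] C) (v : Matrix (Fin m) (Fin n) B) :
    (v.map φ).conjTranspose = v.conjTranspose.map φ := by
  ext i j; simp [Matrix.conjTranspose_apply, map_star]

lemma map_mul' {l m n : ℕ} (φ : B →⋆ₐ[ℂ] C) (v : Matrix (Fin l) (Fin m) B)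
    (w : Matrix (Fin m) (Fin n) B) : (v * w).map φ = v.map φ * w.map φ := by
  ext i j; simp [Matrix.mul_apply]

/-- Entrywise application of a unital `*`-homomorphism to projections. -/
def projMap (φ : B →⋆ₐ[ℂ] C) (p : Proj B) : Proj C :=
  ⟨p.1, p.2.1.map φ, by
    refine ⟨?_, ?_⟩
    · rw [IsIdempotentElem, ← map_mul', p.2.2.isIdempotentElem.eq]
    · rw [IsSelfAdjoint, Matrix.star_eq_conjTranspose, conjTranspose_map',
        ← Matrix.star_eq_conjTranspose, p.2.2.isSelfAdjoint.star_eq]⟩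

lemma projMap_blockSum (φ : B →⋆ₐ[ℂ] C) (p q : Proj B) :
    projMap φ (blockSum p q) = blockSum (projMap φ p) (projMap φ q) := by
  refine Sigma.ext rfl (heq_of_eq (Subtype.ext ?_))
  simp only [projMap, blockSum, Matrix.reindex_apply, ← Matrix.submatrix_map,
    Matrix.fromBlocks_map, Matrix.map_zero _ (map_zero φ)]

/-- The map induced on `K₀` by a unital `*`-homomorphism. -/
def K0UnitalMap (φ : B →⋆ₐ[ℂ] C) : K0Unital B →+ K0Unital C :=
  QuotientAddGroup.map _ _ (FreeAbelianGroup.map (projMap φ)) <| by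
    rw [relSubgroup, AddSubgroup.closure_le]
    rintro x (⟨p, q, ⟨v, h1, h2⟩, rfl⟩ | ⟨p, q, rfl⟩)
    · refine AddSubgroup.subset_closure (Or.inl ⟨projMap φ p, projMap φ q, ⟨v.map φ, ?_, ?_⟩, ?_⟩)
      · exact (congrArg (· * v.map φ) (conjTranspose_map' φ v)).trans
          ((map_mul' φ _ v).symm.trans (congrArg (fun M => M.map φ) h1))
      · exact (congrArg (v.map φ * ·) (conjTranspose_map' φ v)).trans
          ((map_mul' φ v _).symm.trans (congrArg (fun M => M.map φ) h2))
      · simp [FreeAbelianGroup.map_of_apply]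
    · refine AddSubgroup.subset_closure (Or.inr ⟨projMap φ p, projMap φ q, ?_⟩)
      simp [FreeAbelianGroup.map_of_apply, projMap_blockSum]

lemma K0UnitalMap_comp {D : Type*} [Ring D] [StarRing D] [Algebra ℂ D] (ψ : C →⋆ₐ[ℂ] D)
    (φ : B →⋆ₐ[ℂ] C) (x : K0Unital B) :
    K0UnitalMap ψ (K0UnitalMap φ x) = K0UnitalMap (ψ.comp φ) x := by
  have h : (K0UnitalMap ψ).comp (K0UnitalMap φ) = K0UnitalMap (ψ.comp φ) := by
    refine QuotientAddGroup.addMonoidHom_ext _ (FreeAbelianGroup.lift_ext _ _ fun p => ?_)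
    rfl
  exact DFunLike.congr_fun h x

end functoriality

section nonunital

variable (A : Type*) [NonUnitalCStarAlgebra A] {A' : Type*} [NonUnitalCStarAlgebra A']

/-- The canonical character `A⁺ → ℂ` of the unitization. -/
def augmentation : Unitization ℂ A →⋆ₐ[ℂ] ℂ :=
  { Unitization.fstHom ℂ A with map_star' := fun _ => rfl }

/-- `K₀` of a not necessarily unital C*-algebra: the kernel of `K₀(A⁺) → K₀(ℂ)`. -/
def K0 : AddSubgroup (K0Unital (Unitization ℂ A)) := (K0UnitalMap (augmentation A)).ker

variable {A}

/-- The map induced on `K₀` by a `*`-homomorphism. -/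
def K0Map (φ : A →⋆ₙₐ[ℂ] A') : K0 A →+ K0 A' :=
  ((K0UnitalMap (Unitization.starMap φ)).comp (K0 A).subtype).codRestrict (K0 A') <| by
    rintro ⟨x, hx⟩
    have hx' : K0UnitalMap (augmentation A) x = 0 := hx
    change K0UnitalMap (augmentation A') (K0UnitalMap (Unitization.starMap φ) x) = 0
    rw [K0UnitalMap_comp]
    have : (augmentation A').comp (Unitization.starMap φ) = augmentation A := by
      ext a
      change (Unitization.starMap φ (a : Unitization ℂ A)).fst = (a : Unitization ℂ A).fst
      rw [Unitization.starMap_inr, Unitization.fst_inr, Unitization.fst_inr]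
    rw [this, hx']

/-- The `*`-homomorphism `C₀(Z, A) → C₀(Z, A')` given by composition with `φ`. -/
def c0Map (Z : Type*) [TopologicalSpace Z] (φ : A →⋆ₙₐ[ℂ] A') :
    C₀(Z, A) →⋆ₙₐ[ℂ] C₀(Z, A') where
  toFun f :=
    have hφ : Continuous φ := AddMonoidHomClass.continuous_of_bound φ 1 fun a => by
      simpa using NonUnitalStarAlgHom.norm_apply_le φ a
    ⟨⟨fun z => φ (f z), hφ.comp (map_continuous f)⟩, by
    have := (hφ.tendsto 0).comp f.zero_at_infty'
    rwa [map_zero] at this⟩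
  map_smul' c f := by ext z; exact map_smul φ c (f z)
  map_zero' := by ext z; exact map_zero φ
  map_add' f g := by ext z; exact map_add φ (f z) (g z)
  map_mul' f g := by ext z; exact map_mul φ (f z) (g z)
  map_star' f := by ext z; exact map_star φ (f z)

/-- `K_n(A) = K₀(Sⁿ A)`, where `Sⁿ A = C₀(ℝⁿ, A)` is the `n`-fold suspension. -/
abbrev K (n : ℕ) (A : Type*) [NonUnitalCStarAlgebra A] : Type _ :=
  K0 C₀(EuclideanSpace ℝ (Fin n), A)

/-- The homomorphism induced on `K_n` by a `*`-homomorphism. -/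
def KMap (n : ℕ) (φ : A →⋆ₙₐ[ℂ] A') : K n A →+ K n A' :=
  K0Map (c0Map (EuclideanSpace ℝ (Fin n)) φ)

end nonunital

end KTheory

/-! ## Modules over spaces with cylindrical ends and their Roe algebras -/

namespace Coarse

set_option linter.unusedSectionVars false

section modules

variable (Γ Z H : Type*) [Group Γ] [MetricSpace Z] [MulAction Γ Z]
  [NormedAddCommGroup H] [InnerProductSpace ℂ H] [CompleteSpace H]

/-- A `Z`-module: an ample covariant representation of `(C₀(Z), Γ)` on the Hilbert space `H`.
As usual, representations are nondegenerate. The function `g` in `covariant` is `γ·f`. -/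
structure GeomModule where
  ρ : C₀(Z, ℂ) →⋆ₙₐ[ℂ] (H →L[ℂ] H)
  U : Γ →* unitary (H →L[ℂ] H)
  covariant : ∀ (γ : Γ) (f g : C₀(Z, ℂ)), (∀ z, g (γ • z) = f z) →
    ρ g = (U γ : H →L[ℂ] H) * ρ f * star (U γ : H →L[ℂ] H)
  nondegenerate : ∀ v : H, (∀ f, ρ f v = 0) → v = 0
  ample : ∀ f : C₀(Z, ℂ), IsCompactOperator (ρ f) → f = 0

variable {Γ Z H}

/-- The subspace `χ_K H` of vectors supported in the closed set `K`: those annihilated by all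
functions vanishing on `K`. -/
def GeomModule.supportedIn (M : GeomModule Γ Z H) (K : Set Z) : Submodule ℂ H where
  carrier := {v | ∀ f : C₀(Z, ℂ), (∀ z ∈ K, f z = 0) → M.ρ f v = 0}
  add_mem' := by
    intro v w hv hw f hf
    rw [map_add, hv f hf, hw f hf, add_zero]
  zero_mem' := by
    intro f _
    rw [map_zero]
  smul_mem' := by
    intro c v hv f hf
    rw [map_smul, hv f hf, smul_zero]

lemma GeomModule.isClosed_supportedIn (M : GeomModule Γ Z H) (K : Set Z) :
    IsClosed (M.supportedIn K : Set H) := by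
  have : (M.supportedIn K : Set H) =
      ⋂ (f : C₀(Z, ℂ)) (_ : ∀ z ∈ K, f z = 0), {v | M.ρ f v = 0} := by
    ext v
    simp [GeomModule.supportedIn]
  rw [this]
  exact isClosed_iInter fun f => isClosed_iInter fun _ =>
    isClosed_eq (M.ρ f).continuous continuous_const

instance (M : GeomModule Γ Z H) (K : Set Z) : CompleteSpace (M.supportedIn K) :=
  (M.isClosed_supportedIn K).completeSpace_coe

/-- The projection `χ_K`, the value of the extension of `ρ` to bounded Borel functions at the
characteristic function of the closed set `K`. -/
def GeomModule.chi (M : GeomModule Γ Z H) (K : Set Z) : H →L[ℂ] H :=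
  (M.supportedIn K).starProjection

lemma GeomModule.supportedIn_mono (M : GeomModule Γ Z H) {K L : Set Z} (h : K ⊆ L) :
    M.supportedIn K ≤ M.supportedIn L :=
  fun _ hv f hf => hv f fun z hz => hf z (h hz)

/-- The subspace `H_c` of vectors with compact support. -/
def GeomModule.compactlySupported (M : GeomModule Γ Z H) : Submodule ℂ H where
  carrier := {v | ∃ K : Set Z, IsCompact K ∧ v ∈ M.supportedIn K}
  add_mem' := by
    rintro v w ⟨K, hK, hv⟩ ⟨L, hL, hw⟩
    exact ⟨K ∪ L, hK.union hL, add_mem (M.supportedIn_mono Set.subset_union_left hv)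
      (M.supportedIn_mono Set.subset_union_right hw)⟩
  zero_mem' := ⟨∅, isCompact_empty, zero_mem _⟩
  smul_mem' := by
    rintro c v ⟨K, hK, hv⟩
    exact ⟨K, hK, Submodule.smul_mem _ c hv⟩

/-- The form `⟨v, w⟩_N = ∑_{n ∈ N} ⟨v, n·w⟩` on `H_c`. By properness of the action only finitely
many terms are nonzero. -/
def GeomModule.form (M : GeomModule Γ Z H) (N : Subgroup Γ) (v w : M.compactlySupported) : ℂ :=
  ∑ᶠ n : N, ⟪(v : H), (M.U (n : Γ) : H →L[ℂ] H) (w : H)⟫_ℂ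

section form

variable (M : GeomModule Γ Z H)

lemma GeomModule.apply_eq_self {K : Set Z} {v : H} (hv : v ∈ M.supportedIn K) (f : C₀(Z, ℂ))
    (hf : ∀ z ∈ K, f z = 1) : M.ρ f v = v := by
  rw [← sub_eq_zero]
  refine M.nondegenerate _ fun g => ?_
  have := hv (g * f - g) fun z hz => by simp [hf z hz]
  rw [map_sub, map_mul] at this
  simpa [map_sub] using this

lemma GeomModule.inner_apply (f : C₀(Z, ℂ)) (v w : H) :
    ⟪M.ρ f v, w⟫_ℂ = ⟪v, M.ρ (star f) w⟫_ℂ := by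
  rw [map_star, ContinuousLinearMap.star_eq_adjoint, ContinuousLinearMap.adjoint_inner_right]

lemma GeomModule.U_mul_apply (γ δ : Γ) (v : H) :
    (M.U (γ * δ) : H →L[ℂ] H) v = (M.U γ : H →L[ℂ] H) ((M.U δ : H →L[ℂ] H) v) := by
  rw [map_mul]; rfl

lemma GeomModule.U_one_apply (v : H) : (M.U 1 : H →L[ℂ] H) v = v := by
  rw [map_one]; rfl

lemma GeomModule.inner_U_left (γ : Γ) (v w : H) :
    ⟪(M.U γ : H →L[ℂ] H) v, w⟫_ℂ = ⟪v, (M.U γ⁻¹ : H →L[ℂ] H) w⟫_ℂ := by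
  have : (M.U γ⁻¹ : H →L[ℂ] H) = star (M.U γ : H →L[ℂ] H) := by
    rw [map_inv, ← Unitary.star_eq_inv, Unitary.coe_star]
  rw [this, ContinuousLinearMap.star_eq_adjoint, ContinuousLinearMap.adjoint_inner_right]

variable [ProperSpace Z] [ContinuousConstSMul Γ Z]

/-- The translate `γ·f`. -/
def translate (γ : Γ) (f : C₀(Z, ℂ)) : C₀(Z, ℂ) :=
  f.comp ⟨⟨fun z => γ⁻¹ • z, continuous_const_smul _⟩,
    (Homeomorph.smul (γ⁻¹ : Γ)).isClosedEmbedding.tendsto_cocompact⟩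

lemma translate_apply (γ : Γ) (f : C₀(Z, ℂ)) (z : Z) : translate γ f z = f (γ⁻¹ • z) := rfl

lemma GeomModule.rho_translate (γ : Γ) (f : C₀(Z, ℂ)) :
    M.ρ (translate γ f) = (M.U γ : H →L[ℂ] H) * M.ρ f * star (M.U γ : H →L[ℂ] H) :=
  M.covariant γ f _ fun z => by rw [translate_apply, inv_smul_smul]

lemma GeomModule.rho_U_apply (γ : Γ) (f : C₀(Z, ℂ)) (v : H) :
    M.ρ f ((M.U γ : H →L[ℂ] H) v) = (M.U γ : H →L[ℂ] H) (M.ρ (translate γ⁻¹ f) v) := by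
  have h : M.ρ f = (M.U γ : H →L[ℂ] H) * M.ρ (translate γ⁻¹ f) * star (M.U γ : H →L[ℂ] H) :=
    M.covariant γ _ _ fun z => by rw [translate_apply, inv_inv]
  rw [h]
  have h2 : star (M.U γ : H →L[ℂ] H) * (M.U γ : H →L[ℂ] H) = 1 :=
    Unitary.coe_star_mul_self _
  change (M.U γ : H →L[ℂ] H) (M.ρ (translate γ⁻¹ f)
    ((star (M.U γ : H →L[ℂ] H) * (M.U γ : H →L[ℂ] H)) v)) = _
  rw [h2]; rfl

lemma GeomModule.U_apply_mem (γ : Γ) {K : Set Z} {v : H} (hv : v ∈ M.supportedIn K) :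
    (M.U γ : H →L[ℂ] H) v ∈ M.supportedIn ((γ • ·) '' K) := by
  intro f hf
  rw [M.rho_U_apply, hv _ fun z hz => ?_, map_zero]
  rw [translate_apply, inv_inv]
  exact hf _ ⟨z, hz, rfl⟩

/-- A compactly supported cutoff function. -/
lemma exists_cutoff {K L : Set Z} (hK : IsCompact K) (hL : IsClosed L) (h : Disjoint K L) :
    ∃ φ : C(Z, ℝ), (∀ z ∈ K, φ z = 1) ∧ (∀ z ∈ L, φ z = 0) ∧ HasCompactSupport φ := by
  obtain ⟨φ, h1, h2, h3, -⟩ := exists_continuous_one_zero_of_isCompact hK hL h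
  exact ⟨φ, fun z hz => h1 hz, fun z hz => h2 hz, h3⟩

/-- A compactly supported continuous real function as an element of `C₀(Z)`. -/
def ofCompact (φ : Z → ℝ) (hc : Continuous φ) (h : HasCompactSupport φ) : C₀(Z, ℂ) where
  toFun z := (φ z : ℂ)
  continuous_toFun := Complex.continuous_ofReal.comp hc
  zero_at_infty' := by
    have : HasCompactSupport (fun z => (φ z : ℂ)) := h.comp_left (g := fun t : ℝ => (t : ℂ)) rfl
    exact this.is_zero_at_infty

lemma GeomModule.inner_eq_zero {K L : Set Z} (hK : IsCompact K) (hL : IsCompact L)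
    (h : Disjoint K L) {v w : H} (hv : v ∈ M.supportedIn K) (hw : w ∈ M.supportedIn L) :
    ⟪v, w⟫_ℂ = 0 := by
  obtain ⟨φ, h1, h2, h3⟩ := exists_cutoff hK hL.isClosed h
  have e : M.ρ (ofCompact φ φ.continuous h3) v = v :=
    M.apply_eq_self hv _ fun z hz => by change ((φ z : ℝ) : ℂ) = 1; rw [h1 z hz]; simp
  rw [← e, M.inner_apply, hw _ fun z hz => ?_, inner_zero_right]
  change star ((φ z : ℝ) : ℂ) = 0
  rw [h2 z hz]; simp

variable [ProperlyDiscontinuousSMul Γ Z]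

lemma finite_meeting (N : Subgroup Γ) {K L : Set Z} (hK : IsCompact K) (hL : IsCompact L) :
    {n : N | ((((n : Γ) • ·) '' K) ∩ L).Nonempty}.Finite :=
  Set.Finite.preimage (f := fun n : N => (n : Γ)) Subtype.val_injective.injOn
    (ProperlyDiscontinuousSMul.finite_disjoint_inter_image (Γ := Γ) hK hL)

lemma GeomModule.form_finite (N : Subgroup Γ) (v w : M.compactlySupported) :
    (fun n : N => ⟪(v : H), (M.U (n : Γ) : H →L[ℂ] H) (w : H)⟫_ℂ).HasFiniteSupport := by
  obtain ⟨v, K, hK, hv⟩ := v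
  obtain ⟨w, L, hL, hw⟩ := w
  refine (finite_meeting N hL hK).subset fun n hn => ?_
  by_contra hne
  refine hn (M.inner_eq_zero hK (hL.image (continuous_const_smul _)) ?_ hv (M.U_apply_mem _ hw))
  rw [Set.disjoint_iff_inter_eq_empty, Set.inter_comm]
  exact Set.not_nonempty_iff_eq_empty.1 hne

/-- For compact `K` there is a function `g` of compact support `⊆ L` with
`∑_{n ∈ N} |g(n⁻¹ z)|² = 1` on `K`. -/
lemma exists_partition (N : Subgroup Γ) {K : Set Z} (hK : IsCompact K) :
    ∃ (g : Z → ℝ) (L : Set Z) (F : Finset N), Continuous g ∧ HasCompactSupport g ∧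
      IsCompact L ∧ K ⊆ L ∧ (∀ z ∉ L, g z = 0) ∧
      (∀ n : N, n ∈ F ↔ ((((n : Γ) • ·) '' L) ∩ L).Nonempty) ∧
      ∀ z ∈ K, ∑ n ∈ F, g ((n : Γ)⁻¹ • z) ^ 2 = 1 := by
  classical
  obtain ⟨φ, h1, -, h3⟩ := exists_cutoff hK isClosed_empty (Set.disjoint_empty K)
  set L := tsupport φ with hLdef
  have hL : IsCompact L := h3
  have hφL : ∀ z ∉ L, φ z = 0 := fun z hz => image_eq_zero_of_notMem_tsupport hz
  have hKL : K ⊆ L := fun z hz => by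
    by_contra hzL
    have := hφL z hzL
    rw [h1 z hz] at this
    exact one_ne_zero this
  set F : Finset N := (finite_meeting N hL hL).toFinset with hFdef
  have hF : ∀ n : N, n ∈ F ↔ ((((n : Γ) • ·) '' L) ∩ L).Nonempty := fun n => by
    rw [hFdef, Set.Finite.mem_toFinset]; rfl
  set σ : Z → ℝ := fun z => ∑ n ∈ F, φ ((n : Γ)⁻¹ • z) ^ 2 with hσ
  have hσc : Continuous σ := continuous_finsetSum _ fun n _ =>
    (φ.continuous.comp (continuous_const_smul _)).pow 2
  have hσfin : ∀ z ∈ L, σ z = ∑ᶠ n : N, φ ((n : Γ)⁻¹ • z) ^ 2 := by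
    intro z hz
    rw [hσ, finsum_eq_sum_of_support_subset]
    intro n hn
    rw [Finset.mem_coe, hF]
    have : (n : Γ)⁻¹ • z ∈ L := by
      by_contra hne
      exact hn (by simp [hφL _ hne])
    exact ⟨z, ⟨_, this, smul_inv_smul _ _⟩, hz⟩
  have hinv : ∀ (m : N) (z : Z), z ∈ L → (m : Γ)⁻¹ • z ∈ L → σ ((m : Γ)⁻¹ • z) = σ z := by
    intro m z hz hmz
    rw [hσfin _ hz, hσfin _ hmz,
      ← finsum_comp_equiv (Equiv.mulLeft m) (f := fun n : N => φ ((n : Γ)⁻¹ • z) ^ 2)]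
    refine finsum_congr fun n => ?_
    simp [mul_smul]
  set g : Z → ℝ := fun z => φ z / √(max (σ z) 1) with hg
  have hpos : ∀ z, 0 < max (σ z) 1 := fun z => lt_max_of_lt_right one_pos
  have hgc : Continuous g := φ.continuous.div ((hσc.max continuous_const).sqrt) fun z =>
    (Real.sqrt_pos.2 (hpos z)).ne'
  have hg0 : ∀ z ∉ L, g z = 0 := fun z hz => by simp [hg, hφL z hz]
  refine ⟨g, L, F, hgc, HasCompactSupport.intro hL hg0, hL, hKL, hg0, hF, fun z hz => ?_⟩
  have hzL := hKL hz
  have hone : (1 : N) ∈ F := (hF 1).2 ⟨z, ⟨z, hzL, by simp⟩, hzL⟩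
  have hσ1 : 1 ≤ σ z := by
    have := Finset.single_le_sum (f := fun n : N => φ ((n : Γ)⁻¹ • z) ^ 2)
      (fun n _ => sq_nonneg _) hone
    simpa [h1 z hz] using this
  have key : ∀ n ∈ F, g ((n : Γ)⁻¹ • z) ^ 2 = φ ((n : Γ)⁻¹ • z) ^ 2 / σ z := by
    intro n _
    by_cases h : (n : Γ)⁻¹ • z ∈ L
    · simp only [hg]
      rw [div_pow, Real.sq_sqrt (hpos _).le, hinv n z hzL h, max_eq_left hσ1]
    · rw [hg0 _ h, hφL _ h]; simp
  rw [Finset.sum_congr rfl key, ← Finset.sum_div]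
  exact div_self (by positivity)

lemma GeomModule.form_self_nonneg (N : Subgroup Γ) (v : M.compactlySupported) :
    0 ≤ (M.form N v v).re := by
  classical
  obtain ⟨v, K, hK, hv⟩ := v
  obtain ⟨g, L, F, hgc, hgs, hL, hKL, hg0, hF, hsum⟩ := exists_partition (Γ := Γ) N hK
  set G := ofCompact g hgc hgs with hG
  have hG_apply : ∀ z, G z = (g z : ℂ) := fun z => rfl
  set a : N → H := fun k => M.ρ G ((M.U (k : Γ) : H →L[ℂ] H) v) with ha
  have hasupp : Function.support a ⊆ F := by
    intro k hk
    rw [Finset.mem_coe, hF]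
    by_contra hne
    refine hk ((M.U_apply_mem (k : Γ) hv) G ?_)
    rintro _ ⟨z, hz, rfl⟩
    have : (k : Γ) • z ∉ L := fun h => hne ⟨_, ⟨z, hKL hz, rfl⟩, h⟩
    simp [hG_apply, hg0 _ this]
  have hFinv : ∀ n, n ∈ F ↔ n⁻¹ ∈ F := by
    have : ∀ n, n ∈ F → n⁻¹ ∈ F := by
      intro n hn
      obtain ⟨_, ⟨z, hz, rfl⟩, hz2⟩ := (hF n).1 hn
      exact (hF _).2 ⟨z, ⟨_, hz2, by simp⟩, hz⟩
    exact fun n => ⟨this n, fun h => by simpa using this _ h⟩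
  -- the identity inserted in front of `v`
  have hid : ∑ m ∈ F, M.ρ (translate (m : Γ) (star G * G)) v = v := by
    have := M.apply_eq_self hv (∑ m ∈ F, translate (m : Γ) (star G * G)) fun z hz => by
      have h : ∀ s : Finset N, (∑ m ∈ s, translate (m : Γ) (star G * G)) z =
          ∑ m ∈ s, ((g ((m : Γ)⁻¹ • z) ^ 2 : ℝ) : ℂ) := by
        intro s
        induction s using Finset.induction_on with
        | empty => simp
        | insert m s hm ih =>
          rw [Finset.sum_insert hm, Finset.sum_insert hm, ZeroAtInftyContinuousMap.add_apply, ih]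
          congr 1
          simp [translate_apply, hG_apply, sq]
      rw [h, ← Complex.ofReal_sum, hsum z hz, Complex.ofReal_one]
    rw [map_sum] at this
    simpa using this
  have hterm : ∀ m n : N, ⟪M.ρ (translate (m : Γ) (star G * G)) v, (M.U (n : Γ) : H →L[ℂ] H) v⟫_ℂ
      = ⟪a m⁻¹, a (m⁻¹ * n)⟫_ℂ := by
    intro m n
    have hs : star (M.U (m : Γ) : H →L[ℂ] H) = (M.U (m : Γ)⁻¹ : H →L[ℂ] H) := by
      rw [map_inv, ← Unitary.star_eq_inv, Unitary.coe_star]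
    rw [M.rho_translate, hs, map_mul]
    change ⟪(M.U (m : Γ) : H →L[ℂ] H) (M.ρ (star G) (M.ρ G ((M.U (m : Γ)⁻¹ : H →L[ℂ] H) v))), _⟫_ℂ
      = _
    rw [M.inner_U_left, M.inner_apply, star_star, ← M.U_mul_apply]
    simp [ha]
  have hform : M.form N ⟨v, K, hK, hv⟩ ⟨v, K, hK, hv⟩ = ⟪∑ᶠ k, a k, ∑ᶠ k, a k⟫_ℂ := by
    have hafin : a.HasFiniteSupport := F.finite_toSet.subset hasupp
    calc M.form N ⟨v, K, hK, hv⟩ ⟨v, K, hK, hv⟩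
        = ∑ᶠ n : N, ∑ m ∈ F, ⟪a m⁻¹, a (m⁻¹ * n)⟫_ℂ := by
          refine finsum_congr fun n => ?_
          rw [← Finset.sum_congr rfl fun m _ => hterm m n, ← sum_inner, hid]
      _ = ∑ m ∈ F, ∑ᶠ n : N, ⟪a m⁻¹, a (m⁻¹ * n)⟫_ℂ := by
          refine finsum_sum_comm F _ fun m _ => ?_
          refine ((hafin.preimage (f := fun n => m⁻¹ * n)
            (mul_right_injective m⁻¹).injOn)).subset fun n hn => ?_
          intro h0
          exact hn (by simp only; rw [h0, inner_zero_right])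
      _ = ∑ m ∈ F, ⟪a m⁻¹, ∑ᶠ k, a k⟫_ℂ := by
          refine Finset.sum_congr rfl fun m _ => ?_
          refine (finsum_comp_equiv (Equiv.mulLeft m⁻¹) (f := fun k => ⟪a m⁻¹, a k⟫_ℂ)).trans ?_
          exact (AddMonoidHom.map_finsum
            (innerSL ℂ (a m⁻¹)).toLinearMap.toAddMonoidHom hafin).symm
      _ = ⟪∑ᶠ k, a k, ∑ᶠ k, a k⟫_ℂ := by
          rw [← sum_inner]
          congr 1
          rw [finsum_eq_sum_of_support_subset a hasupp]
          exact Finset.sum_bij' (fun m _ => m⁻¹) (fun m _ => m⁻¹) (fun m hm => (hFinv m).1 hm)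
            (fun m hm => (hFinv m).1 hm) (by simp) (by simp) (by simp)
  rw [hform]
  exact inner_self_nonneg (𝕜 := ℂ)

/-- The positive semidefinite form `⟨v, w⟩_N` on `H_c`. -/
abbrev GeomModule.core (N : Subgroup Γ) : PreInnerProductSpace.Core ℂ M.compactlySupported where
  inner v w := M.form N v w
  conj_inner_symm v w := by
    refine (AddMonoidHom.map_finsum (starRingEnd ℂ).toAddMonoidHom (M.form_finite N w v)).trans ?_
    rw [GeomModule.form, ← finsum_comp_equiv (Equiv.inv N)]
    refine finsum_congr fun n => ?_
    change (starRingEnd ℂ) _ = _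
    rw [inner_conj_symm, M.inner_U_left]
    simp
  re_inner_nonneg v := M.form_self_nonneg N v
  add_left u v w := by
    rw [GeomModule.form, GeomModule.form, GeomModule.form,
      ← finsum_add_distrib (M.form_finite N u w) (M.form_finite N v w)]
    exact finsum_congr fun n => inner_add_left _ _ _
  smul_left u v c := by
    rw [GeomModule.form, GeomModule.form, mul_finsum]
    exact finsum_congr fun n => inner_smul_left _ _ _

/-- `H_c` with the seminorm given by `⟨v, w⟩_N`. -/
def GeomModule.PreQuot (_ : Subgroup Γ) : Type _ := M.compactlySupported

variable (N : Subgroup Γ)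

instance : AddCommGroup (M.PreQuot N) := inferInstanceAs (AddCommGroup M.compactlySupported)
instance : Module ℂ (M.PreQuot N) := inferInstanceAs (Module ℂ M.compactlySupported)

/-- The form `⟨v, w⟩_N` on `M.PreQuot N`. -/
abbrev GeomModule.preQuotCore : PreInnerProductSpace.Core ℂ (M.PreQuot N) := M.core N

instance : SeminormedAddCommGroup (M.PreQuot N) :=
  InnerProductSpace.Core.toSeminormedAddCommGroup (c := M.preQuotCore N)
instance : InnerProductSpace ℂ (M.PreQuot N) := InnerProductSpace.ofCore (M.preQuotCore N)

/-- The `Z/N`-module `H_N` associated with `H`: the Hausdorff completion of `H_c` with respect to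
`⟨v, w⟩_N`. -/
abbrev GeomModule.Quot : Type _ := UniformSpace.Completion (M.PreQuot N)

variable {N} in
/-- The class in `H_N` of a vector in `H_c`. -/
def GeomModule.toQuot (v : M.compactlySupported) : M.Quot N :=
  ((show M.PreQuot N from v : M.PreQuot N) : UniformSpace.Completion (M.PreQuot N))

/-- The C*-algebra `∏_N B(H_N)` of bounded families, over all normal subgroups `N` of `Γ`, with
norm `sup_N ‖T_N‖`. -/
def GeomModule.QuotProd : Type _ :=
  lp (fun N : {N : Subgroup Γ // N.Normal} => M.Quot N.1 →L[ℂ] M.Quot N.1) ∞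

instance : NonUnitalCStarAlgebra M.QuotProd :=
  inferInstanceAs (NonUnitalCStarAlgebra
    (lp (fun N : {N : Subgroup Γ // N.Normal} => M.Quot N.1 →L[ℂ] M.Quot N.1) ∞))

/-- The component `S_N` of a family `S = (S_N)_N`. -/
def GeomModule.component (S : M.QuotProd) (N : {N : Subgroup Γ // N.Normal}) :
    M.Quot N.1 →L[ℂ] M.Quot N.1 :=
  (S : lp (fun N : {N : Subgroup Γ // N.Normal} => M.Quot N.1 →L[ℂ] M.Quot N.1) ∞).1 N

/-- The family `S = (S_N)_N` consists of the operators `S_N` on `H_N` induced by the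
operator `T` on `H`. -/
def GeomModule.Induces (T : H →L[ℂ] H) (S : M.QuotProd) : Prop :=
  ∀ v : M.compactlySupported, ∃ h : T v ∈ M.compactlySupported,
    ∀ N : {N : Subgroup Γ // N.Normal},
      M.component S N (M.toQuot v) = M.toQuot ⟨T v, h⟩

end form

section operators

variable {Z' H' : Type*} [MetricSpace Z'] [NormedAddCommGroup H'] [InnerProductSpace ℂ H']

/-- The support of an operator `T : H → H'`, for Hilbert spaces on which `C₀(Z)` and `C₀(Z')`
act: the complement of the union of all open `V × W ⊆ Z' × Z` such that `f T g = 0` for all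
`f ∈ C₀(V)`, `g ∈ C₀(W)`. -/
def opSupport (ρ : C₀(Z, ℂ) → (H →L[ℂ] H)) (ρ' : C₀(Z', ℂ) → (H' →L[ℂ] H'))
    (T : H →L[ℂ] H') : Set (Z' × Z) :=
  {p | ∀ (V : Set Z') (W : Set Z), IsOpen V → IsOpen W → p.1 ∈ V → p.2 ∈ W →
    ∃ (f : C₀(Z', ℂ)) (g : C₀(Z, ℂ)), (∀ z ∉ V, f z = 0) ∧ (∀ z ∉ W, g z = 0) ∧
      ρ' f ∘L T ∘L ρ g ≠ 0}

/-- `T : H → H'` covers the map `φ : Z → Z'`: there is `R > 0` with `d(φ(z), z') < R` for all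
`(z', z)` in the support of `T`. -/
def CoversMap (ρ : C₀(Z, ℂ) → (H →L[ℂ] H)) (ρ' : C₀(Z', ℂ) → (H' →L[ℂ] H'))
    (φ : Z → Z') (T : H →L[ℂ] H') : Prop :=
  ∃ R : ℝ, 0 < R ∧ ∀ p ∈ opSupport ρ ρ' T, dist (φ p.2) p.1 < R

variable (M : GeomModule Γ Z H)

/-- `T f` and `f T` are compact for all `f ∈ C₀(Z)`. -/
def GeomModule.LocallyCompact (T : H →L[ℂ] H) : Prop :=
  ∀ f : C₀(Z, ℂ), IsCompactOperator (T * M.ρ f) ∧ IsCompactOperator (M.ρ f * T)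

/-- `f T g = 0` for all `f, g ∈ C₀(Z)` whose supports are at distance greater than `R`. -/
def GeomModule.FinitePropagation (T : H →L[ℂ] H) : Prop :=
  ∃ R : ℝ, 0 < R ∧ ∀ f g : C₀(Z, ℂ),
    (∀ x ∈ Function.support f, ∀ y ∈ Function.support g, R < dist x y) →
      M.ρ f * T * M.ρ g = 0

/-- `T = U_γ^* T U_γ` for all `γ`. -/
def GeomModule.Equivariant (T : H →L[ℂ] H) : Prop :=
  ∀ γ : Γ, T = star (M.U γ : H →L[ℂ] H) * T * (M.U γ : H →L[ℂ] H)

/-- The equivariant algebraic Roe algebra (as a set of operators). -/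
def GeomModule.algRoe : Set (H →L[ℂ] H) :=
  {T | M.LocallyCompact T ∧ M.FinitePropagation T ∧ M.Equivariant T}

end operators

end modules

/-- Bounded geometry of a metric space. -/
def BoundedGeometry (X : Type*) [MetricSpace X] : Prop :=
  ∃ (D : Set X) (c : ℝ), 0 < c ∧ (∀ x, ∃ d ∈ D, dist x d < c) ∧
    ∀ r : ℝ, 0 < r → ∃ N : ℕ, ∀ x, (D ∩ Metric.ball x r).encard < N

/-- A coarse map between metric spaces. -/
structure IsCoarseMap {X X' : Type*} [MetricSpace X] [MetricSpace X'] (f : X → X') : Prop where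
  proper : ∀ B : Set X', Bornology.IsBounded B → Bornology.IsBounded (f ⁻¹' B)
  expansive : ∀ R : ℝ, 0 < R → ∃ S : ℝ, 0 < S ∧ ∀ x y, dist x y < R → dist (f x) (f y) < S

section ends

universe w

/-- A cylindrical end of the `Γ`-space `X`: a `Γ`-invariant subset `Y` (the base) and a
`Γ`-equivariant isometry `ι : Y × [0, ∞) → X` for the product metric, with `ι(y, 0) = y` and
`dist(ι(Y × [R, ∞)), X ∖ Y_∞) → ∞` as `R → ∞`, where `Y_∞` is the image of `ι`. -/
structure CylindricalEnd (Γ X : Type*) [Group Γ] [MetricSpace X] [MulAction Γ X] where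
  base : SubMulAction Γ X
  ι : base → ℝ≥0 → X
  isometry : ∀ y t y' t', dist (ι y t) (ι y' t') = √(dist y y' ^ 2 + dist t t' ^ 2)
  equivariant : ∀ (γ : Γ) y t, ι (γ • y) t = γ • ι y t
  ι_zero : ∀ y, ι y 0 = y
  separated : ∀ C : ℝ, ∃ R : ℝ≥0, ∀ (y : base) (t : ℝ≥0), R ≤ t →
    ∀ x : X, (∀ y' t', ι y' t' ≠ x) → C ≤ dist (ι y t) x

variable {Γ X X' : Type*} [Group Γ] [MetricSpace X] [MulAction Γ X]
  [MetricSpace X'] [MulAction Γ X']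

/-- The part `ι(Y × [R, ∞))` of the end; in particular `E.part 0 = Y_∞`. -/
def CylindricalEnd.part (E : CylindricalEnd Γ X) (R : ℝ≥0) : Set X :=
  {x | ∃ y t, R ≤ t ∧ E.ι y t = x}

/-- A (`Γ`-equivariant) coarse map of spaces with cylindrical ends. -/
structure IsCylindricalCoarseMap (E : CylindricalEnd Γ X) (E' : CylindricalEnd Γ X')
    (f : X → X') : Prop extends IsCoarseMap f where
  equivariant : ∀ (γ : Γ) x, f (γ • x) = γ • f x
  mapsTo_compl : ∀ x, x ∉ E.part 0 → f x ∉ E'.part 0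
  on_end : ∃ g : E.base → E'.base, (∀ y, (g y : X') = f y) ∧ ∀ y t, f (E.ι y t) = E'.ι (g y) t

lemma CylindricalEnd.isometry_slice (E : CylindricalEnd Γ X) (t : ℝ≥0) :
    Isometry fun y => E.ι y t :=
  Isometry.of_dist_eq fun y y' => by
    rw [E.isometry, dist_self, zero_pow two_ne_zero, add_zero, Real.sqrt_sq dist_nonneg]

lemma CylindricalEnd.dist_slice (E : CylindricalEnd Γ X) (y : E.base) (s t : ℝ≥0) :
    dist (E.ι y s) (E.ι y t) = dist s t := by
  rw [E.isometry, dist_self, zero_pow two_ne_zero, zero_add, Real.sqrt_sq dist_nonneg]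

lemma CylindricalEnd.dist_le (E : CylindricalEnd Γ X) (y y' : E.base) (s t : ℝ≥0) :
    dist y y' ≤ dist (E.ι y s) (E.ι y' t) := by
  rw [E.isometry]
  exact Real.le_sqrt_of_sq_le (by nlinarith [sq_nonneg (dist s t)])

lemma CylindricalEnd.isClosed_base [CompleteSpace X] (E : CylindricalEnd Γ X) :
    IsClosed (E.base : Set X) := by
  refine IsSeqClosed.isClosed fun u x hu hx => ?_
  obtain ⟨R, hR⟩ := E.separated 1
  set w : ℕ → E.base := fun k => ⟨u k, hu k⟩ with hw
  have hwc : CauchySeq w := by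
    have := hx.cauchySeq
    rw [Metric.cauchySeq_iff] at this ⊢
    exact this
  have hιc : CauchySeq fun k => E.ι (w k) R := hwc.map (E.isometry_slice R).uniformContinuous
  obtain ⟨z, hz⟩ := cauchySeq_tendsto_of_complete hιc
  by_cases h : ∀ y' t', E.ι y' t' ≠ z
  · have h1 : ∀ k, 1 ≤ dist (E.ι (w k) R) z := fun k => hR (w k) R le_rfl z h
    have h2 := (tendsto_iff_dist_tendsto_zero.1 hz)
    exact absurd (ge_of_tendsto' h2 h1) (by norm_num)
  · push Not at h
    obtain ⟨y', t', rfl⟩ := h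
    have h2 := tendsto_iff_dist_tendsto_zero.1 hz
    have h3 : Filter.Tendsto (fun k => dist (w k) y') Filter.atTop (nhds 0) :=
      squeeze_zero (fun _ => dist_nonneg) (fun k => E.dist_le _ _ _ _) h2
    have h4 : Filter.Tendsto u Filter.atTop (nhds (y' : X)) :=
      tendsto_iff_dist_tendsto_zero.2 h3
    rw [tendsto_nhds_unique hx h4]
    exact y'.2

lemma CylindricalEnd.isClosedEmbedding_slice [CompleteSpace X] (E : CylindricalEnd Γ X)
    (t : ℝ≥0) : Topology.IsClosedEmbedding fun y => E.ι y t := by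
  have : CompleteSpace E.base := E.isClosed_base.completeSpace_coe
  exact (E.isometry_slice t).isClosedEmbedding

/-- The restriction of `F ∈ C₀(X)` to the slice `Y × {t}`. -/
def CylindricalEnd.slice [CompleteSpace X] (E : CylindricalEnd Γ X) (F : C₀(X, ℂ)) (t : ℝ≥0) :
    C₀(E.base, ℂ) :=
  F.comp ⟨⟨fun y => E.ι y t, (E.isometry_slice t).continuous⟩,
    (E.isClosedEmbedding_slice t).tendsto_cocompact⟩

lemma CylindricalEnd.continuous_slice [CompleteSpace X] (E : CylindricalEnd Γ X)
    (F : C₀(X, ℂ)) : Continuous (E.slice F) := by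
  rw [Metric.continuous_iff]
  intro t ε hε
  obtain ⟨δ, hδ, h⟩ := Metric.uniformContinuous_iff.1
    (ZeroAtInftyContinuousMap.uniformContinuous F) (ε / 2) (half_pos hε)
  refine ⟨δ, hδ, fun s hs => ?_⟩
  rw [← ZeroAtInftyContinuousMap.dist_toBCF_eq_dist]
  refine lt_of_le_of_lt ((BoundedContinuousFunction.dist_le (half_pos hε).le).2 fun y => ?_)
    (half_lt_self hε)
  exact (h (lt_of_eq_of_lt (E.dist_slice y s t) hs)).le

lemma CylindricalEnd.norm_slice_le [CompleteSpace X] (E : CylindricalEnd Γ X)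
    (F : C₀(X, ℂ)) (t : ℝ≥0) : ‖E.slice F t‖ ≤ ‖F‖ := by
  rw [← ZeroAtInftyContinuousMap.norm_toBCF_eq_norm,
    ← ZeroAtInftyContinuousMap.norm_toBCF_eq_norm,
    BoundedContinuousFunction.norm_le (norm_nonneg _)]
  exact fun y => F.toBCF.norm_coe_le_norm (E.ι y t)

/-- Lebesgue measure on `ℝ₊ = [0, ∞)`. -/
def lebesgue : MeasureTheory.Measure ℝ≥0 :=
  MeasureTheory.Measure.comap (fun t : ℝ≥0 => (t : ℝ)) MeasureTheory.volume

/-- The Hilbert space `L²(ℝ₊; K)`. -/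
abbrev L2 (K : Type*) [NormedAddCommGroup K] : Type _ :=
  MeasureTheory.Lp K 2 lebesgue

variable {K : Type*} [NormedAddCommGroup K] [InnerProductSpace ℂ K] [CompleteSpace K]

lemma CylindricalEnd.memLp_slice [CompleteSpace X] (E : CylindricalEnd Γ X)
    (MY : GeomModule Γ E.base K) (F : C₀(X, ℂ)) :
    MeasureTheory.MemLp (fun t : ℝ≥0 => MY.ρ (E.slice F t)) ∞ lebesgue := by
  have hρ : Continuous MY.ρ := AddMonoidHomClass.continuous_of_bound MY.ρ 1 fun a => by
    simpa using NonUnitalStarAlgHom.norm_apply_le MY.ρ a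
  refine MeasureTheory.memLp_top_of_bound
    (hρ.comp (E.continuous_slice F)).aestronglyMeasurable ‖F‖ (Filter.Eventually.of_forall fun t =>
      (NonUnitalStarAlgHom.norm_apply_le MY.ρ _).trans (E.norm_slice_le F t))

/-- The standard action of `C₀(X)` on `L²(ℝ₊; H_Y)` for a `Y`-module `H_Y`, through restriction
to `Y_∞ ≅ Y × ℝ₊`: `(F · h)(t) = F(ι(·, t)) · h(t)`. -/
def CylindricalEnd.stdRep [CompleteSpace X] (E : CylindricalEnd Γ X)
    (MY : GeomModule Γ E.base K) (F : C₀(X, ℂ)) : L2 K →L[ℂ] L2 K :=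
  (ContinuousLinearMap.id ℂ (K →L[ℂ] K)).holderL lebesgue ∞ 2 2
    (E.memLp_slice MY F).toLp

/-- An `X`-module tailored to the end. In `translation`, `F` restricted to `ι(Y × [s, ∞))` is the
translate `L_s` of the restriction of `G` to `Y_∞`, so the condition says
`ρ(L_s g) P_s = P_s ρ(g)` for `g ∈ C₀(Y_∞)`. -/
structure TailoredModule [CompleteSpace X] (E : CylindricalEnd Γ X) (H : Type w)
    [NormedAddCommGroup H] [InnerProductSpace ℂ H] [CompleteSpace H]
    extends GeomModule Γ X H where
  P : ℝ≥0 → H →L[ℂ] H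
  continuous_P : ∀ v, Continuous fun s => P s v
  star_P_mul_P : ∀ s, 0 < s → star (P s) * P s = toGeomModule.chi (E.part 0)
  P_mul_star_P : ∀ s, 0 < s → P s * star (P s) = toGeomModule.chi (E.part s)
  translation : ∀ (s : ℝ≥0) (F G : C₀(X, ℂ)), (∀ y t, F (E.ι y (t + s)) = G (E.ι y t)) →
    ρ F * P s = P s * ρ G
  /-- For some `Y`-module `H_Y` there is a `Γ`-equivariant unitary
  `W : χ_{Y_∞} H → L²(ℝ₊; H_Y)` (extended by zero to `H`) which covers the identity and
  satisfies `W P_s = P_s^st W`. -/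
  standard : ∃ (K : Type w) (_ : NormedAddCommGroup K) (_ : InnerProductSpace ℂ K)
    (_ : CompleteSpace K) (MY : GeomModule Γ E.base K) (W : H →L[ℂ] L2 K),
    (ContinuousLinearMap.adjoint W) ∘L W = toGeomModule.chi (E.part 0) ∧
    W ∘L (ContinuousLinearMap.adjoint W) = ContinuousLinearMap.id ℂ (L2 K) ∧
    (∀ γ : Γ, W ∘L (U γ : H →L[ℂ] H) =
      (ContinuousLinearMap.compLpL 2 lebesgue (MY.U γ : K →L[ℂ] K)) ∘L W) ∧
    CoversMap ρ (E.stdRep MY) id W ∧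
    ∀ (s : ℝ≥0) (v : H), ∀ᵐ t ∂lebesgue, (W (P s v)) t = if s ≤ t then (W v) (t - s) else 0

end ends

section roe

variable {Γ X X' H H' : Type*} [Group Γ] [MetricSpace X] [ProperSpace X] [MulAction Γ X]
  [IsIsometricSMul Γ X] [ProperlyDiscontinuousSMul Γ X]
  [MetricSpace X'] [ProperSpace X'] [MulAction Γ X']
  [IsIsometricSMul Γ X'] [ProperlyDiscontinuousSMul Γ X']
  [NormedAddCommGroup H] [InnerProductSpace ℂ H] [CompleteSpace H]
  [NormedAddCommGroup H'] [InnerProductSpace ℂ H'] [CompleteSpace H']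
  {E : CylindricalEnd Γ X} {E' : CylindricalEnd Γ X'}

/-- `lim_{R → ∞} sup_{s > 0} ‖(P_s^* T P_s - T) χ_{ι(Y × [R, ∞))}‖ = 0`. -/
def TailoredModule.AsymptoticallyInvariant (M : TailoredModule E H) (T : H →L[ℂ] H) : Prop :=
  ∀ ε : ℝ, 0 < ε → ∃ R₀ : ℝ≥0, ∀ R, R₀ ≤ R → ∀ s, 0 < s →
    ‖(star (M.P s) * T * M.P s - T) * M.chi (E.part R)‖ ≤ ε

/-- The equivariant algebraic Roe algebra tailored to the end (as a set of operators). -/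
def TailoredModule.algRoeEnd (M : TailoredModule E H) : Set (H →L[ℂ] H) :=
  {T | T ∈ M.algRoe ∧ M.AsymptoticallyInvariant T}

/-- The equivariant Roe algebra `C*(X)^{Γ,ℝ₊}` tailored to the end, for the quotient completion:
the closure of the algebraic one in the norm `‖T‖ = sup_N ‖T_N‖`, where `N` runs over the normal
subgroups of `Γ` and `T_N` is the operator induced by `T` on `H_N`. -/
def TailoredModule.roeSubalgebra (M : TailoredModule E H) :
    NonUnitalStarSubalgebra ℂ M.QuotProd :=
  (NonUnitalStarAlgebra.adjoin ℂ
    {S : M.QuotProd | ∃ T ∈ M.algRoeEnd, M.Induces T S}).topologicalClosure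

instance (M : TailoredModule E H) : IsClosed (M.roeSubalgebra : Set M.QuotProd) :=
  NonUnitalStarSubalgebra.isClosed_topologicalClosure _

/-- The C*-algebra `C*(X)^{Γ,ℝ₊}` as a type. -/
def TailoredModule.Roe (M : TailoredModule E H) : Type _ := M.roeSubalgebra

instance (M : TailoredModule E H) : NonUnitalCStarAlgebra M.Roe :=
  inferInstanceAs (NonUnitalCStarAlgebra M.roeSubalgebra)

/-- The element `S` of `C*(X)^{Γ,ℝ₊}` is the class of the operator `T`. -/
def TailoredModule.IsClassOf (M : TailoredModule E H) (S : M.Roe) (T : H →L[ℂ] H) : Prop :=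
  M.Induces T (S : M.roeSubalgebra).1

/-- The isometry `V : H → H'` covers the map `f` of spaces with cylindrical ends. -/
structure Covers (M : TailoredModule E H) (M' : TailoredModule E' H') (f : X → X')
    (V : H →ₗᵢ[ℂ] H') : Prop where
  equivariant : ∀ γ v, V ((M.U γ : H →L[ℂ] H) v) = (M'.U γ : H' →L[ℂ] H') (V v)
  covers : CoversMap M.ρ M'.ρ f V.toContinuousLinearMap
  intertwines : ∀ s v, V (M.P s v) = M'.P s (V v)

/-- Conjugation `T ↦ V T V^*`. -/
def conj (V : H →ₗᵢ[ℂ] H') (T : H →L[ℂ] H) : H' →L[ℂ] H' :=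
  V.toContinuousLinearMap ∘L T ∘L ContinuousLinearMap.adjoint V.toContinuousLinearMap

/-- The `*`-homomorphism `Φ` between Roe algebras is given on the algebraic Roe algebra by
conjugation by `V`. -/
def IsConjugation (M : TailoredModule E H) (M' : TailoredModule E' H') (V : H →ₗᵢ[ℂ] H')
    (Φ : M.Roe →⋆ₙₐ[ℂ] M'.Roe) : Prop :=
  ∀ T ∈ M.algRoeEnd, ∀ S : M.Roe, M.IsClassOf S T → M'.IsClassOf (Φ S) (conj V T)

end roe

end Coarse
end

/-!
# Functoriality of the equivariant Roe algebra tailored to a cylindrical end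

**Existence of covering isometries.** Choose an invariant net in the source and an equivariant
partition `∑_p φ_p² = 1` subordinate to the balls around its points. Ampleness and freeness of the
action on the target give isometries `W_p` of `H` into `H'`, with mutually orthogonal ranges and
equivariant in `p`, which are located near the images of these points. Then `v ↦ ∑_p W_p ρ(φ_p) v` is an equivariant isometry covering the given map
(`Coarse.exists_covering_operator`). For spaces with cylindrical ends this is applied twice. On the
bases it yields `V_Y`, and `1 ⊗ V_Y` on `L²(ℝ₊; H_Y)` commutes with translations. On the open
complements of the ends it yields an isometry with values over the complement of the end, which the
translations do not see. The orthogonal sum of the two is the isometry sought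
(`Coarse.exists_covers`).

**Conjugation.** Let `V` and `W` be isometries covering `f`. Then `T ↦ V T W^*` preserves local
compactness because `f` is proper, and finite propagation because `f` expands distances in a
controlled way. For asymptotic invariance the point is that `W^*` and `T` move supports by a bounded
amount, so that far out in the end `W^*` intertwines the translations `P_s` and `V` intertwines
their adjoints (`Coarse.conjPair_mem_algRoeEnd`). The isometries preserve compactly
supported vectors and the forms `⟨·, ·⟩_N`, hence induce isometries `V_N` of the quotient modules,
and `S ↦ (V_N S_N W_N^*)_N` extends the conjugation to the completions (`Coarse.roeConj`). The
extension is unique since the induced operators are determined on compactly supported vectors and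
`*`-homomorphisms of C*-algebras are continuous (`Coarse.IsConjugation.unique`).

**K-theory.** For two isometries `V_0`, `V_1` covering `f`, the maps `φ_ij(a) = V_i a V_j^*` satisfy
`φ_ik(a) φ_kj(b) = φ_ij(ab)`. For every unit vector `c ∈ ℝ²` the matrices `(c_i c_j φ_ij(a))_ij`
therefore define a `*`-homomorphism to the `2 × 2`-matrices, conjugation by the column
`(c_0 V_0, c_1 V_1)`. Rotating `c` from `(1, 0)` to `(0, 1)` gives a path of projections from
`Ad_{V_0}(p) ⊕ p₀` to `p₀ ⊕ Ad_{V_1}(p)`, where `p₀` is the scalar part of `p`. Homotopic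
projections have the same class in `K₀`, so `Ad_{V_0}` and `Ad_{V_1}` agree in K-theory
(`KTheory.KMap_eq_of_linking`). No unit or multiplier algebra is needed. For isometries
`H → H₂ → H` covering the identity, the composition covers the identity like `1` does, so the
induced maps in K-theory are mutually inverse (`Coarse.KMap_KMap_eq_self`).
-/

noncomputable section

/-! ### Homotopy invariance of `K₀` -/

namespace KTheory

/-- Two projections in a C*-algebra at distance less than one are Murray--von Neumann equivalent:
with `h = (p - q)²`, which commutes with `p` and `q`, the partial isometry is
`q p (1 - h)^{-1/2}`. -/
lemma exists_mvN_of_norm_sub_lt_one {D : Type*} [CStarAlgebra D] {p q : D}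
    (hp : IsStarProjection p) (hq : IsStarProjection q) (h : ‖p - q‖ < 1) :
    ∃ v : D, star v * v = p ∧ v * star v = q := by
  rcases subsingleton_or_nontrivial D with _ | _
  · exact ⟨0, Subsingleton.elim _ _, Subsingleton.elim _ _⟩
  have hpp : p * p = p := hp.isIdempotentElem.eq
  have hqq : q * q = q := hq.isIdempotentElem.eq
  have hps : star p = p := hp.isSelfAdjoint.star_eq
  have hqs : star q = q := hq.isSelfAdjoint.star_eq
  set e : D := (p - q) * (p - q) with he
  have hes : IsSelfAdjoint e := by
    rw [IsSelfAdjoint, he, star_mul, star_sub, hps, hqs]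
  have hen : ‖e‖ < 1 := by
    refine (norm_mul_le _ _).trans_lt ?_
    nlinarith [norm_nonneg (p - q)]
  have e1 : e = p - p * q - q * p + q := by rw [he]; noncomm_ring [hpp, hqq]
  have hpe : p * e = p - p * q * p := by
    rw [e1]; simp only [mul_add, mul_sub, ← mul_assoc, hpp]; abel
  have hep : e * p = p - p * q * p := by
    rw [e1]; simp only [add_mul, sub_mul, mul_assoc, hpp]; abel
  have hqe : q * e = q - q * p * q := by
    rw [e1]; simp only [mul_add, mul_sub, ← mul_assoc, hqq]; abel
  have heq : e * q = q - q * p * q := by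
    rw [e1]; simp only [add_mul, sub_mul, mul_assoc, hqq]; abel
  have hlt : ∀ x ∈ spectrum ℝ e, x < 1 := fun x hx =>
    (le_abs_self x).trans_lt ((spectrum.norm_le_norm_of_mem hx).trans_lt hen)
  set g : ℝ → ℝ := fun x => (√(1 - x))⁻¹ with hg
  have hgc : ContinuousOn g (spectrum ℝ e) := by
    refine ContinuousOn.inv₀ (by fun_prop) fun x hx => ?_
    exact (Real.sqrt_pos.2 (sub_pos.2 (hlt x hx))).ne'
  set d : D := cfc g e with hd
  have hds : star d = d := (cfc_predicate (p := IsSelfAdjoint) g e).star_eq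
  have hdp : Commute d p := (show Commute e p from hep.trans hpe.symm).cfc_real g
  have hdq : Commute d q := (show Commute e q from heq.trans hqe.symm).cfc_real g
  have hdd : d * d * (1 - e) = 1 := by
    have h1 : cfc (fun x : ℝ => 1 - x) e = 1 - e := by
      rw [cfc_sub (fun _ => 1) (fun x => x) e, cfc_const_one ℝ e, cfc_id' ℝ e]
    rw [hd, ← h1, ← cfc_mul g g e, ← cfc_mul (fun x => g x * g x) (fun x => 1 - x) e,
      ← cfc_const_one ℝ e]
    refine cfc_congr fun x hx => ?_
    have := sub_pos.2 (hlt x hx)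
    simp only [hg]
    rw [← mul_inv, Real.mul_self_sqrt this.le, inv_mul_cancel₀ this.ne']
  have hpc : p * q * p = (1 - e) * p := by rw [sub_mul, one_mul, hep, sub_sub_cancel]
  have hqc : q * p * q = (1 - e) * q := by rw [sub_mul, one_mul, heq, sub_sub_cancel]
  have cp : ∀ x, p * (d * x) = d * (p * x) := fun x => by
    rw [← mul_assoc, ← hdp.eq, mul_assoc]
  have cq : ∀ x, q * (d * x) = d * (q * x) := fun x => by
    rw [← mul_assoc, ← hdq.eq, mul_assoc]
  have hpp' : ∀ x, p * (p * x) = p * x := fun x => by rw [← mul_assoc, hpp]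
  have hqq' : ∀ x, q * (q * x) = q * x := fun x => by rw [← mul_assoc, hqq]
  refine ⟨q * p * d, ?_, ?_⟩
  · calc star (q * p * d) * (q * p * d) = d * d * (p * q * p) := by
          rw [star_mul, star_mul, hds, hps, hqs]
          simp only [mul_assoc, hqq', cp, cq, ← hdp.eq]
      _ = p := by rw [hpc, ← mul_assoc, hdd, one_mul]
  · calc q * p * d * star (q * p * d) = d * d * (q * p * q) := by
          rw [star_mul, star_mul, hds, hps, hqs]
          simp only [mul_assoc, hpp', cp, cq]
      _ = q := by rw [hqc, ← mul_assoc, hdd, one_mul]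

section classes

variable {B : Type*} [Ring B] [StarRing B]

/-- The class in `K₀` of a projection. -/
def cls (p : Proj B) : K0Unital B := QuotientAddGroup.mk (FreeAbelianGroup.of p)

lemma cls_eq_of_mvN {p q : Proj B} (h : MvN p q) : cls p = cls q := by
  rw [cls, cls, QuotientAddGroup.eq_iff_sub_mem]
  exact AddSubgroup.subset_closure (Or.inl ⟨p, q, h, rfl⟩)

lemma cls_blockSum (p q : Proj B) : cls (blockSum p q) = cls p + cls q := by
  rw [cls, cls, cls, ← QuotientAddGroup.mk_add, QuotientAddGroup.eq_iff_sub_mem]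
  exact AddSubgroup.subset_closure (Or.inr ⟨p, q, rfl⟩)

end classes

/-- Homotopic projections have the same class in `K₀`. -/
lemma cls_eq_of_path {B : Type*} [CStarAlgebra B] {n : ℕ}
    (Q : ℝ → Matrix (Fin n) (Fin n) B) (hQ : Continuous Q) (hproj : ∀ t, IsStarProjection (Q t))
    (s t : ℝ) : cls (⟨n, Q s, hproj s⟩ : Proj B) = cls ⟨n, Q t, hproj t⟩ := by
  -- the order is needed for the C*-norm on matrices, whose topology is the entrywise one
  let : PartialOrder B := CStarAlgebra.spectralOrder B
  have : StarOrderedRing B := CStarAlgebra.spectralOrderedRing B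
  have hQ' : Continuous (fun t => CStarMatrix.ofMatrix (Q t)) := hQ
  have hloc : IsLocallyConstant fun t => cls (⟨n, Q t, hproj t⟩ : Proj B) := by
    rw [IsLocallyConstant.iff_eventually_eq]
    intro x
    filter_upwards [(Metric.continuous_iff'.1 hQ') x 1 one_pos] with y hy
    rw [dist_eq_norm] at hy
    obtain ⟨v, h1, h2⟩ := exists_mvN_of_norm_sub_lt_one
      (p := CStarMatrix.ofMatrix (Q y)) (q := CStarMatrix.ofMatrix (Q x))
      ⟨(hproj y).1, (hproj y).2⟩ ⟨(hproj x).1, (hproj x).2⟩ hy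
    exact cls_eq_of_mvN ⟨v, h1, h2⟩
  exact hloc.apply_eq_of_preconnectedSpace s t

section linking

lemma starMap_apply {A J : Type*} [NonUnitalCStarAlgebra A] [NonUnitalCStarAlgebra J]
    (φ : A →⋆ₙₐ[ℂ] J) (x : Unitization ℂ A) :
    Unitization.starMap φ x = Unitization.inl x.fst + (φ x.snd : Unitization ℂ J) := by
  conv_lhs => rw [← Unitization.inl_fst_add_inr_snd_eq x]
  rw [map_add, Unitization.starMap_inr, Unitization.starMap_inl]
  rfl

variable {A J : Type*} [NonUnitalCStarAlgebra A] [NonUnitalCStarAlgebra J]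
  (φ : Bool → Bool → A →ₗ[ℂ] J)

/-- The entries of the unital `*`-homomorphism `A⁺ → M₂(J⁺)`, `1 ↦ 1`,
`a ↦ (c_i c_j φ_ij(a))_{ij}`. -/
def linkEntry (c : Bool → ℝ) (i j : Bool) (x : Unitization ℂ A) : Unitization ℂ J :=
  Unitization.inl (if i = j then x.fst else 0) +
    (((c i * c j : ℂ) • φ i j x.snd : J) : Unitization ℂ J)

variable {φ}

/-- The entries are those of a multiplicative map as `c` is a unit vector:
`∑_k c_i c_k φ_ik(a) c_k c_j φ_kj(b) = c_i c_j φ_ij(ab)`. -/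
lemma linkEntry_mul (hmul : ∀ i k j a b, φ i k a * φ k j b = φ i j (a * b)) {c : Bool → ℝ}
    (hc : c false ^ 2 + c true ^ 2 = 1) (i j : Bool) (x y : Unitization ℂ A) :
    linkEntry φ c i false x * linkEntry φ c false j y
      + linkEntry φ c i true x * linkEntry φ c true j y = linkEntry φ c i j (x * y) := by
  have hc' : (c false : ℂ) * c false + c true * c true = 1 := by
    rw [← sq, ← sq]; exact_mod_cast hc
  have key : ((c i * c false : ℂ) * (c false * c j) + (c i * c true) * (c true * c j))
      = c i * c j := by linear_combination (c i * c j : ℂ) * hc'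
  ext
  · cases i <;> cases j <;> simp [linkEntry]
  · simp only [linkEntry, Unitization.snd_add, Unitization.snd_mul, Unitization.snd_inl,
      Unitization.snd_inr, Unitization.fst_add, Unitization.fst_inl, Unitization.fst_inr, zero_add,
      add_zero, map_add, map_smul, Unitization.fst_mul, smul_mul_smul_comm, hmul]
    have hφ := congrArg (· • φ i j (x.snd * y.snd)) key
    cases i <;> cases j <;>
      simp only [if_true, if_false, Bool.false_eq_true, reduceCtorEq] at hφ ⊢ <;>
      linear_combination (norm := module) hφ

lemma linkEntry_star (hstar : ∀ i j a, star (φ i j a) = φ j i (star a)) (c : Bool → ℝ)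
    (i j : Bool) (x : Unitization ℂ A) :
    star (linkEntry φ c i j x) = linkEntry φ c j i (star x) := by
  ext
  · cases i <;> cases j <;> simp [linkEntry]
  · simp [linkEntry, star_smul, hstar, mul_comm]

lemma linkEntry_sum {ι : Type*} (c : Bool → ℝ) (i j : Bool) (s : Finset ι)
    (x : ι → Unitization ℂ A) :
    linkEntry φ c i j (∑ k ∈ s, x k) = ∑ k ∈ s, linkEntry φ c i j (x k) := by
  have hadd : ∀ x y, linkEntry φ c i j (x + y) = linkEntry φ c i j x + linkEntry φ c i j y := by
    intro x y
    ext
    · cases i <;> cases j <;> simp [linkEntry]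
    · simp [linkEntry]
  have h0 : linkEntry φ c i j 0 = 0 := by simpa using hadd 0 0
  exact map_sum (⟨⟨linkEntry φ c i j, h0⟩, hadd⟩ : Unitization ℂ A →+ Unitization ℂ J) x s

lemma map_linkEntry_mul (hmul : ∀ i k j a b, φ i k a * φ k j b = φ i j (a * b)) {c : Bool → ℝ}
    (hc : c false ^ 2 + c true ^ 2 = 1) (i j : Bool) {n : ℕ}
    (p q : Matrix (Fin n) (Fin n) (Unitization ℂ A)) :
    p.map (linkEntry φ c i false) * q.map (linkEntry φ c false j)
      + p.map (linkEntry φ c i true) * q.map (linkEntry φ c true j)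
      = (p * q).map (linkEntry φ c i j) := by
  refine Matrix.ext fun k l => ?_
  simp only [Matrix.add_apply, Matrix.mul_apply, Matrix.map_apply, linkEntry_sum,
    ← Finset.sum_add_distrib, linkEntry_mul hmul hc]

variable (φ) in
/-- The image in `M_{2n}(J⁺)` of a matrix in `M_n(A⁺)`. -/
def linkMatrix (c : Bool → ℝ) {n : ℕ} (p : Matrix (Fin n) (Fin n) (Unitization ℂ A)) :
    Matrix (Fin (n + n)) (Fin (n + n)) (Unitization ℂ J) :=
  Matrix.reindex finSumFinEquiv finSumFinEquiv
    (Matrix.fromBlocks (p.map (linkEntry φ c false false)) (p.map (linkEntry φ c false true))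
      (p.map (linkEntry φ c true false)) (p.map (linkEntry φ c true true)))

lemma isStarProjection_linkMatrix (hmul : ∀ i k j a b, φ i k a * φ k j b = φ i j (a * b))
    (hstar : ∀ i j a, star (φ i j a) = φ j i (star a)) {c : Bool → ℝ}
    (hc : c false ^ 2 + c true ^ 2 = 1) {n : ℕ} {p : Matrix (Fin n) (Fin n) (Unitization ℂ A)}
    (hp : IsStarProjection p) : IsStarProjection (linkMatrix φ c p) := by
  have hs : ∀ i j, (p.map (linkEntry φ c i j)).conjTranspose = p.map (linkEntry φ c j i) := by
    intro i j
    have h := hp.isSelfAdjoint.star_eq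
    refine Matrix.ext fun k l => ?_
    conv_rhs => rw [← h]
    simp [Matrix.conjTranspose_apply, linkEntry_star hstar]
  refine ⟨?_, ?_⟩
  · simp only [IsIdempotentElem, linkMatrix, Matrix.reindex_apply, Matrix.submatrix_mul_equiv,
      Matrix.fromBlocks_multiply, map_linkEntry_mul hmul hc, hp.isIdempotentElem.eq]
  · simp only [IsSelfAdjoint, Matrix.star_eq_conjTranspose, linkMatrix, Matrix.reindex_apply,
      Matrix.conjTranspose_submatrix, Matrix.fromBlocks_conjTranspose, hs]

/-- If `φ_ij(a) = V_i a V_j^*` behave like the corners of conjugation by a pair of isometries,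
then the two `*`-homomorphisms `φ_00` and `φ_11` agree on `K₀`. Rotating the pair `(V_0, 0)` into
`(0, V_1)` gives, for a projection `p` over `A⁺` with scalar part `p₀`, a path of projections
from `φ_00(p) ⊕ p₀` to `p₀ ⊕ φ_11(p)`. -/
theorem K0Map_eq_of_linking (hmul : ∀ i k j a b, φ i k a * φ k j b = φ i j (a * b))
    (hstar : ∀ i j a, star (φ i j a) = φ j i (star a)) (Φ : Bool → A →⋆ₙₐ[ℂ] J)
    (hΦ : ∀ i a, Φ i a = φ i i a) : K0Map (Φ false) = K0Map (Φ true) := by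
  have key : K0UnitalMap (Unitization.starMap (Φ false))
      = K0UnitalMap (Unitization.starMap (Φ true)) := by
    refine QuotientAddGroup.addMonoidHom_ext _ (FreeAbelianGroup.lift_ext _ _ fun p => ?_)
    change cls (projMap (Unitization.starMap (Φ false)) p)
      = cls (projMap (Unitization.starMap (Φ true)) p)
    set c : ℝ → Bool → ℝ := fun t i => if i then Real.sin t else Real.cos t with hc
    have hc1 : ∀ t, c t false ^ 2 + c t true ^ 2 = 1 := fun t => by simp [hc]
    obtain ⟨n, p, hp⟩ := p
    set p₀ : Proj (Unitization ℂ J) :=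
      projMap (Unitization.starMap (0 : A →⋆ₙₐ[ℂ] J)) ⟨n, p, hp⟩ with hp₀
    have hpath := cls_eq_of_path (fun t => linkMatrix φ (c t) p) (by
      refine Continuous.matrix_reindex (Continuous.matrix_fromBlocks ?_ ?_ ?_ ?_) _ _ <;>
      · refine continuous_matrix fun k l => ?_
        simp only [Matrix.map_apply, linkEntry, hc]
        refine continuous_const.add
          ((Unitization.isometry_inr (𝕜 := ℂ) (A := J)).continuous.comp ?_)
        simp only [if_true, if_false, Bool.false_eq_true]
        fun_prop) (fun t => isStarProjection_linkMatrix hmul hstar (hc1 t) hp) 0 (Real.pi / 2)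
    -- the blocks of the matrix at the two ends of the path
    have hmain : ∀ t i, c t i ^ 2 = 1 →
        p.map (linkEntry φ (c t) i i) = p.map (Unitization.starMap (Φ i)) := by
      intro t i h
      have h' : (c t i : ℂ) * c t i = 1 := by rw [← sq]; exact_mod_cast h
      refine Matrix.ext fun k l => ?_
      rw [Matrix.map_apply, Matrix.map_apply, starMap_apply, linkEntry, h', if_pos rfl, one_smul,
        hΦ]
    have hzero : ∀ t i, c t i = 0 → p.map (linkEntry φ (c t) i i)
        = p.map (Unitization.starMap (0 : A →⋆ₙₐ[ℂ] J)) := by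
      intro t i h
      refine Matrix.ext fun k l => ?_
      rw [Matrix.map_apply, Matrix.map_apply, starMap_apply, linkEntry, h, if_pos rfl,
        NonUnitalStarAlgHom.zero_apply]
      simp
    have hoff : ∀ t i j, i ≠ j → (c t i * c t j : ℂ) = 0 → p.map (linkEntry φ (c t) i j) = 0 := by
      intro t i j h h0
      refine Matrix.ext fun k l => ?_
      rw [Matrix.map_apply, linkEntry, h0, if_neg h]
      simp
    have e0 : (⟨n + n, linkMatrix φ (c 0) p, isStarProjection_linkMatrix hmul hstar (hc1 0) hp⟩ :
        Proj (Unitization ℂ J)) =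
        blockSum (projMap (Unitization.starMap (Φ false)) ⟨n, p, hp⟩) p₀ := by
      refine Sigma.ext rfl (heq_of_eq (Subtype.ext ?_))
      simp only [linkMatrix, blockSum]
      rw [hmain 0 false (by simp [hc]), hzero 0 true (by simp [hc]),
        hoff 0 false true (by simp) (by simp [hc]), hoff 0 true false (by simp) (by simp [hc])]
      rfl
    have e1 : (⟨n + n, linkMatrix φ (c (Real.pi / 2)) p,
        isStarProjection_linkMatrix hmul hstar (hc1 _) hp⟩ : Proj (Unitization ℂ J))
        = blockSum p₀ (projMap (Unitization.starMap (Φ true)) ⟨n, p, hp⟩) := by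
      refine Sigma.ext rfl (heq_of_eq (Subtype.ext ?_))
      simp only [linkMatrix, blockSum]
      rw [hmain _ true (by simp [hc]), hzero _ false (by simp [hc]),
        hoff _ false true (by simp) (by simp [hc]), hoff _ true false (by simp) (by simp [hc])]
      rfl
    rw [e0, e1, cls_blockSum, cls_blockSum, add_comm] at hpath
    exact add_left_cancel hpath
  refine AddMonoidHom.ext fun x => Subtype.ext ?_
  exact DFunLike.congr_fun key x.1

end linking

section functorial

variable {A B C : Type*} [NonUnitalCStarAlgebra A] [NonUnitalCStarAlgebra B]
  [NonUnitalCStarAlgebra C]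

lemma KMap_comp (n : ℕ) (ψ : B →⋆ₙₐ[ℂ] C) (φ : A →⋆ₙₐ[ℂ] B) (x : K n A) :
    KMap n (ψ.comp φ) x = KMap n ψ (KMap n φ x) := by
  refine Subtype.ext ?_
  change K0UnitalMap _ _ = K0UnitalMap _ (K0UnitalMap _ _)
  rw [K0UnitalMap_comp, ← Unitization.starMap_comp]
  rfl

lemma KMap_id (n : ℕ) (x : K n A) : KMap n (NonUnitalStarAlgHom.id ℂ A) x = x := by
  have h : K0UnitalMap (Unitization.starMap
      (c0Map (EuclideanSpace ℝ (Fin n)) (NonUnitalStarAlgHom.id ℂ A))) = AddMonoidHom.id _ := by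
    refine QuotientAddGroup.addMonoidHom_ext _ (FreeAbelianGroup.lift_ext _ _ fun p => ?_)
    change cls (projMap _ p) = cls p
    congr 1
    refine Sigma.ext rfl (heq_of_eq (Subtype.ext ?_))
    refine Matrix.ext fun k l => ?_
    exact DFunLike.congr_fun (Unitization.starMap_id (R := ℂ) (B := C₀(_, A))) (p.2.1 k l)
  exact Subtype.ext (DFunLike.congr_fun h x.1)

end functorial

/-- The same for `K_n`, with `φ_ij` applied pointwise to functions with values in `A`. -/
theorem KMap_eq_of_linking {A J : Type*} [NonUnitalCStarAlgebra A] [NonUnitalCStarAlgebra J]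
    {φ : Bool → Bool → A →L[ℂ] J} (hmul : ∀ i k j a b, φ i k a * φ k j b = φ i j (a * b))
    (hstar : ∀ i j a, star (φ i j a) = φ j i (star a)) (Φ : Bool → A →⋆ₙₐ[ℂ] J)
    (hΦ : ∀ i a, Φ i a = φ i i a) (n : ℕ) : KMap n (Φ false) = KMap n (Φ true) := by
  let ψ : Bool → Bool → C₀(EuclideanSpace ℝ (Fin n), A) →ₗ[ℂ] C₀(EuclideanSpace ℝ (Fin n), J) :=
    fun i j =>
    { toFun f := ⟨⟨fun z => φ i j (f z), (φ i j).continuous.comp (map_continuous f)⟩, by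
        have := ((φ i j).continuous.tendsto 0).comp f.zero_at_infty'
        rwa [map_zero] at this⟩
      map_add' f g := by ext z; exact map_add (φ i j) (f z) (g z)
      map_smul' c f := by ext z; exact map_smul (φ i j) c (f z) }
  exact K0Map_eq_of_linking (φ := ψ) (fun i k j f g => by ext z; exact hmul i k j (f z) (g z))
    (fun i j f => by ext z; exact hstar i j (f z))
    (fun i => c0Map (EuclideanSpace ℝ (Fin n)) (Φ i)) (fun i f => by ext z; exact hΦ i (f z))

end KTheory

/-! ### Supports of vectors and of operators -/

namespace Coarse

set_option linter.unusedSectionVars false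

section functions

variable {Z : Type*} [MetricSpace Z]

/-- The product of a continuous function with values in `[0, 1]` and a function in `C₀(Z)`. -/
def mulC0 (h : Z → ℝ) (hc : Continuous h) (hb : ∀ z, h z ∈ Set.Icc (0 : ℝ) 1) (k : C₀(Z, ℂ)) :
    C₀(Z, ℂ) where
  toFun z := (h z : ℂ) * k z
  continuous_toFun := (Complex.continuous_ofReal.comp hc).mul (map_continuous k)
  zero_at_infty' := by
    refine squeeze_zero_norm (fun z => ?_) (tendsto_zero_iff_norm_tendsto_zero.1 k.zero_at_infty')
    rw [norm_mul, Complex.norm_real, Real.norm_of_nonneg (hb z).1]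
    exact mul_le_of_le_one_left (norm_nonneg _) (hb z).2

lemma norm_le_of_forall {f : C₀(Z, ℂ)} {c : ℝ} (hc : 0 ≤ c) (h : ∀ z, ‖f z‖ ≤ c) : ‖f‖ ≤ c := by
  rw [← ZeroAtInftyContinuousMap.norm_toBCF_eq_norm, BoundedContinuousFunction.norm_le hc]
  exact h

/-- A continuous function that is one on `B` and vanishes away from the `ε`-neighbourhood. -/
lemma exists_thickened_cutoff (B : Set Z) {ε : ℝ} (hε : 0 < ε) :
    ∃ h : Z → ℝ, Continuous h ∧ (∀ z, h z ∈ Set.Icc (0 : ℝ) 1) ∧ (∀ z ∈ B, h z = 1) ∧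
      ∀ z ∉ Metric.thickening ε B, h z = 0 := by
  refine ⟨fun z => (thickenedIndicator hε B z : ℝ), ?_, fun z => ⟨NNReal.coe_nonneg _, ?_⟩,
    fun z hz => ?_, fun z hz => ?_⟩
  · exact NNReal.continuous_coe.comp (thickenedIndicator hε B).continuous
  · exact_mod_cast thickenedIndicator_le_one hε B z
  · simp [thickenedIndicator_one hε B hz]
  · simp [thickenedIndicator_zero hε B hz]

/-- The functions whose support is compact and contained in `{F ≠ 0}` approximate `F`. -/
lemma mem_closure_compact_support [ProperSpace Z] (F : C₀(Z, ℂ)) :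
    F ∈ closure {G : C₀(Z, ℂ) | HasCompactSupport G ∧ tsupport G ⊆ Function.support F} := by
  rw [Metric.mem_closure_iff]
  intro ε hε
  have hFc : Continuous fun z => ‖F z‖ := (map_continuous F).norm
  have hcpt : ∀ δ : ℝ, 0 < δ → IsCompact {z | δ ≤ ‖F z‖} := by
    intro δ hδ
    have hev : ∀ᶠ z in Filter.cocompact Z, ‖F z‖ < δ :=
      (tendsto_zero_iff_norm_tendsto_zero.1 F.zero_at_infty').eventually (gt_mem_nhds hδ)
    obtain ⟨K, hK, hKF⟩ := Filter.mem_cocompact.1 hev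
    refine hK.of_isClosed_subset (isClosed_le continuous_const hFc) fun z hz => ?_
    by_contra hzK
    exact not_lt.2 hz (show ‖F z‖ < δ from hKF hzK)
  obtain ⟨φ, h1, h2, -, h4⟩ := exists_continuous_one_zero_of_isCompact (hcpt (ε / 2) (half_pos hε))
    (isClosed_le hFc (continuous_const (y := ε / 4)))
    (Set.disjoint_left.2 fun z hz hz' => by
      have h3 : ε / 2 ≤ ‖F z‖ := hz
      have h4 : ‖F z‖ ≤ ε / 4 := hz'
      linarith)
  have hsub : tsupport (mulC0 φ φ.continuous h4 F) ⊆ {z | ε / 4 ≤ ‖F z‖} := by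
    refine closure_minimal (fun z hz => ?_) (isClosed_le continuous_const hFc)
    by_contra hlt
    have : φ z = 0 := h2 (show ‖F z‖ ≤ ε / 4 from (not_le.1 hlt).le)
    exact hz (by simp [mulC0, this])
  refine ⟨mulC0 φ φ.continuous h4 F, ⟨(hcpt (ε / 4) (by positivity)).of_isClosed_subset
    (isClosed_tsupport _) hsub, fun z hz h0 => ?_⟩, ?_⟩
  · have : ε / 4 ≤ ‖F z‖ := hsub hz
    rw [h0, norm_zero] at this
    linarith
  · rw [dist_eq_norm]
    refine (norm_le_of_forall (half_pos hε).le fun z => ?_).trans_lt (half_lt_self hε)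
    have e : (F - mulC0 φ φ.continuous h4 F) z = ((1 - φ z : ℝ) : ℂ) * F z := by
      simp [mulC0, sub_mul]
    rw [e, norm_mul, Complex.norm_real, Real.norm_of_nonneg (sub_nonneg.2 (h4 z).2)]
    by_cases hz : ε / 2 ≤ ‖F z‖
    · rw [h1 hz]; simpa using (half_pos hε).le
    · exact (mul_le_of_le_one_left (norm_nonneg _) (by linarith [(h4 z).1])).trans (not_le.1 hz).le

/-- An additive property of functions which holds locally near a compact set holds for all
functions supported there. -/
lemma local_to_global {K : Set Z} (hK : IsCompact K) (P : C₀(Z, ℂ) → Prop) (h0 : P 0)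
    (hadd : ∀ a b, P a → P b → P (a + b))
    (hloc : ∀ x ∈ K, ∃ U : Set Z, IsOpen U ∧ x ∈ U ∧ ∀ g : C₀(Z, ℂ), (∀ z ∉ U, g z = 0) → P g)
    (g : C₀(Z, ℂ)) (hg : ∀ z ∉ K, g z = 0) : P g := by
  classical
  choose! U hUo hxU hU using hloc
  obtain ⟨t, htcov⟩ := hK.elim_nhds_subcover' (fun x _ => U x)
    fun x hx => (hUo x hx).mem_nhds (hxU x hx)
  have hcov : K ⊆ ⋃ i : t, U (i : K) := fun z hz => by
    simpa using htcov hz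
  obtain ⟨f, hf⟩ := PartitionOfUnity.exists_isSubordinate hK.isClosed (fun i : t => U (i : K))
    (fun i => hUo _ i.1.2) hcov
  have hsum : g = ∑ i : t, mulC0 (f i) (f i).continuous
      (fun z => ⟨f.nonneg i z, f.le_one i z⟩) g := by
    ext z
    have e : (∑ i : t, mulC0 (f i) (f i).continuous
        (fun z => ⟨f.nonneg i z, f.le_one i z⟩) g) z = ∑ i : t, (f i z : ℂ) * g z := by
      have : ∀ s : Finset t, (∑ i ∈ s, mulC0 (f i) (f i).continuous
          (fun z => ⟨f.nonneg i z, f.le_one i z⟩) g) z = ∑ i ∈ s, (f i z : ℂ) * g z := by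
        intro s
        induction s using Finset.induction_on with
        | empty => simp
        | insert m s hm ih =>
          rw [Finset.sum_insert hm, Finset.sum_insert hm, ZeroAtInftyContinuousMap.add_apply, ih]
          rfl
      exact this _
    rw [e, ← Finset.sum_mul]
    by_cases hz : z ∈ K
    · have := f.sum_eq_one hz
      rw [finsum_eq_sum_of_fintype] at this
      rw [← Complex.ofReal_sum, this, Complex.ofReal_one, one_mul]
    · rw [hg z hz, mul_zero]
  rw [hsum]
  refine Finset.sum_induction _ P hadd h0 fun i _ => hU _ i.1.2 _ fun z hz => ?_
  have : f i z = 0 := by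
    by_contra hne
    exact hz (hf i (subset_tsupport _ hne))
  simp [mulC0, this]

end functions

section control

variable {Z Z' Z'' H H' H'' : Type*} [MetricSpace Z] [MetricSpace Z'] [MetricSpace Z'']
  [NormedAddCommGroup H] [InnerProductSpace ℂ H] [CompleteSpace H]
  [NormedAddCommGroup H'] [InnerProductSpace ℂ H'] [CompleteSpace H']
  [NormedAddCommGroup H''] [InnerProductSpace ℂ H''] [CompleteSpace H'']
  {ρ : C₀(Z, ℂ) →⋆ₙₐ[ℂ] (H →L[ℂ] H)} {ρ' : C₀(Z', ℂ) →⋆ₙₐ[ℂ] (H' →L[ℂ] H')}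
  {ρ'' : C₀(Z'', ℂ) →⋆ₙₐ[ℂ] (H'' →L[ℂ] H'')}

/-- A representation is nondegenerate if no nonzero vector is annihilated by all functions. -/
def Nondeg (ρ : C₀(Z, ℂ) →⋆ₙₐ[ℂ] (H →L[ℂ] H)) : Prop := ∀ v : H, (∀ f, ρ f v = 0) → v = 0

lemma rep_mul_apply (ρ : C₀(Z, ℂ) →⋆ₙₐ[ℂ] (H →L[ℂ] H)) (f g : C₀(Z, ℂ)) (v : H) :
    ρ (f * g) v = ρ f (ρ g v) := by
  rw [map_mul]; rfl

lemma rep_inner (ρ : C₀(Z, ℂ) →⋆ₙₐ[ℂ] (H →L[ℂ] H)) (f : C₀(Z, ℂ)) (v w : H) :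
    ⟪ρ f v, w⟫_ℂ = ⟪v, ρ (star f) w⟫_ℂ := by
  rw [map_star, ContinuousLinearMap.star_eq_adjoint, ContinuousLinearMap.adjoint_inner_right]

lemma rep_continuous (ρ : C₀(Z, ℂ) →⋆ₙₐ[ℂ] (H →L[ℂ] H)) : Continuous ρ :=
  AddMonoidHomClass.continuous_of_bound ρ 1 fun a => by
    simpa using NonUnitalStarAlgHom.norm_apply_le ρ a

/-- `v` lies in the closure of `C₀(Z) v`: the component of `v` orthogonal to `C₀(Z) v` is
annihilated by `C₀(Z)`. -/
lemma Nondeg.mem_closure (hρ : Nondeg ρ) (v : H) : v ∈ closure (Set.range fun k => ρ k v) := by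
  let L : C₀(Z, ℂ) →ₗ[ℂ] H :=
    { toFun k := ρ k v
      map_add' a b := by rw [map_add]; rfl
      map_smul' c a := by rw [map_smul]; rfl }
  let S : Submodule ℂ H := L.range.topologicalClosure
  have hSc : IsClosed (S : Set H) := Submodule.isClosed_topologicalClosure _
  have : CompleteSpace S := hSc.completeSpace_coe
  have hinv : ∀ f, ∀ u ∈ S, ρ f u ∈ S := by
    intro f u hu
    have hcl : IsClosed {u | ρ f u ∈ S} := hSc.preimage (ρ f).continuous
    refine closure_minimal ?_ hcl (s := (L.range : Set H)) hu
    rintro _ ⟨k, rfl⟩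
    refine Submodule.le_topologicalClosure _ ⟨f * k, ?_⟩
    exact rep_mul_apply ρ f k v
  have hinv' : ∀ f, ∀ u ∈ Sᗮ, ρ f u ∈ Sᗮ := by
    intro f u hu
    rw [Submodule.mem_orthogonal]
    intro s hs
    have := rep_inner ρ (star f) s u
    rw [star_star] at this
    rw [← this]
    exact Submodule.inner_right_of_mem_orthogonal (hinv _ s hs) hu
  have hd : v - S.starProjection v = 0 := by
    refine hρ _ fun f => ?_
    have h1 : ρ f (v - S.starProjection v) ∈ Sᗮ :=
      hinv' f _ (Submodule.sub_starProjection_mem_orthogonal v)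
    have h2 : ρ f (v - S.starProjection v) ∈ S := by
      rw [map_sub]
      exact S.sub_mem (Submodule.le_topologicalClosure _ ⟨f, rfl⟩)
        (hinv f _ (Submodule.starProjection_apply_mem S v))
    exact inner_self_eq_zero.1 (Submodule.inner_right_of_mem_orthogonal h2 h1)
  have hv : v ∈ S := by
    rw [sub_eq_zero.1 hd]
    exact Submodule.starProjection_apply_mem S v
  exact hv

variable (ρ) in
/-- The vectors supported in `B`: those annihilated by all functions vanishing on `B`. -/
def SuppOn (B : Set Z) (v : H) : Prop := ∀ f : C₀(Z, ℂ), (∀ z ∈ B, f z = 0) → ρ f v = 0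

lemma SuppOn.mono {B C : Set Z} {v : H} (h : SuppOn ρ B v) (hBC : B ⊆ C) : SuppOn ρ C v :=
  fun f hf => h f fun z hz => hf z (hBC hz)

lemma suppOn_rep {B : Set Z} {g : C₀(Z, ℂ)} (hg : ∀ z, g z ≠ 0 → z ∈ B) (v : H) :
    SuppOn ρ B (ρ g v) := by
  intro f hf
  rw [← rep_mul_apply, show f * g = 0 from ?_, map_zero]; · rfl
  ext z
  by_cases hz : g z = 0
  · simp [hz]
  · simp [hf z (hg z hz)]

lemma SuppOn.rep_eq {B : Set Z} {v : H} (h : SuppOn ρ B v) {f g : C₀(Z, ℂ)}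
    (hfg : ∀ z ∈ B, f z = g z) : ρ f v = ρ g v := by
  rw [← sub_eq_zero, ← sub_apply, ← map_sub]
  exact h _ fun z hz => by simp [hfg z hz]

lemma SuppOn.rep_eq_self (hρ : Nondeg ρ) {B : Set Z} {v : H} (h : SuppOn ρ B v) {f : C₀(Z, ℂ)}
    (hf : ∀ z ∈ B, f z = 1) : ρ f v = v := by
  rw [← sub_eq_zero]
  refine hρ _ fun g => ?_
  rw [map_sub, ← rep_mul_apply, sub_eq_zero]
  exact h.rep_eq fun z hz => by simp [hf z hz]

lemma SuppOn.rep_apply {B C : Set Z} {v : H} (h : SuppOn ρ B v) (g : C₀(Z, ℂ))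
    (hg : ∀ z ∈ B, g z ≠ 0 → z ∈ C) : SuppOn ρ C (ρ g v) := by
  intro f hf
  rw [← rep_mul_apply]
  refine h _ fun z hz => ?_
  by_cases h0 : g z = 0
  · simp [h0]
  · simp [hf z (hg z hz h0)]

variable (ρ ρ') in
/-- The support of the operator `T : H → H'` is controlled by the relation `r`: `F T G = 0`
unless some points `x'` of the support of `F` and `x` of the support of `G` satisfy `r x' x`. -/
def Ctrl (r : Z' → Z → Prop) (T : H →L[ℂ] H') : Prop :=
  ∀ (F : C₀(Z', ℂ)) (G : C₀(Z, ℂ)), (∀ x' x, F x' ≠ 0 → G x ≠ 0 → ¬ r x' x) →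
    ρ' F ∘L T ∘L ρ G = 0

lemma Ctrl.mono {r s : Z' → Z → Prop} {T : H →L[ℂ] H'} (h : Ctrl ρ ρ' r T)
    (hrs : ∀ x' x, r x' x → s x' x) : Ctrl ρ ρ' s T :=
  fun F G hFG => h F G fun x' x hF hG hr => hFG x' x hF hG (hrs _ _ hr)

lemma Ctrl.adjoint {r : Z' → Z → Prop} {T : H →L[ℂ] H'} (h : Ctrl ρ ρ' r T) :
    Ctrl ρ' ρ (fun x x' => r x' x) (ContinuousLinearMap.adjoint T) := by
  intro F G hFG
  have := h (star G) (star F) fun x' x hG hF => hFG x x' (by simpa using hF) (by simpa using hG)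
  have h2 := congrArg ContinuousLinearMap.adjoint this
  simpa only [ContinuousLinearMap.adjoint_comp, map_star, ContinuousLinearMap.star_eq_adjoint,
    ContinuousLinearMap.adjoint_adjoint, map_zero, ContinuousLinearMap.comp_assoc] using h2

lemma Ctrl.suppOn_apply_rep {r : Z' → Z → Prop} {T : H →L[ℂ] H'} (h : Ctrl ρ ρ' r T)
    (G : C₀(Z, ℂ)) (v : H) : SuppOn ρ' {x' | ∃ x, G x ≠ 0 ∧ r x' x} (T (ρ G v)) := by
  intro F hF
  exact DFunLike.congr_fun (h F G fun x' x hF' hG hr => hF' (hF x' ⟨x, hG, hr⟩)) v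

/-- An operator controlled by `r` moves supports along `r`, up to arbitrarily small
enlargement. -/
lemma Ctrl.suppOn_apply (hρ : Nondeg ρ) {r : Z' → Z → Prop} {T : H →L[ℂ] H'}
    (h : Ctrl ρ ρ' r T) {B : Set Z} {v : H} (hv : SuppOn ρ B v) {ε : ℝ} (hε : 0 < ε) :
    SuppOn ρ' {x' | ∃ x ∈ Metric.thickening ε B, r x' x} (T v) := by
  intro F hF
  obtain ⟨φ, hφc, hφ01, hφ1, hφ0⟩ := exists_thickened_cutoff B hε
  have hcl : IsClosed {w : H | ρ' F (T w) = 0} :=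
    isClosed_eq ((ρ' F).continuous.comp T.continuous) continuous_const
  refine closure_minimal ?_ hcl (hρ.mem_closure v)
  rintro _ ⟨k, rfl⟩
  have e : ρ k v = ρ (mulC0 φ hφc hφ01 k) v :=
    hv.rep_eq fun z hz => by simp [mulC0, hφ1 z hz]
  simp only [Set.mem_ofPred_eq]
  rw [e]
  refine h.suppOn_apply_rep _ v F fun x' hx' => ?_
  obtain ⟨x, hx, hr⟩ := hx'
  refine hF x' ⟨x, ?_, hr⟩
  by_contra hne
  exact hx (by simp [mulC0, hφ0 x hne])

/-- The composition of controlled operators is controlled. -/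
lemma Ctrl.comp (hρ' : Nondeg ρ') {r₁ : Z' → Z → Prop} {r₂ : Z'' → Z' → Prop} {T₁ : H →L[ℂ] H'}
    {T₂ : H' →L[ℂ] H''} (h₂ : Ctrl ρ' ρ'' r₂ T₂) (h₁ : Ctrl ρ ρ' r₁ T₁) {ε : ℝ} (hε : 0 < ε) :
    Ctrl ρ ρ'' (fun z x => ∃ y' y, r₂ z y' ∧ dist y' y < ε ∧ r₁ y x) (T₂ ∘L T₁) := by
  intro F G hFG
  ext v
  refine h₂.suppOn_apply hρ' (h₁.suppOn_apply_rep G v) hε F fun z hz => ?_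
  obtain ⟨y', hy', hr⟩ := hz
  obtain ⟨y, ⟨x, hG, hr'⟩, hd⟩ := Metric.mem_thickening_iff.1 hy'
  by_contra hF
  exact hFG z x hF hG ⟨y', y, hr, hd, hr'⟩

/-- The relation `d(φ(x), x') < R`. -/
abbrev near (φ : Z → Z') (R : ℝ) : Z' → Z → Prop := fun x' x => dist (φ x) x' < R

lemma coversMap_of_ctrl {φ : Z → Z'}
    (hφ : ∀ R : ℝ, 0 < R → ∃ S : ℝ, 0 < S ∧ ∀ x y, dist x y < R → dist (φ x) (φ y) < S)
    {T : H →L[ℂ] H'} {R : ℝ} (hR : 0 < R) (h : Ctrl ρ ρ' (near φ R) T) : CoversMap ρ ρ' φ T := by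
  obtain ⟨S, hS, hφS⟩ := hφ 1 one_pos
  refine ⟨R + S + 1, by positivity, fun p hp => ?_⟩
  by_contra hlt
  obtain ⟨F, G, hF, hG, hne⟩ := hp (Metric.ball p.1 1) (Metric.ball p.2 1) Metric.isOpen_ball
    Metric.isOpen_ball (Metric.mem_ball_self one_pos) (Metric.mem_ball_self one_pos)
  refine hne (h F G fun x' x hFx hGx hn => hlt ?_)
  have h1 : dist x' p.1 < 1 := by
    by_contra hb
    exact hFx (hF x' hb)
  have h2 : dist x p.2 < 1 := by
    by_contra hb
    exact hGx (hG x hb)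
  have h3 := hφS p.2 x (by rwa [dist_comm])
  have h4 := dist_triangle4 (φ p.2) (φ x) x' p.1
  linarith

/-- An operator whose support avoids the product of the supports of `F` and `G` satisfies
`F T G = 0`, by compactness and partitions of unity. -/
lemma comp_eq_zero_of_disjoint_opSupport {T : H →L[ℂ] H'} {F : C₀(Z', ℂ)} {G : C₀(Z, ℂ)}
    (hF : HasCompactSupport F) (hG : HasCompactSupport G)
    (h : ∀ x' ∈ tsupport F, ∀ x ∈ tsupport G, (x', x) ∉ opSupport ρ ρ' T) :
    ρ' F ∘L T ∘L ρ G = 0 := by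
  refine local_to_global hF (fun F => ρ' F ∘L T ∘L ρ G = 0) (by simp)
    (fun a b ha hb => by rw [map_add, ContinuousLinearMap.add_comp, ha, hb, add_zero]) ?_ F
    fun z hz => image_eq_zero_of_notMem_tsupport hz
  intro x' hx'
  have hex : ∀ x ∈ tsupport G, ∃ (V : Set Z') (W : Set Z), IsOpen V ∧ IsOpen W ∧ x' ∈ V ∧ x ∈ W ∧
      ∀ (f : C₀(Z', ℂ)) (g : C₀(Z, ℂ)), (∀ z ∉ V, f z = 0) → (∀ z ∉ W, g z = 0) →
        ρ' f ∘L T ∘L ρ g = 0 := by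
    intro x hx
    have := h x' hx' x hx
    simp only [opSupport, Set.mem_ofPred_eq] at this
    push Not at this
    exact this
  choose! V W hVo hWo hxV hxW hVW using hex
  obtain ⟨t, htK, htcov⟩ := hG.elim_nhds_subcover W fun x hx => (hWo x hx).mem_nhds (hxW x hx)
  refine ⟨⋂ x ∈ t, V x, isOpen_biInter_finset fun x hx => hVo x (htK x hx), ?_, fun f hf => ?_⟩
  · simp only [Set.mem_iInter]
    exact fun x hx => hxV x (htK x hx)
  · refine local_to_global hG (fun G => ρ' f ∘L T ∘L ρ G = 0) (by simp)
      (fun a b ha hb => by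
        simp only [map_add, ContinuousLinearMap.comp_add, ha, hb, add_zero]) ?_ G
      fun z hz => image_eq_zero_of_notMem_tsupport hz
    intro x hx
    obtain ⟨i, hi, hxi⟩ := Set.mem_iUnion₂.1 (htcov hx)
    refine ⟨W i, hWo i (htK i hi), hxi, fun g hg => hVW i (htK i hi) f g (fun z hz => hf z ?_) hg⟩
    exact fun h => hz (Set.mem_iInter₂.1 h i hi)

variable [ProperSpace Z] [ProperSpace Z']

lemma ctrl_of_coversMap {φ : Z → Z'}
    (hφ : ∀ R : ℝ, 0 < R → ∃ S : ℝ, 0 < S ∧ ∀ x y, dist x y < R → dist (φ x) (φ y) < S)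
    {T : H →L[ℂ] H'} (h : CoversMap ρ ρ' φ T) : ∃ R, 0 < R ∧ Ctrl ρ ρ' (near φ R) T := by
  obtain ⟨R, hR, hT⟩ := h
  obtain ⟨S, hS, hφS⟩ := hφ 1 one_pos
  refine ⟨R + S + 1, by positivity, fun F G hFG => ?_⟩
  have hc : ∀ (F₁ : C₀(Z', ℂ)) (G₁ : C₀(Z, ℂ)), HasCompactSupport F₁ → HasCompactSupport G₁ →
      (∀ z, F z = 0 → F₁ z = 0) → (∀ z, G z = 0 → G₁ z = 0) → ρ' F₁ ∘L T ∘L ρ G₁ = 0 := by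
    intro F₁ G₁ hF₁ hG₁ hFF hGG
    refine comp_eq_zero_of_disjoint_opSupport hF₁ hG₁ fun x' hx' x hx hmem => ?_
    obtain ⟨y', hy', hd'⟩ := Metric.mem_closure_iff.1 hx' 1 one_pos
    obtain ⟨y, hy, hd⟩ := Metric.mem_closure_iff.1 hx 1 one_pos
    have h1 := hT _ hmem
    have h2 := hφS y x (by rwa [dist_comm])
    have h3 := hFG y' y (fun h0 => hy' (hFF _ h0)) fun h0 => hy (hGG _ h0)
    have h4 := dist_triangle4 (φ y) (φ x) x' y'
    simp only [near] at h3
    simp only at h1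
    linarith
  have hF : ∀ G₁ : C₀(Z, ℂ), HasCompactSupport G₁ → (∀ z, G z = 0 → G₁ z = 0) →
      ρ' F ∘L T ∘L ρ G₁ = 0 := by
    intro G₁ hG₁ hGG
    have hcl : IsClosed {F : C₀(Z', ℂ) | ρ' F ∘L T ∘L ρ G₁ = 0} :=
      isClosed_eq ((rep_continuous ρ').clm_comp continuous_const) continuous_const
    exact closure_minimal (fun F₁ h1 => hc F₁ G₁ h1.1 hG₁
      (fun z hz => image_eq_zero_of_notMem_tsupport fun hz' => h1.2 hz' hz) hGG) hcl
      (mem_closure_compact_support F)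
  have hcl : IsClosed {G : C₀(Z, ℂ) | ρ' F ∘L T ∘L ρ G = 0} :=
    isClosed_eq (continuous_const.clm_comp (continuous_const.clm_comp (rep_continuous ρ)))
      continuous_const
  exact closure_minimal (fun G₁ h1 => hF G₁ h1.1
    fun z hz => image_eq_zero_of_notMem_tsupport fun hz' => h1.2 hz' hz) hcl
      (mem_closure_compact_support G)

end control

/-! ### Nets and equivariant partitions of unity -/

section nets

variable (Γ : Type*) {Z : Type*} [Group Γ] [MetricSpace Z] [MulAction Γ Z]

/-- Points of different `Γ`-orbits in `D` have distance at least one. -/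
def OrbitSeparated (D : Set Z) : Prop :=
  ∀ x ∈ D, ∀ y ∈ D, x ≠ y → ∀ γ : Γ, 1 ≤ dist x (γ • y)

/-- Every subset contains representatives of a maximal family of orbits with distances at least
one. -/
lemma exists_net [IsIsometricSMul Γ Z] (A : Set Z) : ∃ D ⊆ A, OrbitSeparated Γ D ∧
    ∀ z ∈ A, ∃ x ∈ D, ∃ γ : Γ, dist z (γ • x) < 1 := by
  obtain ⟨D, hD⟩ := zorn_subset {D : Set Z | D ⊆ A ∧ OrbitSeparated Γ D} (by
    intro c hc hchain
    refine ⟨⋃₀ c, ⟨Set.sUnion_subset fun s hs => (hc hs).1, ?_⟩, fun s hs =>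
      Set.subset_sUnion_of_mem hs⟩
    rintro x ⟨s, hs, hx⟩ y ⟨t, ht, hy⟩ hne γ
    rcases hchain.total hs ht with h | h
    · exact (hc ht).2 x (h hx) y hy hne γ
    · exact (hc hs).2 x hx y (h hy) hne γ)
  refine ⟨D, hD.prop.1, hD.prop.2, fun z hz => ?_⟩
  by_contra! hfar
  by_cases hzD : z ∈ D
  · have := hfar z hzD 1
    rw [one_smul, dist_self] at this
    exact absurd this (by norm_num)
  refine hzD (hD.le_of_ge (y := insert z D) ⟨Set.insert_subset hz hD.prop.1, ?_⟩
    (Set.subset_insert z D) (Set.mem_insert z D))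
  rintro x (rfl | hx) y (rfl | hy) hne γ
  · exact absurd rfl hne
  · exact hfar y hy γ
  · have := hfar x hx γ⁻¹
    rwa [dist_comm, ← dist_smul γ, smul_inv_smul] at this
  · exact hD.prop.2 x hx y hy hne γ

end nets

section partition

variable {Γ Z : Type*} [Group Γ] [MetricSpace Z] [MulAction Γ Z]

lemma OrbitSeparated.countable [SecondCountableTopology Z] {D : Set Z} (hD : OrbitSeparated Γ D) :
    D.Countable := by
  refine Set.PairwiseDisjoint.countable_of_isOpen (s := fun x => Metric.ball x (1 / 2)) ?_
    (fun x _ => Metric.isOpen_ball) fun x _ => ⟨x, Metric.mem_ball_self (by norm_num)⟩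
  intro x hx y hy hne
  refine Metric.ball_disjoint_ball ?_
  have := hD x hx y hy hne 1
  rw [one_smul] at this
  linarith

variable [IsIsometricSMul Γ Z] [ProperSpace Z] [ProperlyDiscontinuousSMul Γ Z]

/-- The orbits of a separated set of representatives are locally finite. -/
lemma OrbitSeparated.finite_near {D : Set Z} (hD : OrbitSeparated Γ D) (z₀ : Z) (r : ℝ) :
    {p : D × Γ | dist (p.2 • (p.1 : Z)) z₀ ≤ r}.Finite := by
  have hK : IsCompact (Metric.closedBall z₀ r) := isCompact_closedBall z₀ r
  obtain ⟨t, -, htf, ht⟩ := hK.finite_cover_balls (e := 1 / 2) (by norm_num)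
  set I : Set D := {i | ∃ γ : Γ, dist (γ • (i : Z)) z₀ ≤ r} with hI
  have hIf : I.Finite := by
    have h1 : ∀ i ∈ I, ∃ c ∈ t, ∃ γ : Γ, dist (γ • (i : Z)) c < 1 / 2 := by
      rintro i ⟨γ, hγ⟩
      obtain ⟨c, hc, hic⟩ := Set.mem_iUnion₂.1 (ht (Metric.mem_closedBall.2 hγ))
      exact ⟨c, hc, γ, hic⟩
    have : Nonempty Z := ⟨z₀⟩
    choose! c hct γ hγ using h1
    refine Set.Finite.of_injOn (f := c) (fun i hi => hct i hi) (fun i hi j hj hij => ?_) htf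
    by_contra hne
    have h2 := hD i i.2 j j.2 (fun h => hne (Subtype.ext h)) ((γ i)⁻¹ * γ j)
    rw [mul_smul, ← dist_smul (γ i), smul_inv_smul] at h2
    have h3 := hγ i hi
    have h4 := hγ j hj
    rw [← hij] at h4
    have h5 := dist_triangle_right (γ i • (i : Z)) (γ j • (j : Z)) (c i)
    linarith
  have hγf : ∀ i : D, {γ : Γ | dist (γ • (i : Z)) z₀ ≤ r}.Finite := fun i => by
    refine (ProperlyDiscontinuousSMul.finite_disjoint_inter_image (Γ := Γ)
      (isCompact_singleton (x := (i : Z))) hK).subset fun γ hγ => ?_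
    exact ⟨γ • (i : Z), ⟨i, rfl, rfl⟩, hγ⟩
  refine (hIf.biUnion fun i _ => (hγf i).image fun γ => (i, γ)).subset ?_
  rintro ⟨i, γ⟩ h
  exact Set.mem_biUnion (show i ∈ I from ⟨γ, h⟩) ⟨γ, h, rfl⟩

/-- A `Γ`-equivariant family of compactly supported functions, located near the orbits of a set
`D ⊆ A` of representatives, whose squares sum up to one on `A`. -/
lemma exists_equivariant_partition (A : Set Z) : ∃ (D : Set Z) (φ : D × Γ → Z → ℝ), D ⊆ A ∧
    OrbitSeparated Γ D ∧ (∀ p, Continuous (φ p)) ∧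
    (∀ p z, 2 ≤ dist z (p.2 • (p.1 : Z)) → φ p z = 0) ∧
    (∀ (s : Finset (D × Γ)) z, ∑ p ∈ s, φ p z ^ 2 ≤ 1) ∧
    (∀ z ∈ A, ∀ s : Finset (D × Γ), (∀ p ∉ s, φ p z = 0) → ∑ p ∈ s, φ p z ^ 2 = 1) ∧
    ∀ (i : D) (γ δ : Γ) z, φ (i, δ * γ) (δ • z) = φ (i, γ) z := by
  obtain ⟨D, hDA, hD, hnet⟩ := exists_net Γ A
  set ψ : D × Γ → Z → ℝ := fun p z => max 0 (2 - dist z (p.2 • (p.1 : Z))) with hψ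
  have hψ0 : ∀ p z, 2 ≤ dist z (p.2 • (p.1 : Z)) → ψ p z = 0 := fun p z h =>
    max_eq_left (by linarith)
  have hψc : ∀ p, Continuous (ψ p) := fun p => by fun_prop
  have hψe : ∀ (i : D) (γ δ : Γ) z, ψ (i, δ * γ) (δ • z) = ψ (i, γ) z := fun i γ δ z => by
    simp only [hψ]
    rw [mul_smul, dist_smul]
  have hfin : ∀ z, (Function.support fun p => ψ p z ^ 2).Finite := fun z => by
    refine (hD.finite_near z 2).subset fun p hp => ?_
    by_contra hlt
    refine hp ?_
    have : 2 < dist z (p.2 • (p.1 : Z)) := by rw [dist_comm]; exact not_le.1 hlt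
    simp [hψ0 p z this.le]
  set σ : Z → ℝ := fun z => ∑ᶠ p, ψ p z ^ 2 with hσ
  have hσc : Continuous σ := by
    refine continuous_finsum (fun p => (hψc p).pow 2) fun z => ?_
    refine ⟨Metric.ball z 1, Metric.ball_mem_nhds z one_pos,
      (hD.finite_near z 3).subset fun p hp => ?_⟩
    obtain ⟨y, hy, hyz⟩ := hp
    by_contra hlt
    have h1 : 3 < dist (p.2 • (p.1 : Z)) z := not_le.1 hlt
    have h2 := dist_triangle (p.2 • (p.1 : Z)) y z
    have h3 : dist y z < 1 := hyz
    refine hy ?_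
    have : 2 ≤ dist y (p.2 • (p.1 : Z)) := by rw [dist_comm]; linarith
    simp [hψ0 p y this]
  have hσe : ∀ (δ : Γ) z, σ (δ • z) = σ z := fun δ z => by
    simp only [hσ]
    rw [← finsum_comp_equiv (Equiv.prodCongr (Equiv.refl D) (Equiv.mulLeft δ))]
    refine finsum_congr fun p => ?_
    change ψ (p.1, δ * p.2) (δ • z) ^ 2 = _
    rw [hψe]
  have hσA : ∀ z ∈ A, 1 ≤ σ z := fun z hz => by
    obtain ⟨x, hx, γ, hd⟩ := hnet z hz
    have h1 : ψ (⟨x, hx⟩, γ) z ^ 2 ≤ σ z :=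
      single_le_finsum (f := fun p => ψ p z ^ 2) _ (hfin z) fun p => sq_nonneg _
    have h2 : 1 ≤ ψ (⟨x, hx⟩, γ) z := le_max_of_le_right (by simp only; linarith)
    nlinarith
  -- dividing by the square root of `max σ 1` normalizes on `A`, where `1 ≤ σ`, and keeps the sums
  -- of squares at most one elsewhere
  have hpos : ∀ z, 0 < max (σ z) 1 := fun z => lt_max_of_lt_right one_pos
  have hsq : ∀ p z, (ψ p z / √(max (σ z) 1)) ^ 2 = ψ p z ^ 2 / max (σ z) 1 := fun p z => by
    rw [div_pow, Real.sq_sqrt (hpos z).le]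
  refine ⟨D, fun p z => ψ p z / √(max (σ z) 1), hDA, hD, fun p => ?_, fun p z h => ?_,
    fun s z => ?_, fun z hz s hs => ?_, fun i γ δ z => ?_⟩
  · exact (hψc p).div ((hσc.max continuous_const).sqrt) fun z => (Real.sqrt_pos.2 (hpos z)).ne'
  · simp only; rw [hψ0 p z h, zero_div]
  · simp only [hsq]
    rw [← Finset.sum_div, div_le_one (hpos z)]
    refine le_max_of_le_left ?_
    simp only [hσ]
    rw [finsum_eq_sum_of_support_subset_of_finite _ (Set.subset_union_left (t := (s : Set (D × Γ))))
      ((hfin z).union s.finite_toSet)]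
    refine Finset.sum_le_sum_of_subset_of_nonneg ?_ fun _ _ _ => sq_nonneg _
    intro p hp
    simp [hp]
  · simp only [hsq]
    rw [← Finset.sum_div, max_eq_left (hσA z hz)]
    have h1 : σ z = ∑ p ∈ s, ψ p z ^ 2 := by
      refine finsum_eq_sum_of_support_subset _ fun p hp => ?_
      by_contra hps
      have := hs p hps
      rw [div_eq_zero_iff] at this
      rcases this with h | h
      · exact hp (by simp [h])
      · exact (Real.sqrt_pos.2 (hpos z)).ne' h
    rw [← h1, div_self (zero_lt_one.trans_le (hσA z hz)).ne']
  · simp only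
    rw [hψe, hσe]

end partition

/-! ### Isometries into ample modules -/

section hilbert

variable {H H' : Type*} [NormedAddCommGroup H] [InnerProductSpace ℂ H] [CompleteSpace H]
  [NormedAddCommGroup H'] [InnerProductSpace ℂ H'] [CompleteSpace H']

/-- The range of a noncompact operator contains an infinite orthonormal sequence. -/
lemma exists_orthonormal_range {T : H →L[ℂ] H} (hT : ¬ IsCompactOperator T) :
    ∃ e : ℕ → H, Orthonormal ℂ e ∧ ∀ n, ∃ v, T v = e n := by
  have hinf : ¬ FiniteDimensional ℂ T.range := by
    intro hfd
    refine hT ?_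
    have : ProperSpace T.range := FiniteDimensional.proper ℂ _
    have h1 : IsCompactOperator (T.codRestrict T.range fun v => ⟨v, rfl⟩) := by
      refine ⟨_, isCompact_closedBall (0 : T.range) ‖T‖, ?_⟩
      filter_upwards [Metric.closedBall_mem_nhds (0 : H) one_pos] with v hv
      simp only [Set.mem_preimage, mem_closedBall_zero_iff] at hv ⊢
      exact (T.le_opNorm v).trans (mul_le_of_le_one_right (norm_nonneg _) hv)
    exact h1.clm_comp T.range.subtypeL
  let b := Module.Basis.ofVectorSpace ℂ T.range
  have hI : Infinite (Module.Basis.ofVectorSpaceIndex ℂ T.range) := by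
    by_contra h
    rw [not_infinite_iff_finite] at h
    exact hinf (Module.Finite.of_basis b)
  set u : ℕ → T.range := fun n => b (Infinite.natEmbedding _ n) with hu
  have hli : LinearIndependent ℂ u :=
    b.linearIndependent.comp _ (Infinite.natEmbedding _).injective
  have ho := InnerProductSpace.gramSchmidtNormed_orthonormal hli
  refine ⟨fun n => ((InnerProductSpace.gramSchmidtNormed ℂ u n : T.range) : H), ?_, fun n => ?_⟩
  · exact ho.comp_linearIsometry T.range.subtypeₗᵢ
  · exact (InnerProductSpace.gramSchmidtNormed ℂ u n).2

/-- A Hilbert space is mapped isometrically to the closed span of an orthonormal family indexed by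
one of its Hilbert bases. -/
lemma exists_isometry_of_orthonormal {w : Type*} (b : HilbertBasis w ℂ H) {a : w → H'}
    (ha : Orthonormal ℂ a) : ∃ J : H →ₗᵢ[ℂ] H', ∀ S : Submodule ℂ H', IsClosed (S : Set H') →
      (∀ x, a x ∈ S) → ∀ v, J v ∈ S := by
  refine ⟨ha.orthogonalFamily.linearIsometry.comp b.repr.toLinearIsometry, fun S hS haS v => ?_⟩
  have h := ha.orthogonalFamily.hasSum_linearIsometry (b.repr v)
  refine hS.mem_of_tendsto h (Filter.Eventually.of_forall fun s => ?_)
  refine S.sum_mem fun x _ => ?_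
  simp only [LinearIsometry.toSpanSingleton_apply]
  exact S.smul_mem _ (haS x)

lemma orthonormal_countable {w : Type*} [TopologicalSpace.SeparableSpace H] {a : w → H}
    (ha : Orthonormal ℂ a) : Countable w := by
  refine Pairwise.countable_of_isOpen_disjoint (s := fun x => Metric.ball (a x) (1 / 2)) ?_
    (fun x => Metric.isOpen_ball) fun x => ⟨a x, Metric.mem_ball_self (by norm_num)⟩
  intro x y hxy
  refine Metric.ball_disjoint_ball ?_
  have h1 : ‖a x - a y‖ ^ 2 = 2 := by
    rw [@norm_sub_sq ℂ, ha.2 hxy, ha.1, ha.1]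
    norm_num
  rw [dist_eq_norm]
  nlinarith [norm_nonneg (a x - a y)]

end hilbert

section modules

variable {Γ Z H : Type*} [Group Γ] [MetricSpace Z] [MulAction Γ Z]
  [NormedAddCommGroup H] [InnerProductSpace ℂ H] [CompleteSpace H] (M : GeomModule Γ Z H)

lemma GeomModule.nondeg : Nondeg M.ρ := M.nondegenerate

lemma GeomModule.inner_eq_zero_of_disjoint {B C : Set Z} (h : Disjoint B C) {F : C₀(Z, ℂ)}
    (hF : ∀ z, F z ≠ 0 → z ∈ B) {v w : H} (hw : w ∈ M.supportedIn C) : ⟪M.ρ F v, w⟫_ℂ = 0 := by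
  rw [M.inner_apply, hw (star F) fun z hz => ?_, inner_zero_right]
  by_contra hne
  exact Set.disjoint_left.1 h (hF z fun h0 => hne (by simp [h0])) hz

lemma GeomModule.rho_mem_supportedIn {B : Set Z} {F : C₀(Z, ℂ)} (hF : ∀ z, F z ≠ 0 → z ∈ B)
    (v : H) : M.ρ F v ∈ M.supportedIn B := suppOn_rep (ρ := M.ρ) hF v

lemma GeomModule.U_inv_apply_U (γ : Γ) (v : H) :
    (M.U γ⁻¹ : H →L[ℂ] H) ((M.U γ : H →L[ℂ] H) v) = v := by
  rw [← M.U_mul_apply, inv_mul_cancel, M.U_one_apply]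

lemma GeomModule.inner_U_U (γ : Γ) (v w : H) :
    ⟪(M.U γ : H →L[ℂ] H) v, (M.U γ : H →L[ℂ] H) w⟫_ℂ = ⟪v, w⟫_ℂ := by
  rw [M.inner_U_left, M.U_inv_apply_U]

/-- The action of a group element as a linear isometry. -/
def GeomModule.Uₗᵢ (γ : Γ) : H →ₗᵢ[ℂ] H where
  toLinearMap := (M.U γ : H →L[ℂ] H).toLinearMap
  norm_map' v := by
    have h := M.inner_U_U γ v v
    rw [inner_self_eq_norm_sq_to_K, inner_self_eq_norm_sq_to_K] at h
    have h2 : ‖(M.U γ : H →L[ℂ] H) v‖ ^ 2 = ‖v‖ ^ 2 := by exact_mod_cast h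
    exact (pow_left_inj₀ (norm_nonneg _) (norm_nonneg _) two_ne_zero).1 h2

lemma GeomModule.Uₗᵢ_apply (γ : Γ) (v : H) : M.Uₗᵢ γ v = (M.U γ : H →L[ℂ] H) v := rfl

variable [IsIsometricSMul Γ Z] [ProperSpace Z] [ProperlyDiscontinuousSMul Γ Z]

/-- For a free action, each point has a small ball whose translates are mutually disjoint. -/
lemma exists_disjoint_ball (hfree : ∀ (γ : Γ) (x : Z), γ • x = x → γ = 1) {A : Set Z}
    (hA : IsOpen A) {z : Z} (hz : z ∈ A) : ∃ r : ℝ, 0 < r ∧ r ≤ 1 / 3 ∧ Metric.ball z r ⊆ A ∧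
      ∀ γ : Γ, γ ≠ 1 → 2 * r ≤ dist (γ • z) z := by
  have hf : {γ : Γ | dist (γ • z) z ≤ 1}.Finite :=
    (ProperlyDiscontinuousSMul.finite_disjoint_inter_image (Γ := Γ) (isCompact_singleton (x := z))
      (isCompact_closedBall z 1)).subset fun γ hγ => ⟨γ • z, ⟨z, rfl, rfl⟩, hγ⟩
  set F : Set Z := (fun γ : Γ => γ • z) '' {γ : Γ | dist (γ • z) z ≤ 1 ∧ γ ≠ 1} with hF
  have hFc : IsClosed F := ((hf.subset fun γ h => h.1).image _).isClosed
  have hzF : z ∉ F := by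
    rintro ⟨γ, ⟨-, hne⟩, h⟩
    exact hne (hfree γ z h)
  obtain ⟨ε, hε, hball⟩ := Metric.isOpen_iff.1 (hA.inter hFc.isOpen_compl) z ⟨hz, hzF⟩
  refine ⟨min (ε / 2) (1 / 3), by positivity, min_le_right _ _, fun y hy => ?_, fun γ hγ => ?_⟩
  · refine (hball ?_).1
    have h1 : dist y z < min (ε / 2) (1 / 3) := hy
    have h2 := min_le_left (ε / 2) (1 / 3 : ℝ)
    exact Metric.mem_ball.2 (by linarith)
  · by_contra! hlt
    have h1 := min_le_left (ε / 2) (1 / 3 : ℝ)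
    have h2 := min_le_right (ε / 2) (1 / 3 : ℝ)
    have h3 : γ • z ∈ Metric.ball z ε := Metric.mem_ball.2 (by linarith)
    exact (hball h3).2 ⟨γ, ⟨by linarith, hγ⟩, rfl⟩

/-- Ampleness: each ball carries an orthonormal sequence. -/
lemma GeomModule.exists_orthonormal (z : Z) {r : ℝ} (hr : 0 < r) :
    ∃ (F : C₀(Z, ℂ)) (e : ℕ → H), (∀ y, F y ≠ 0 → y ∈ Metric.ball z r) ∧ Orthonormal ℂ e ∧
      ∀ n, ∃ v, M.ρ F v = e n := by
  obtain ⟨φ, h1, h2, h3⟩ := exists_cutoff (isCompact_singleton (x := z))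
    (Metric.isOpen_ball (x := z) (ε := r)).isClosed_compl
    (Set.disjoint_singleton_left.2 fun h => h (Metric.mem_ball_self hr : z ∈ Metric.ball z r))
  set F : C₀(Z, ℂ) := ofCompact φ φ.continuous h3 with hF
  have hFz : ∀ y, F y = (φ y : ℂ) := fun _ => rfl
  have hne : ¬ IsCompactOperator (M.ρ F) := by
    intro hc
    have h0 := M.ample F hc
    have := hFz z
    rw [h0, h1 z rfl] at this
    simp at this
  obtain ⟨e, he, hr⟩ := exists_orthonormal_range hne
  refine ⟨F, e, fun y hy => ?_, he, hr⟩
  by_contra hb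
  exact hy (by rw [hFz, h2 y hb]; simp)

/-- Countably many isometries from a separable Hilbert space, with ranges located near given
points of an invariant open set `A` and such that all translates of the ranges are mutually
orthogonal. -/
lemma GeomModule.exists_isometries {H₀ ι : Type*} [NormedAddCommGroup H₀] [InnerProductSpace ℂ H₀]
    [CompleteSpace H₀] [TopologicalSpace.SeparableSpace H₀] [Countable ι]
    (hfree : ∀ (γ : Γ) (x : Z), γ • x = x → γ = 1) {A : Set Z} (hA : IsOpen A)
    (hAinv : ∀ (γ : Γ), ∀ z ∈ A, γ • z ∈ A) (y : ι → Z) (hy : ∀ i, y i ∈ A) :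
    ∃ J : ι → H₀ →ₗᵢ[ℂ] H, (∀ i v, J i v ∈ M.supportedIn (Metric.ball (y i) 2)) ∧
      (∀ i v, J i v ∈ (M.supportedIn Aᶜ)ᗮ) ∧
      ∀ i j γ, (i ≠ j ∨ γ ≠ 1) → ∀ v w, ⟪J i v, (M.U γ : H →L[ℂ] H) (J j w)⟫_ℂ = 0 := by
  obtain ⟨D, hDA, hD, hnet⟩ := exists_net Γ A
  choose k hkD g hg using fun i => hnet (y i) (hy i)
  choose! r hr0 hr3 hrA hrγ using fun (z : Z) (hz : z ∈ A) =>
    exists_disjoint_ball (Γ := Γ) hfree hA hz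
  choose! F e hF he hFe using fun (z : Z) (hz : z ∈ A) => M.exists_orthonormal z (hr0 z hz)
  obtain ⟨w, b, -⟩ := exists_hilbertBasis ℂ H₀
  have hw : Countable w := orthonormal_countable b.orthonormal
  obtain ⟨ei, hei⟩ := exists_injective_nat ι
  obtain ⟨ew, hew⟩ := exists_injective_nat w
  have hkA : ∀ i, k i ∈ A := fun i => hDA (hkD i)
  -- The point `y i` lies near `g i • k i` with `k i` in the net. Pairing indices distributes the
  -- orthonormal sequence near a net point among all the `y i` that are assigned to it.
  set a : ι → w → H := fun i x => M.Uₗᵢ (g i) (e (k i) (Nat.pair (ei i) (ew x))) with ha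
  have hao : ∀ i, Orthonormal ℂ (a i) := fun i => by
    have h1 : Function.Injective fun x => Nat.pair (ei i) (ew x) := fun x x' h =>
      hew (Nat.pair_eq_pair.1 h).2
    exact ((he (k i) (hkA i)).comp _ h1).comp_linearIsometry (M.Uₗᵢ (g i))
  have hae : ∀ i n, e (k i) n ∈ M.supportedIn (Metric.ball (k i) (r (k i))) := fun i n => by
    obtain ⟨v, hv⟩ := hFe (k i) (hkA i) n
    rw [← hv]
    exact M.rho_mem_supportedIn (hF (k i) (hkA i)) v
  -- the translates of the orthonormal sequences are mutually orthogonal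
  have haorth : ∀ i j γ, (i ≠ j ∨ γ ≠ 1) → ∀ x x', ⟪a i x, (M.U γ : H →L[ℂ] H) (a j x')⟫_ℂ = 0 := by
    intro i j γ hij x x'
    simp only [ha, M.Uₗᵢ_apply]
    rw [M.inner_U_left, ← M.U_mul_apply, ← M.U_mul_apply]
    set δ := (g i)⁻¹ * γ * g j with hδ
    by_cases hcase : k i = k j ∧ δ = 1
    · obtain ⟨hk, hδ1⟩ := hcase
      rw [hδ1, M.U_one_apply, ← hk]
      refine (he (k i) (hkA i)).2 fun hp => ?_
      have hij' : i = j := hei (Nat.pair_eq_pair.1 hp).1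
      subst hij'
      rcases hij with h | h
      · exact h rfl
      · refine h ?_
        have : (g i)⁻¹ * γ * g i = 1 := hδ1
        rw [mul_assoc, inv_mul_eq_one] at this
        exact mul_eq_right.1 this.symm
    · obtain ⟨v, hv⟩ := hFe (k i) (hkA i) (Nat.pair (ei i) (ew x))
      rw [← hv]
      refine M.inner_eq_zero_of_disjoint (C := (δ • ·) '' Metric.ball (k j) (r (k j))) ?_
        (hF (k i) (hkA i)) (M.U_apply_mem δ (hae j _))
      rw [Set.disjoint_left]
      rintro _ hz ⟨z, hz', rfl⟩
      have h1 : dist (δ • z) (k i) < r (k i) := hz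
      have h2 : dist (δ • z) (δ • k j) < r (k j) := by rw [dist_smul]; exact hz'
      have h3 := dist_triangle_left (k i) (δ • k j) (δ • z)
      have h4 := hr3 (k i) (hkA i)
      have h5 := hr3 (k j) (hkA j)
      by_cases hk : k i = k j
      · have h6 := hrγ (k j) (hkA j) δ fun h => hcase ⟨hk, h⟩
        rw [dist_comm] at h6
        rw [hk] at h1 h3
        linarith
      · have h6 := hD (k i) (hkD i) (k j) (hkD j) hk δ
        linarith
  choose J hJ using fun i => exists_isometry_of_orthonormal b (hao i)
  have hspan : ∀ i (c : H), (∀ x, ⟪c, a i x⟫_ℂ = 0) → ∀ v, ⟪c, J i v⟫_ℂ = 0 := by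
    intro i c hc v
    have := hJ i (ℂ ∙ c)ᗮ (Submodule.isClosed_orthogonal _)
      (fun x => Submodule.mem_orthogonal_singleton_iff_inner_right.2 (hc x)) v
    exact Submodule.mem_orthogonal_singleton_iff_inner_right.1 this
  refine ⟨J, fun i => hJ i _ (M.isClosed_supportedIn _) fun x => ?_,
    fun i => hJ i _ (Submodule.isClosed_orthogonal _) fun x => ?_, fun i j γ hij v v' => ?_⟩
  · refine M.supportedIn_mono ?_ (M.U_apply_mem (g i) (hae i _))
    rintro _ ⟨z, hz, rfl⟩
    have h1 : dist (g i • z) (g i • k i) < r (k i) := by rw [dist_smul]; exact hz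
    have h2 := hr3 (k i) (hkA i)
    have h3 := hg i
    have h4 := dist_triangle_right (g i • z) (y i) (g i • k i)
    exact Metric.mem_ball.2 (by linarith)
  · rw [Submodule.mem_orthogonal']
    intro u hu
    simp only [ha, M.Uₗᵢ_apply]
    obtain ⟨v, hv⟩ := hFe (k i) (hkA i) (Nat.pair (ei i) (ew x))
    rw [M.inner_U_left, ← hv]
    refine M.inner_eq_zero_of_disjoint (C := Aᶜ) (B := A) disjoint_compl_right
      (fun z hz => hrA (k i) (hkA i) (hF (k i) (hkA i) z hz)) ?_
    refine M.supportedIn_mono ?_ (M.U_apply_mem (g i)⁻¹ hu)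
    rintro _ ⟨z, hz, rfl⟩ hz'
    refine hz ?_
    have := hAinv (g i) _ hz'
    rwa [smul_inv_smul] at this
  · have h1 : ∀ x, ⟪(M.U γ⁻¹ : H →L[ℂ] H) (a i x), J j v'⟫_ℂ = 0 := fun x =>
      hspan j _ (fun x' => by rw [M.inner_U_left, inv_inv]; exact haorth i j γ hij x x') v'
    rw [← inner_conj_symm, hspan i _ (fun x => ?_) v, map_zero]
    rw [← inner_conj_symm, ← inv_inv γ, ← M.inner_U_left, h1, map_zero]

end modules

/-! ### Equivariant isometries covering a coarse map -/

section density

variable {Γ Z H : Type*} [Group Γ] [MetricSpace Z] [ProperSpace Z] [MulAction Γ Z]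
  [NormedAddCommGroup H] [InnerProductSpace ℂ H] [CompleteSpace H] (M : GeomModule Γ Z H)

/-- The vectors supported in compact subsets of `A`. -/
def GeomModule.compactlySupportedIn (A : Set Z) : Submodule ℂ H where
  carrier := {v | ∃ K ⊆ A, IsCompact K ∧ v ∈ M.supportedIn K}
  add_mem' := by
    rintro v w ⟨K, hKA, hK, hv⟩ ⟨L, hLA, hL, hw⟩
    exact ⟨K ∪ L, Set.union_subset hKA hLA, hK.union hL,
      add_mem (M.supportedIn_mono Set.subset_union_left hv)
        (M.supportedIn_mono Set.subset_union_right hw)⟩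
  zero_mem' := ⟨∅, Set.empty_subset _, isCompact_empty, zero_mem _⟩
  smul_mem' := by
    rintro c v ⟨K, hKA, hK, hv⟩
    exact ⟨K, hKA, hK, Submodule.smul_mem _ c hv⟩

/-- The vectors supported in compact subsets of `A` are dense in the orthogonal complement of the
vectors supported off `A`. -/
lemma GeomModule.orthogonal_supportedIn_compl_le (A : Set Z) :
    (M.supportedIn Aᶜ)ᗮ ≤ (M.compactlySupportedIn A).topologicalClosure := by
  rw [← Submodule.orthogonal_orthogonal_eq_closure]
  refine Submodule.orthogonal_le fun u hu => ?_
  intro g hg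
  have hcl : IsClosed {g : C₀(Z, ℂ) | M.ρ g u = 0} :=
    isClosed_eq ((rep_continuous M.ρ).clm_apply continuous_const) continuous_const
  refine closure_minimal ?_ hcl (mem_closure_compact_support g)
  rintro k ⟨hk, hkg⟩
  have hkA : tsupport k ⊆ A := fun z hz => by
    by_contra hzA
    exact hkg hz (hg z hzA)
  have h1 : M.ρ (star k) (M.ρ k u) ∈ M.compactlySupportedIn A := by
    refine ⟨tsupport k, hkA, hk, ?_⟩
    rw [← rep_mul_apply]
    refine M.rho_mem_supportedIn (fun z hz => subset_tsupport _ fun h0 => hz ?_) u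
    simp [h0]
  have h2 := Submodule.inner_right_of_mem_orthogonal h1 hu
  rw [M.inner_apply, star_star] at h2
  exact inner_self_eq_zero.1 h2

end density

section existence

variable {Γ Z Z' H H' : Type*} [Group Γ]
  [MetricSpace Z] [ProperSpace Z] [MulAction Γ Z] [IsIsometricSMul Γ Z]
  [ProperlyDiscontinuousSMul Γ Z]
  [MetricSpace Z'] [ProperSpace Z'] [MulAction Γ Z'] [IsIsometricSMul Γ Z']
  [ProperlyDiscontinuousSMul Γ Z']
  [NormedAddCommGroup H] [InnerProductSpace ℂ H] [CompleteSpace H]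
  [TopologicalSpace.SeparableSpace H]
  [NormedAddCommGroup H'] [InnerProductSpace ℂ H'] [CompleteSpace H']

/-- For an equivariant map `f` which expands distances in a controlled way and maps the invariant
set `A` into the invariant open set `A'`, there is an equivariant operator covering `f` which is
isometric on the part of `H` over `A` and takes values in the part of `H'` over `A'`. It is
`V v = ∑_p W_p ρ(φ_p) v`, with an equivariant quadratic partition of unity `φ_p` and isometries
`W_p` with orthogonal ranges located near the images of the supports of `φ_p`. -/
theorem exists_covering_operator (hfree' : ∀ (γ : Γ) (x : Z'), γ • x = x → γ = 1)
    (M : GeomModule Γ Z H) (M' : GeomModule Γ Z' H') {f : Z → Z'}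
    (hf : ∀ R : ℝ, 0 < R → ∃ S : ℝ, 0 < S ∧ ∀ x y, dist x y < R → dist (f x) (f y) < S)
    (hfe : ∀ (γ : Γ) x, f (γ • x) = γ • f x) {A : Set Z} {A' : Set Z'} (hA' : IsOpen A')
    (hA'inv : ∀ γ : Γ, ∀ z ∈ A', γ • z ∈ A') (hAA' : ∀ z ∈ A, f z ∈ A') :
    ∃ V : H →L[ℂ] H', (∀ γ v, V ((M.U γ : H →L[ℂ] H) v) = (M'.U γ : H' →L[ℂ] H') (V v)) ∧
      (∃ R, 0 < R ∧ Ctrl M.ρ M'.ρ (near f R) V) ∧ (∀ v, V v ∈ (M'.supportedIn A'ᶜ)ᗮ) ∧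
      ∀ v ∈ (M.supportedIn Aᶜ)ᗮ, ‖V v‖ = ‖v‖ := by
  classical
  obtain ⟨D, φ, hDA, hD, hφc, hφ0, hφle, hφ1, hφe⟩ := exists_equivariant_partition (Γ := Γ) A
  have : Countable D := hD.countable.to_subtype
  obtain ⟨J, hJsupp, hJA, hJorth⟩ := M'.exists_isometries (H₀ := H) hfree' hA' hA'inv
    (fun i : D => f i) fun i => hAA' i (hDA i.2)
  have hφsupp : ∀ p, HasCompactSupport (φ p) := fun p => by
    refine HasCompactSupport.intro (isCompact_closedBall (p.2 • (p.1 : Z)) 2) fun z hz => hφ0 p z ?_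
    exact (not_le.1 fun h => hz (Metric.mem_closedBall.2 h)).le
  set Φ : D × Γ → C₀(Z, ℂ) := fun p => ofCompact (φ p) (hφc p) (hφsupp p) with hΦ
  have hΦz : ∀ p z, Φ p z = (φ p z : ℂ) := fun p z => rfl
  have hΦs : ∀ p, star (Φ p) = Φ p := fun p => by ext z; simp [hΦz]
  set W : D × Γ → H →ₗᵢ[ℂ] H' := fun p =>
    ((M'.Uₗᵢ p.2).comp (J p.1)).comp (M.Uₗᵢ p.2⁻¹) with hW
  have hWa : ∀ p v, W p v = (M'.U p.2 : H' →L[ℂ] H') (J p.1 ((M.U p.2⁻¹ : H →L[ℂ] H) v)) :=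
    fun _ _ => rfl
  have hWo : OrthogonalFamily ℂ (fun _ : D × Γ => H) W := by
    intro p q hpq v w
    rw [hWa, hWa, M'.inner_U_left, ← M'.U_mul_apply]
    refine hJorth p.1 q.1 _ ?_ _ _
    by_contra! h
    refine hpq (Prod.ext h.1 ?_)
    exact inv_mul_eq_one.1 h.2
  -- the sum of the squares of the operators `ρ(φ_p)`
  have hsum : ∀ (s : Finset (D × Γ)) v,
      ((∑ p ∈ s, ‖M.ρ (Φ p) v‖ ^ 2 : ℝ) : ℂ) = ⟪v, M.ρ (∑ p ∈ s, Φ p * Φ p) v⟫_ℂ := by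
    intro s v
    rw [map_sum, sum_apply, inner_sum, Complex.ofReal_sum]
    refine Finset.sum_congr rfl fun p _ => ?_
    rw [rep_mul_apply, ← hΦs p, ← M.inner_apply, hΦs, inner_self_eq_norm_sq_to_K]
    norm_cast
  have hsumz : ∀ (s : Finset (D × Γ)) z,
      (∑ p ∈ s, Φ p * Φ p) z = ((∑ p ∈ s, φ p z ^ 2 : ℝ) : ℂ) := by
    intro s z
    induction s using Finset.induction_on with
    | empty => simp
    | insert m s hm ih =>
      rw [Finset.sum_insert hm, Finset.sum_insert hm, ZeroAtInftyContinuousMap.add_apply, ih]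
      simp [hΦz, sq]
  have hle : ∀ (s : Finset (D × Γ)) v, ∑ p ∈ s, ‖M.ρ (Φ p) v‖ ^ 2 ≤ ‖v‖ ^ 2 := by
    intro s v
    have h1 : ‖M.ρ (∑ p ∈ s, Φ p * Φ p)‖ ≤ 1 := by
      refine (NonUnitalStarAlgHom.norm_apply_le M.ρ _).trans
        (norm_le_of_forall zero_le_one fun z => ?_)
      rw [hsumz, Complex.norm_real, Real.norm_of_nonneg (Finset.sum_nonneg fun _ _ => sq_nonneg _)]
      exact hφle s z
    have h2 : ‖((∑ p ∈ s, ‖M.ρ (Φ p) v‖ ^ 2 : ℝ) : ℂ)‖ ≤ ‖v‖ ^ 2 := by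
      rw [hsum, sq]
      refine (norm_inner_le_norm _ _).trans ?_
      gcongr
      exact (ContinuousLinearMap.le_opNorm _ _).trans (mul_le_of_le_one_left (norm_nonneg _) h1)
    rwa [Complex.norm_real, Real.norm_of_nonneg (Finset.sum_nonneg fun _ _ => sq_nonneg _)] at h2
  have hmem : ∀ v, Memℓp (fun p : D × Γ => M.ρ (Φ p) v) 2 := fun v =>
    memℓp_gen' (C := ‖v‖ ^ 2) fun s => by simpa using hle s v
  -- `v ↦ (ρ(φ_p) v)_p` is a contraction into the `ℓ²`-sum
  let L₀ : H →ₗ[ℂ] lp (fun _ : D × Γ => H) 2 :=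
    { toFun v := ⟨fun p => M.ρ (Φ p) v, hmem v⟩
      map_add' v w := by ext p : 2; exact map_add (M.ρ (Φ p)) v w
      map_smul' c v := by ext p : 2; exact map_smul (M.ρ (Φ p)) c v }
  have hnorm : ∀ v, HasSum (fun p => ‖M.ρ (Φ p) v‖ ^ 2) (‖L₀ v‖ ^ 2) := fun v => by
    have := lp.hasSum_norm (p := 2) (by norm_num) (L₀ v)
    simp only [ENNReal.toReal_ofNat, Real.rpow_ofNat] at this
    exact this
  let L : H →L[ℂ] lp (fun _ : D × Γ => H) 2 := L₀.mkContinuous 1 fun v => by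
    rw [one_mul]
    refine le_of_sq_le_sq ?_ (norm_nonneg _)
    exact hasSum_le_of_sum_le (hnorm v) fun s => hle s v
  let V : H →L[ℂ] H' := hWo.linearIsometry.toContinuousLinearMap ∘L L
  have hV : ∀ v, HasSum (fun p => W p (M.ρ (Φ p) v)) (V v) := fun v =>
    hWo.hasSum_linearIsometry (L v)
  have hVn : ∀ v, HasSum (fun p => ‖M.ρ (Φ p) v‖ ^ 2) (‖V v‖ ^ 2) := fun v => by
    have : ‖V v‖ = ‖L₀ v‖ := hWo.linearIsometry.norm_map (L v)
    rw [this]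
    exact hnorm v
  refine ⟨V, fun δ v => ?_, ?_, fun v => ?_, fun v hv => ?_⟩
  · have h1 := (hV v).mapL (M'.U δ : H' →L[ℂ] H')
    have h2 := hV ((M.U δ : H →L[ℂ] H) v)
    rw [← (Equiv.prodCongr (Equiv.refl D) (Equiv.mulLeft δ)).hasSum_iff] at h2
    refine h2.unique (h1.congr_fun fun p => ?_)
    change W (p.1, δ * p.2) (M.ρ (Φ (p.1, δ * p.2)) ((M.U δ : H →L[ℂ] H) v))
      = (M'.U δ : H' →L[ℂ] H') (W p (M.ρ (Φ p) v))
    have h3 : translate δ⁻¹ (Φ (p.1, δ * p.2)) = Φ p := by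
      ext z
      rw [translate_apply, inv_inv, hΦz, hΦz, hφe]
    rw [M.rho_U_apply, h3, hWa, hWa, ← M.U_mul_apply, ← M'.U_mul_apply]
    simp
  · obtain ⟨S, hS, hfS⟩ := hf 2 two_pos
    refine ⟨S + 2, by positivity, fun F G hFG => ?_⟩
    ext v
    have h1 := (hV (M.ρ G v)).mapL (M'.ρ F)
    refine h1.unique ?_
    refine HasSum.congr_fun (f := fun _ => (0 : H')) hasSum_zero fun p => ?_
    by_cases hp : Φ p * G = 0
    · rw [← rep_mul_apply, hp]; simp
    · obtain ⟨x, hx⟩ : ∃ x, (Φ p * G) x ≠ 0 := by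
        by_contra! h
        exact hp (by ext z; simpa using h z)
      rw [ZeroAtInftyContinuousMap.mul_apply, mul_ne_zero_iff, hΦz] at hx
      have hx2 : dist x (p.2 • (p.1 : Z)) < 2 := by
        by_contra! h
        exact hx.1 (by rw [hφ0 p x h]; simp)
      rw [hWa]
      refine M'.U_apply_mem p.2 (hJsupp p.1 _) F ?_
      rintro _ ⟨z, hz, rfl⟩
      by_contra hFz
      refine hFG (p.2 • z) x hFz hx.2 ?_
      have h2 : dist (p.2 • z) (p.2 • f p.1) < 2 := by rw [dist_smul]; exact hz
      have h3 := hfS x _ hx2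
      rw [hfe] at h3
      have h4 := dist_triangle_right (f x) (p.2 • z) (p.2 • f (p.1 : Z))
      simp only [near]
      linarith
  · have hcl : IsClosed ((M'.supportedIn A'ᶜ)ᗮ : Set H') := Submodule.isClosed_orthogonal _
    refine hcl.mem_of_tendsto (hV v) (Filter.Eventually.of_forall fun s => ?_)
    refine Submodule.sum_mem _ fun p _ => ?_
    rw [hWa, Submodule.mem_orthogonal']
    intro u hu
    rw [M'.inner_U_left]
    refine Submodule.inner_left_of_mem_orthogonal ?_ (hJA p.1 _)
    refine M'.supportedIn_mono ?_ (M'.U_apply_mem p.2⁻¹ hu)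
    rintro _ ⟨z, hz, rfl⟩ hz'
    refine hz ?_
    have := hA'inv p.2 _ hz'
    rwa [smul_inv_smul] at this
  · have hcl : IsClosed {v | ‖V v‖ = ‖v‖} := isClosed_eq V.continuous.norm continuous_norm
    have hsub : (M.compactlySupportedIn A : Set H) ⊆ {v | ‖V v‖ = ‖v‖} := by
      rintro v ⟨K, hKA, hK, hv⟩
      obtain ⟨s, hs⟩ : ∃ s : Finset (D × Γ), ∀ p ∉ s, ∀ z ∈ K, φ p z = 0 := by
        rcases K.eq_empty_or_nonempty with rfl | ⟨z₀, -⟩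
        · exact ⟨∅, fun p _ z hz => hz.elim⟩
        · obtain ⟨r, hr⟩ := hK.isBounded.subset_closedBall z₀
          refine ⟨(hD.finite_near z₀ (r + 2)).toFinset, fun p hp z hz => hφ0 p z ?_⟩
          rw [Set.Finite.mem_toFinset] at hp
          have h1 : r + 2 < dist (p.2 • (p.1 : Z)) z₀ := not_le.1 hp
          have h2 : dist z z₀ ≤ r := hr hz
          have h3 := dist_triangle_left (p.2 • (p.1 : Z)) z₀ z
          linarith
      have h1 : HasSum (fun p => ‖M.ρ (Φ p) v‖ ^ 2) (∑ p ∈ s, ‖M.ρ (Φ p) v‖ ^ 2) := by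
        refine hasSum_sum_of_ne_finset_zero fun p hp => ?_
        rw [hv (Φ p) fun z hz => by rw [hΦz, hs p hp z hz]; simp]
        simp
      have h2 : M.ρ (∑ p ∈ s, Φ p * Φ p) v = v := by
        refine M.apply_eq_self hv _ fun z hz => ?_
        rw [hsumz, hφ1 z (hKA hz) s fun p hp => hs p hp z hz, Complex.ofReal_one]
      have h3 := hsum s v
      rw [h2, inner_self_eq_norm_sq_to_K, ← (hVn v).unique h1] at h3
      have h4 : ‖V v‖ ^ 2 = ‖v‖ ^ 2 := by
        refine Complex.ofReal_injective (h3.trans ?_)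
        norm_cast
      exact (pow_left_inj₀ (norm_nonneg _) (norm_nonneg _) two_ne_zero).1 h4
    exact closure_minimal hsub hcl (M.orthogonal_supportedIn_compl_le A hv)

end existence

/-! ### The projections `χ_K` and the partial isometries `P_s` -/

section chi

variable {Γ Z H : Type*} [Group Γ] [MetricSpace Z] [MulAction Γ Z]
  [NormedAddCommGroup H] [InnerProductSpace ℂ H] [CompleteSpace H] (M : GeomModule Γ Z H)

lemma GeomModule.chi_mem (K : Set Z) (v : H) : M.chi K v ∈ M.supportedIn K :=
  Submodule.starProjection_apply_mem _ v

lemma GeomModule.chi_eq_self {K : Set Z} {v : H} : M.chi K v = v ↔ v ∈ M.supportedIn K :=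
  Submodule.starProjection_eq_self_iff

lemma GeomModule.sub_chi_mem (K : Set Z) (v : H) : v - M.chi K v ∈ (M.supportedIn K)ᗮ :=
  Submodule.sub_starProjection_mem_orthogonal v

lemma GeomModule.chi_eq_zero {K : Set Z} {v : H} (hv : v ∈ (M.supportedIn K)ᗮ) :
    M.chi K v = 0 :=
  (Submodule.starProjection_apply_eq_zero_iff _).2 hv

lemma GeomModule.chi_inner (K : Set Z) (v w : H) : ⟪M.chi K v, w⟫_ℂ = ⟪v, M.chi K w⟫_ℂ :=
  Submodule.inner_starProjection_left_eq_right _ v w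

lemma GeomModule.star_chi (K : Set Z) : star (M.chi K) = M.chi K := by
  rw [ContinuousLinearMap.star_eq_adjoint]
  exact ((ContinuousLinearMap.eq_adjoint_iff _ _).2 fun v w => M.chi_inner K v w).symm

/-- An operator preserving `χ_K H` and its orthogonal complement commutes with `χ_K`. -/
lemma GeomModule.chi_comm {K : Set Z} {T : H →L[ℂ] H}
    (h1 : ∀ v ∈ M.supportedIn K, T v ∈ M.supportedIn K)
    (h2 : ∀ v ∈ (M.supportedIn K)ᗮ, T v ∈ (M.supportedIn K)ᗮ) (v : H) :
    M.chi K (T v) = T (M.chi K v) := by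
  have e : T v = T (M.chi K v) + T (v - M.chi K v) := by rw [← map_add, add_sub_cancel]
  rw [e, map_add, M.chi_eq_zero (h2 _ (M.sub_chi_mem K v)), add_zero]
  exact M.chi_eq_self.2 (h1 _ (M.chi_mem K v))

lemma GeomModule.rho_mem (f : C₀(Z, ℂ)) {K : Set Z} {v : H} (hv : v ∈ M.supportedIn K) :
    M.ρ f v ∈ M.supportedIn K :=
  SuppOn.rep_apply (ρ := M.ρ) hv f fun _ hz _ => hz

lemma GeomModule.chi_rho (K : Set Z) (f : C₀(Z, ℂ)) (v : H) :
    M.chi K (M.ρ f v) = M.ρ f (M.chi K v) := by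
  refine M.chi_comm (fun v hv => M.rho_mem f hv) (fun v hv => ?_) v
  rw [Submodule.mem_orthogonal]
  intro u hu
  have := M.inner_apply (star f) u v
  rw [star_star] at this
  rw [← this]
  exact Submodule.inner_right_of_mem_orthogonal (M.rho_mem _ hu) hv

variable [ProperSpace Z] [IsIsometricSMul Γ Z]

lemma GeomModule.U_mem {K : Set Z} (hK : ∀ (γ : Γ), ∀ z ∈ K, γ • z ∈ K) (γ : Γ) {v : H}
    (hv : v ∈ M.supportedIn K) : (M.U γ : H →L[ℂ] H) v ∈ M.supportedIn K := by
  refine M.supportedIn_mono ?_ (M.U_apply_mem γ hv)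
  rintro _ ⟨z, hz, rfl⟩
  exact hK γ z hz

lemma GeomModule.chi_U {K : Set Z} (hK : ∀ (γ : Γ), ∀ z ∈ K, γ • z ∈ K) (γ : Γ) (v : H) :
    M.chi K ((M.U γ : H →L[ℂ] H) v) = (M.U γ : H →L[ℂ] H) (M.chi K v) := by
  refine M.chi_comm (fun v hv => M.U_mem hK γ hv) (fun v hv => ?_) v
  rw [Submodule.mem_orthogonal']
  intro u hu
  rw [M.inner_U_left]
  exact Submodule.inner_left_of_mem_orthogonal (M.U_mem hK _ hu) hv

end chi

section parts

variable {Γ X : Type*} [Group Γ] [MetricSpace X] [MulAction Γ X] (E : CylindricalEnd Γ X)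

lemma CylindricalEnd.part_anti {s t : ℝ≥0} (h : s ≤ t) : E.part t ⊆ E.part s := by
  rintro _ ⟨y, r, hr, rfl⟩
  exact ⟨y, r, h.trans hr, rfl⟩

lemma CylindricalEnd.smul_mem_part (R : ℝ≥0) (γ : Γ) {x : X} (hx : x ∈ E.part R) :
    γ • x ∈ E.part R := by
  obtain ⟨y, t, ht, rfl⟩ := hx
  exact ⟨γ • y, t, ht, E.equivariant γ y t⟩

/-- The companion of `CylindricalEnd.dist_le` for the coordinate in `ℝ₊`. -/
lemma CylindricalEnd.dist_le' (y y' : E.base) (s t : ℝ≥0) :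
    dist s t ≤ dist (E.ι y s) (E.ι y' t) := by
  rw [E.isometry]
  exact Real.le_sqrt_of_sq_le (by nlinarith [sq_nonneg (dist y y')])

lemma CylindricalEnd.continuous_ι : Continuous fun p : E.base × ℝ≥0 => E.ι p.1 p.2 := by
  refine continuous_iff_continuousAt.2 fun p => ?_
  rw [ContinuousAt, tendsto_iff_dist_tendsto_zero]
  have : (fun q : E.base × ℝ≥0 => dist (E.ι q.1 q.2) (E.ι p.1 p.2))
      = fun q => √(dist q.1 p.1 ^ 2 + dist q.2 p.2 ^ 2) := by
    funext q; rw [E.isometry]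
  rw [this]
  have hc : Continuous fun q : E.base × ℝ≥0 => √(dist q.1 p.1 ^ 2 + dist q.2 p.2 ^ 2) := by
    fun_prop
  simpa using hc.tendsto p

lemma CylindricalEnd.isClosed_part [CompleteSpace X] (R : ℝ≥0) : IsClosed (E.part R) := by
  have : CompleteSpace E.base := E.isClosed_base.completeSpace_coe
  refine IsSeqClosed.isClosed fun u x hu hx => ?_
  choose y t ht hyt using hu
  have hc := hx.cauchySeq
  rw [Metric.cauchySeq_iff] at hc
  have hy : CauchySeq y := Metric.cauchySeq_iff.2 fun ε hε => by
    obtain ⟨N, hN⟩ := hc ε hε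
    refine ⟨N, fun m hm n hn => (E.dist_le _ _ (t m) (t n)).trans_lt ?_⟩
    rw [hyt, hyt]; exact hN m hm n hn
  have ht' : CauchySeq t := Metric.cauchySeq_iff.2 fun ε hε => by
    obtain ⟨N, hN⟩ := hc ε hε
    refine ⟨N, fun m hm n hn => (E.dist_le' (y m) (y n) _ _).trans_lt ?_⟩
    rw [hyt, hyt]; exact hN m hm n hn
  obtain ⟨y₀, hy₀⟩ := cauchySeq_tendsto_of_complete hy
  obtain ⟨t₀, ht₀⟩ := cauchySeq_tendsto_of_complete ht'
  have hlim := (E.continuous_ι.tendsto (y₀, t₀)).comp (hy₀.prodMk_nhds ht₀)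
  have h2 : (fun p : E.base × ℝ≥0 => E.ι p.1 p.2) ∘ (fun n => (y n, t n)) = u := funext hyt
  rw [h2] at hlim
  exact ⟨y₀, t₀, ge_of_tendsto' ht₀ ht, tendsto_nhds_unique hlim hx⟩

end parts

section lebesgue

open MeasureTheory

lemma lebesgue_apply (s : Set ℝ≥0) :
    lebesgue s = volume ((fun t : ℝ≥0 => (t : ℝ)) '' s) :=
  (MeasurableEmbedding.subtype_coe measurableSet_Ici).comap_apply volume s

/-- Translates of null sets are null. -/
lemma ae_sub_of_ae {p : ℝ≥0 → Prop} (h : ∀ᵐ t ∂lebesgue, p t) (s : ℝ≥0) :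
    ∀ᵐ t ∂lebesgue, s ≤ t → p (t - s) := by
  rw [ae_iff, lebesgue_apply] at h ⊢
  refine measure_mono_null (t := (fun x : ℝ => x + s) '' ((fun t : ℝ≥0 => (t : ℝ)) '' {t | ¬ p t}))
    ?_ ?_
  · rintro _ ⟨t, ht, rfl⟩
    simp only [Set.mem_ofPred_eq, Classical.not_imp] at ht
    refine ⟨((t - s : ℝ≥0) : ℝ), ⟨t - s, ht.2, rfl⟩, ?_⟩
    simp only
    rw [NNReal.coe_sub ht.1, sub_add_cancel]
  · rw [Set.image_add_right, measure_preimage_add_right]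
    exact h

end lebesgue

section tailored

variable {Γ X H : Type*} [Group Γ] [MetricSpace X] [CompleteSpace X] [MulAction Γ X]
  [NormedAddCommGroup H] [InnerProductSpace ℂ H] [CompleteSpace H] {E : CylindricalEnd Γ X}
  (M : TailoredModule E H)

/-- The kernel of `P_s` contains the orthogonal complement of `χ_{Y_∞} H`. -/
lemma TailoredModule.P_chi_of_pos {s : ℝ≥0} (hs : 0 < s) (v : H) :
    M.P s (M.chi (E.part 0) v) = M.P s v := by
  have h1 : M.P s (v - M.chi (E.part 0) v) = 0 := by
    rw [← inner_self_eq_zero (𝕜 := ℂ), ← ContinuousLinearMap.adjoint_inner_left,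
      ← ContinuousLinearMap.star_eq_adjoint]
    have h2 := DFunLike.congr_fun (M.star_P_mul_P s hs) (v - M.chi (E.part 0) v)
    rw [M.chi_eq_zero (M.sub_chi_mem _ v)] at h2
    change star (M.P s) (M.P s _) = 0 at h2
    rw [h2, inner_zero_left]
  rw [map_sub, sub_eq_zero] at h1
  exact h1.symm

lemma TailoredModule.P_mem_of_pos {s : ℝ≥0} (hs : 0 < s) (v : H) :
    M.P s v ∈ M.supportedIn (E.part s) := by
  have h1 := DFunLike.congr_fun (M.star_P_mul_P s hs) v
  have h2 := DFunLike.congr_fun (M.P_mul_star_P s hs) (M.P s v)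
  change star (M.P s) (M.P s v) = _ at h1
  change M.P s (star (M.P s) (M.P s v)) = _ at h2
  rw [h1, M.P_chi_of_pos hs] at h2
  rw [h2]
  exact M.chi_mem _ _

/-- By strong continuity, `P₀` is the projection to the part over the end. -/
lemma TailoredModule.P_zero : M.P 0 = M.chi (E.part 0) := by
  obtain ⟨K, _, _, _, MY, W, hWW, -, -, -, hP⟩ := M.standard
  have hWW' : ∀ v, ContinuousLinearMap.adjoint W (W v) = M.chi (E.part 0) v := fun v =>
    DFunLike.congr_fun hWW v
  ext v
  have hmem : M.P 0 v ∈ M.supportedIn (E.part 0) := by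
    have hlim : Filter.Tendsto (fun s => M.P s v) (nhdsWithin 0 (Set.Ioi 0)) (nhds (M.P 0 v)) :=
      ((M.continuous_P v).tendsto 0).mono_left nhdsWithin_le_nhds
    refine (M.isClosed_supportedIn _).mem_of_tendsto hlim ?_
    filter_upwards [self_mem_nhdsWithin] with s hs
    exact M.supportedIn_mono (E.part_anti (zero_le)) (M.P_mem_of_pos hs v)
  have hW : W (M.P 0 v) = W v := by
    refine MeasureTheory.Lp.ext ?_
    filter_upwards [hP 0 v] with t ht
    rw [ht, if_pos (zero_le), tsub_zero]
  rw [← M.chi_eq_self.2 hmem, ← hWW', hW, hWW']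

lemma TailoredModule.star_P_P (s : ℝ≥0) (v : H) :
    star (M.P s) (M.P s v) = M.chi (E.part 0) v := by
  rcases eq_zero_or_pos s with rfl | hs
  · rw [M.P_zero, M.star_chi]
    exact M.chi_eq_self.2 (M.chi_mem _ v)
  · exact DFunLike.congr_fun (M.star_P_mul_P s hs) v

lemma TailoredModule.P_star_P (s : ℝ≥0) (v : H) :
    M.P s (star (M.P s) v) = M.chi (E.part s) v := by
  rcases eq_zero_or_pos s with rfl | hs
  · rw [M.P_zero, M.star_chi]
    exact M.chi_eq_self.2 (M.chi_mem _ v)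
  · exact DFunLike.congr_fun (M.P_mul_star_P s hs) v

lemma TailoredModule.P_chi (s : ℝ≥0) (v : H) : M.P s (M.chi (E.part 0) v) = M.P s v := by
  rcases eq_zero_or_pos s with rfl | hs
  · rw [M.P_zero]
    exact M.chi_eq_self.2 (M.chi_mem _ v)
  · exact M.P_chi_of_pos hs v

lemma TailoredModule.P_mem (s : ℝ≥0) (v : H) : M.P s v ∈ M.supportedIn (E.part s) := by
  rcases eq_zero_or_pos s with rfl | hs
  · rw [M.P_zero]
    exact M.chi_mem _ v
  · exact M.P_mem_of_pos hs v

end tailored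

/-! ### The standard representation on `L²(ℝ₊; H_Y)` -/

open MeasureTheory

section base

variable {Γ X : Type*} [Group Γ] [MetricSpace X] [ProperSpace X] [MulAction Γ X]
  (E : CylindricalEnd Γ X)

lemma CylindricalEnd.properSpace_base : ProperSpace E.base :=
  ProperSpace.of_isClosed E.isClosed_base

instance CylindricalEnd.isIsometricSMul_base [IsIsometricSMul Γ X] : IsIsometricSMul Γ E.base where
  isometry_smul γ := Isometry.of_dist_eq fun y y' => by
    rw [Subtype.dist_eq, Subtype.dist_eq]
    exact dist_smul γ (y : X) y'

instance CylindricalEnd.properlyDiscontinuousSMul_base [ProperlyDiscontinuousSMul Γ X] :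
    ProperlyDiscontinuousSMul Γ E.base where
  finite_disjoint_inter_image {K L} hK hL := by
    refine (ProperlyDiscontinuousSMul.finite_disjoint_inter_image (Γ := Γ)
      (hK.image continuous_subtype_val) (hL.image continuous_subtype_val)).subset ?_
    rintro γ ⟨_, ⟨y, hy, rfl⟩, hyL⟩
    exact ⟨γ • (y : X), ⟨y, ⟨y, hy, rfl⟩, rfl⟩, ⟨γ • y, hyL, rfl⟩⟩

end base

section std

variable {Γ X K : Type*} [Group Γ] [MetricSpace X] [ProperSpace X] [MulAction Γ X]
  {E : CylindricalEnd Γ X}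
  [NormedAddCommGroup K] [InnerProductSpace ℂ K] [CompleteSpace K]

/-- The standard representation is given pointwise by the action of the slices. -/
lemma CylindricalEnd.stdRep_ae (E : CylindricalEnd Γ X) (MY : GeomModule Γ E.base K)
    (F : C₀(X, ℂ)) (h : L2 K) :
    ∀ᵐ t ∂lebesgue, E.stdRep MY F h t = MY.ρ (E.slice F t) (h t) := by
  have h1 := (ContinuousLinearMap.id ℂ (K →L[ℂ] K)).coeFn_holder (r := 2)
    ((E.memLp_slice MY F).toLp) h
  filter_upwards [h1, (E.memLp_slice MY F).coeFn_toLp] with t ht ht2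
  rw [ht2] at ht
  exact ht

/-- The standard representation, as a `*`-homomorphism. -/
def CylindricalEnd.stdHom (E : CylindricalEnd Γ X) (MY : GeomModule Γ E.base K) :
    C₀(X, ℂ) →⋆ₙₐ[ℂ] (L2 K →L[ℂ] L2 K) where
  toFun := E.stdRep MY
  map_smul' c F := by
    ext1 h
    refine Lp.ext ?_
    filter_upwards [E.stdRep_ae MY (c • F) h, E.stdRep_ae MY F h,
      Lp.coeFn_smul c (E.stdRep MY F h)] with t h1 h2 h3
    rw [h1]
    refine Eq.trans ?_ h3.symm
    rw [Pi.smul_apply, h2, show E.slice (c • F) t = c • E.slice F t from rfl, map_smul]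
    rfl
  map_zero' := by
    ext1 h
    refine Lp.ext ?_
    filter_upwards [E.stdRep_ae MY 0 h, Lp.coeFn_zero K 2 lebesgue] with t h1 h2
    rw [h1, show E.slice 0 t = 0 from rfl, map_zero]
    exact h2.symm
  map_add' F G := by
    ext1 h
    refine Lp.ext ?_
    filter_upwards [E.stdRep_ae MY (F + G) h, E.stdRep_ae MY F h, E.stdRep_ae MY G h,
      Lp.coeFn_add (E.stdRep MY F h) (E.stdRep MY G h)] with t h1 h2 h3 h4
    rw [h1]
    refine Eq.trans ?_ h4.symm
    rw [Pi.add_apply, h2, h3, show E.slice (F + G) t = E.slice F t + E.slice G t from rfl, map_add]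
    rfl
  map_mul' F G := by
    ext1 h
    refine Lp.ext ?_
    filter_upwards [E.stdRep_ae MY (F * G) h, E.stdRep_ae MY G h,
      E.stdRep_ae MY F (E.stdRep MY G h)] with t h1 h2 h3
    rw [h1]
    refine Eq.trans ?_ h3.symm
    rw [h2, ← rep_mul_apply]
    rfl
  map_star' F := by
    rw [ContinuousLinearMap.star_eq_adjoint]
    refine (ContinuousLinearMap.eq_adjoint_iff _ _).2 fun h k => ?_
    rw [L2.inner_def, L2.inner_def]
    refine integral_congr_ae ?_
    filter_upwards [E.stdRep_ae MY (star F) h, E.stdRep_ae MY F k] with t h1 h2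
    rw [h1, h2, show E.slice (star F) t = star (E.slice F t) from rfl, rep_inner, star_star]

lemma CylindricalEnd.stdHom_ae (E : CylindricalEnd Γ X) (MY : GeomModule Γ E.base K)
    (F : C₀(X, ℂ)) (h : L2 K) :
    ∀ᵐ t ∂lebesgue, E.stdHom MY F h t = MY.ρ (E.slice F t) (h t) :=
  E.stdRep_ae MY F h

/-- The standard representation is nondegenerate: almost every value of a vector annihilated by
a sequence of cutoff functions exhausting `X` is annihilated by all compactly supported functions
on the base. -/
lemma CylindricalEnd.nondeg_stdHom (E : CylindricalEnd Γ X) (MY : GeomModule Γ E.base K) :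
    Nondeg (E.stdHom MY) := by
  intro h hh
  have := E.properSpace_base
  let B := CompactExhaustion.choice X
  choose φ hφ1 _ hφs using fun n => exists_cutoff (B.isCompact n) isClosed_empty
    (Set.disjoint_empty _)
  let F : ℕ → C₀(X, ℂ) := fun n => ofCompact (φ n) (φ n).continuous (hφs n)
  refine Lp.ext ?_
  have hall : ∀ᵐ t ∂lebesgue, ∀ n, MY.ρ (E.slice (F n) t) (h t) = 0 := by
    refine ae_all_iff.2 fun n => ?_
    filter_upwards [E.stdHom_ae MY (F n) h, Lp.coeFn_zero K 2 lebesgue] with t h1 h2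
    rw [← h1, hh]
    exact h2
  filter_upwards [hall, Lp.coeFn_zero K 2 lebesgue] with t h1 h2
  rw [h2]
  refine MY.nondegenerate _ fun g => ?_
  have hcl : IsClosed {g : C₀(E.base, ℂ) | MY.ρ g (h t) = 0} :=
    isClosed_eq ((rep_continuous MY.ρ).clm_apply continuous_const) continuous_const
  refine closure_minimal ?_ hcl (mem_closure_compact_support g)
  rintro k ⟨hk, -⟩
  obtain ⟨n, hn⟩ := B.exists_superset_of_isCompact (hk.image (E.isometry_slice t).continuous)
  have hkF : k * E.slice (F n) t = k := by
    ext y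
    by_cases hy : k y = 0
    · simp [hy]
    · have h3 : φ n (E.ι y t) = 1 := hφ1 n _ (hn ⟨y, subset_tsupport _ hy, rfl⟩)
      have h4 : E.slice (F n) t y = 1 := by
        change ((φ n (E.ι y t) : ℝ) : ℂ) = 1
        rw [h3, Complex.ofReal_one]
      rw [ZeroAtInftyContinuousMap.mul_apply, h4, mul_one]
  change MY.ρ k (h t) = 0
  rw [← hkF, rep_mul_apply, h1, map_zero]

end std

section amplification

variable {K K' : Type*}
  [NormedAddCommGroup K] [InnerProductSpace ℂ K] [CompleteSpace K]
  [NormedAddCommGroup K'] [InnerProductSpace ℂ K'] [CompleteSpace K']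

lemma norm_compLpL_of_isometric {T : K →L[ℂ] K'} (hT : ∀ v, ‖T v‖ = ‖v‖) (h : L2 K) :
    ‖T.compLpL 2 lebesgue h‖ = ‖h‖ := by
  rw [Lp.norm_def, Lp.norm_def]
  congr 1
  refine eLpNorm_congr_norm_ae ?_
  filter_upwards [T.coeFn_compLpL (p := 2) h] with t ht
  rw [ht, hT]

/-- The Hilbert space `K` embeds isometrically into `L²(ℝ₊; K)`. -/
lemma exists_isometry_to_L2 : ∃ j : K → L2 K, Isometry j := by
  have hs : MeasurableSet (Set.Iic (1 : ℝ≥0)) := measurableSet_Iic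
  have h1 : (lebesgue (Set.Iic (1 : ℝ≥0))) = 1 := by
    rw [lebesgue_apply]
    have : (fun t : ℝ≥0 => (t : ℝ)) '' Set.Iic 1 = Set.Icc 0 1 := by
      ext x
      constructor
      · rintro ⟨t, ht, rfl⟩
        exact ⟨t.2, ht⟩
      · rintro ⟨h0, h1⟩
        exact ⟨⟨x, h0⟩, h1, rfl⟩
    rw [this, Real.volume_Icc]
    simp
  refine ⟨fun k => indicatorConstLp 2 hs (by rw [h1]; exact ENNReal.one_ne_top) k,
    Isometry.of_dist_eq fun k l => ?_⟩
  rw [dist_eq_norm, indicatorConstLp_sub, norm_indicatorConstLp two_ne_zero ENNReal.ofNat_ne_top,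
    dist_eq_norm, Measure.real, h1]
  simp

end amplification

section amplificationCtrl

variable {Γ X X' K K' : Type*} [Group Γ] [MetricSpace X] [ProperSpace X] [MulAction Γ X]
  [MetricSpace X'] [ProperSpace X'] [MulAction Γ X']
  {E : CylindricalEnd Γ X} {E' : CylindricalEnd Γ X'}
  [NormedAddCommGroup K] [InnerProductSpace ℂ K] [CompleteSpace K]
  [NormedAddCommGroup K'] [InnerProductSpace ℂ K'] [CompleteSpace K']

/-- If `T` covers `g` on the bases, then `1 ⊗ T` covers every map given by `g` on the slices. -/
lemma ctrl_compLpL {MY : GeomModule Γ E.base K} {MY' : GeomModule Γ E'.base K'} {f : X → X'}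
    {g : E.base → E'.base} (hfg : ∀ y t, f (E.ι y t) = E'.ι (g y) t) {T : K →L[ℂ] K'} {R : ℝ}
    (hT : Ctrl MY.ρ MY'.ρ (near g R) T) :
    Ctrl (E.stdHom MY) (E'.stdHom MY') (near f R) (T.compLpL 2 lebesgue) := by
  intro F G hFG
  ext1 h
  refine Lp.ext ?_
  filter_upwards [E'.stdHom_ae MY' F (T.compLpL 2 lebesgue (E.stdHom MY G h)),
    T.coeFn_compLpL (p := 2) (E.stdHom MY G h), E.stdHom_ae MY G h, Lp.coeFn_zero K' 2 lebesgue]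
    with t h1 h2 h3 h4
  refine h1.trans (Eq.trans ?_ h4.symm)
  rw [h2, h3]
  refine DFunLike.congr_fun (hT (E'.slice F t) (E.slice G t) fun y' y hF hG hr => ?_) (h t)
  refine hFG (E'.ι y' t) (E.ι y t) hF hG ?_
  rw [near, hfg, (E'.isometry_slice t).dist_eq]
  exact hr

end amplificationCtrl

/-! ### Existence of isometries of tailored modules covering a coarse map -/

section ctrl

variable {Z Z' Z'' H H' H'' : Type*} [MetricSpace Z] [MetricSpace Z'] [MetricSpace Z'']
  [NormedAddCommGroup H] [InnerProductSpace ℂ H] [CompleteSpace H]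
  [NormedAddCommGroup H'] [InnerProductSpace ℂ H'] [CompleteSpace H']
  [NormedAddCommGroup H''] [InnerProductSpace ℂ H''] [CompleteSpace H'']
  {ρ : C₀(Z, ℂ) →⋆ₙₐ[ℂ] (H →L[ℂ] H)} {ρ' : C₀(Z', ℂ) →⋆ₙₐ[ℂ] (H' →L[ℂ] H')}
  {ρ'' : C₀(Z'', ℂ) →⋆ₙₐ[ℂ] (H'' →L[ℂ] H'')}

/-- The identity expands distances in a controlled way. -/
lemma expansive_id (R : ℝ) (hR : 0 < R) :
    ∃ S : ℝ, 0 < S ∧ ∀ x y : Z, dist x y < R → dist (id x) (id y) < S :=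
  ⟨R, hR, fun _ _ h => h⟩

lemma Ctrl.add {r : Z' → Z → Prop} {S T : H →L[ℂ] H'} (hS : Ctrl ρ ρ' r S)
    (hT : Ctrl ρ ρ' r T) : Ctrl ρ ρ' r (S + T) := by
  intro F G h
  rw [ContinuousLinearMap.add_comp, ContinuousLinearMap.comp_add, hS F G h, hT F G h, add_zero]

/-- If `T₁` covers `φ` and `T₂` covers `ψ`, then `T₂ T₁` covers `ψ ∘ φ`. -/
lemma Ctrl.comp_near (hρ' : Nondeg ρ') {φ : Z → Z'} {ψ : Z' → Z''}
    (hψ : ∀ R : ℝ, 0 < R → ∃ S : ℝ, 0 < S ∧ ∀ x y, dist x y < R → dist (ψ x) (ψ y) < S)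
    {T₁ : H →L[ℂ] H'} {T₂ : H' →L[ℂ] H''} {R₁ R₂ : ℝ} (hR₁ : 0 < R₁) (hR₂ : 0 < R₂)
    (h₁ : Ctrl ρ ρ' (near φ R₁) T₁) (h₂ : Ctrl ρ' ρ'' (near ψ R₂) T₂) :
    ∃ R, 0 < R ∧ Ctrl ρ ρ'' (near (ψ ∘ φ) R) (T₂ ∘L T₁) := by
  obtain ⟨S, hS, hψS⟩ := hψ (R₁ + 1) (by positivity)
  refine ⟨S + R₂, by positivity, (h₂.comp hρ' h₁ one_pos).mono ?_⟩
  rintro z x ⟨y', y, h1, h2, h3⟩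
  simp only [near] at h1 h3 ⊢
  have h4 : dist (φ x) y' < R₁ + 1 := by
    have := dist_triangle_right (φ x) y' y
    linarith
  have h5 := hψS _ _ h4
  have h6 := dist_triangle (ψ (φ x)) (ψ y') z
  simp only [Function.comp]
  linarith

lemma Ctrl.adjoint_near_id {σ : C₀(Z, ℂ) →⋆ₙₐ[ℂ] (H' →L[ℂ] H')} {R : ℝ} {T : H →L[ℂ] H'}
    (h : Ctrl ρ σ (near id R) T) :
    Ctrl σ ρ (near id R) (ContinuousLinearMap.adjoint T) :=
  h.adjoint.mono fun x' x hx => by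
    simp only [near, id] at hx ⊢
    rwa [dist_comm]

end ctrl

section std

variable {Γ X H K : Type*} [Group Γ] [MetricSpace X] [ProperSpace X] [MulAction Γ X]
  [NormedAddCommGroup H] [InnerProductSpace ℂ H] [CompleteSpace H]
  [NormedAddCommGroup K] [InnerProductSpace ℂ K] [CompleteSpace K] {E : CylindricalEnd Γ X}

/-- The operator `W` identifies the part of a tailored module over the end with the standard
module `L²(ℝ₊; H_Y)`. -/
structure IsStandardForm (M : TailoredModule E H) (MY : GeomModule Γ E.base K)
    (W : H →L[ℂ] L2 K) : Prop where
  adjoint_apply : ∀ v, ContinuousLinearMap.adjoint W (W v) = M.chi (E.part 0) v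
  apply_adjoint : ∀ h, W (ContinuousLinearMap.adjoint W h) = h
  equivariant : ∀ (γ : Γ) v, W ((M.U γ : H →L[ℂ] H) v) =
    (MY.U γ : K →L[ℂ] K).compLpL 2 lebesgue (W v)
  ctrl : ∃ R, 0 < R ∧ Ctrl M.ρ (E.stdHom MY) (near id R) W
  apply_P : ∀ (s : ℝ≥0) (v : H), ∀ᵐ t ∂lebesgue,
    (W (M.P s v)) t = if s ≤ t then (W v) (t - s) else 0

variable {M : TailoredModule E H} {MY : GeomModule Γ E.base K} {W : H →L[ℂ] L2 K}

lemma IsStandardForm.chi_adjoint (hW : IsStandardForm M MY W) (h : L2 K) :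
    M.chi (E.part 0) (ContinuousLinearMap.adjoint W h) = ContinuousLinearMap.adjoint W h := by
  rw [← hW.adjoint_apply, hW.apply_adjoint]

lemma IsStandardForm.norm_adjoint (hW : IsStandardForm M MY W) (h : L2 K) :
    ‖ContinuousLinearMap.adjoint W h‖ = ‖h‖ := by
  rw [← sq_eq_sq₀ (norm_nonneg _) (norm_nonneg _), ← Complex.ofReal_inj]
  push_cast
  have h1 := inner_self_eq_norm_sq_to_K (𝕜 := ℂ) (ContinuousLinearMap.adjoint W h)
  have h2 := inner_self_eq_norm_sq_to_K (𝕜 := ℂ) h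
  rw [ContinuousLinearMap.adjoint_inner_left, hW.apply_adjoint] at h1
  exact h1.symm.trans h2

lemma IsStandardForm.norm_apply (hW : IsStandardForm M MY W) (v : H) :
    ‖W v‖ = ‖M.chi (E.part 0) v‖ := by
  rw [← hW.norm_adjoint, hW.adjoint_apply]

lemma IsStandardForm.eq_of_apply_eq (hW : IsStandardForm M MY W) {v w : H}
    (hv : v ∈ M.supportedIn (E.part 0)) (hw : w ∈ M.supportedIn (E.part 0)) (h : W v = W w) :
    v = w := by
  rw [← M.chi_eq_self.2 hv, ← M.chi_eq_self.2 hw, ← hW.adjoint_apply, h, hW.adjoint_apply]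

/-- The module `H_Y` of a standard form is separable if `H` is, since it embeds into
`L²(ℝ₊; H_Y)` and hence into `H`. -/
lemma IsStandardForm.separableSpace (hW : IsStandardForm M MY W)
    [TopologicalSpace.SeparableSpace H] : TopologicalSpace.SeparableSpace K := by
  have : SecondCountableTopology H := UniformSpace.secondCountable_of_separable H
  obtain ⟨j, hj⟩ := exists_isometry_to_L2 (K := K)
  have h2 : Isometry (ContinuousLinearMap.adjoint W) :=
    AddMonoidHomClass.isometry_of_norm _ hW.norm_adjoint
  have := (h2.comp hj).isEmbedding.secondCountableTopology
  infer_instance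

variable [IsIsometricSMul Γ X]

lemma IsStandardForm.adjoint_equivariant (hW : IsStandardForm M MY W) (γ : Γ) (h : L2 K) :
    ContinuousLinearMap.adjoint W ((MY.U γ : K →L[ℂ] K).compLpL 2 lebesgue h) =
      (M.U γ : H →L[ℂ] H) (ContinuousLinearMap.adjoint W h) := by
  have h1 := hW.equivariant γ (ContinuousLinearMap.adjoint W h)
  rw [hW.apply_adjoint] at h1
  rw [← h1, hW.adjoint_apply, M.chi_U fun γ z hz => E.smul_mem_part 0 γ hz, hW.chi_adjoint]

end std

section existence

universe w w'

variable {Γ X X' : Type*} {H : Type w} {H' : Type w'} [Group Γ]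
  [MetricSpace X] [ProperSpace X] [MulAction Γ X]
  [IsIsometricSMul Γ X] [ProperlyDiscontinuousSMul Γ X]
  [MetricSpace X'] [ProperSpace X'] [MulAction Γ X']
  [IsIsometricSMul Γ X'] [ProperlyDiscontinuousSMul Γ X']
  [NormedAddCommGroup H] [InnerProductSpace ℂ H] [CompleteSpace H]
  [NormedAddCommGroup H'] [InnerProductSpace ℂ H'] [CompleteSpace H']
  {E : CylindricalEnd Γ X} {E' : CylindricalEnd Γ X'}

lemma TailoredModule.exists_isStandardForm (M : TailoredModule E H) :
    ∃ (K : Type w) (_ : NormedAddCommGroup K) (_ : InnerProductSpace ℂ K)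
      (_ : CompleteSpace K) (MY : GeomModule Γ E.base K) (W : H →L[ℂ] L2 K),
      IsStandardForm M MY W := by
  obtain ⟨K, i1, i2, i3, MY, W, h1, h2, h3, h4, h5⟩ := M.standard
  refine ⟨K, i1, i2, i3, MY, W, fun v => DFunLike.congr_fun h1 v, fun v => DFunLike.congr_fun h2 v,
    fun γ v => DFunLike.congr_fun (h3 γ) v, ?_, h5⟩
  exact ctrl_of_coversMap (ρ' := E.stdHom MY) expansive_id h4

/-- Over the end, the isometry is `1 ⊗ V_Y` on `L²(ℝ₊; H_Y)` for an isometry `V_Y` covering the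
restriction of the map to the bases; over the complement of the end it is any isometry covering
the map which takes values over the complement of the end. -/
theorem exists_covers [TopologicalSpace.SeparableSpace H]
    (hfree' : ∀ (γ : Γ) (x : X'), γ • x = x → γ = 1)
    (M : TailoredModule E H) (M' : TailoredModule E' H') {f : X → X'}
    (hf : IsCylindricalCoarseMap E E' f) : ∃ V : H →ₗᵢ[ℂ] H', Covers M M' f V := by
  obtain ⟨K, _, _, _, MY, W, hW⟩ := M.exists_isStandardForm
  obtain ⟨K', _, _, _, MY', W', hW'⟩ := M'.exists_isStandardForm
  obtain ⟨g, hg, hfg⟩ := hf.on_end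
  have := hW.separableSpace
  have := E.properSpace_base
  have := E'.properSpace_base
  obtain ⟨VY, hVYe, ⟨RY, hRY, hVYc⟩, -, hVYn⟩ := exists_covering_operator (A := Set.univ)
    (A' := Set.univ) (fun γ (y : E'.base) h => hfree' γ (y : X') (congrArg Subtype.val h))
    MY MY' (f := g)
    (fun R hR => by
      obtain ⟨S, hS, h⟩ := hf.expansive R hR
      refine ⟨S, hS, fun x y hxy => ?_⟩
      rw [Subtype.dist_eq, hg, hg]
      exact h _ _ hxy)
    (fun γ y => Subtype.ext <| by
      rw [hg]
      exact (hf.equivariant γ y).trans (congrArg (γ • ·) (hg y).symm))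
    isOpen_univ (fun _ _ _ => Set.mem_univ _) (fun _ _ => Set.mem_univ _)
  obtain ⟨VC, hVCe, ⟨RC, hRC, hVCc⟩, hVCo, hVCn⟩ := exists_covering_operator
    (A := (E.part 0)ᶜ) (A' := (E'.part 0)ᶜ) hfree' M.toGeomModule M'.toGeomModule hf.expansive
    hf.equivariant (E'.isClosed_part 0).isOpen_compl
    (fun γ z hz h => hz (by simpa using E'.smul_mem_part 0 γ⁻¹ h)) hf.mapsTo_compl
  rw [compl_compl] at hVCn
  simp only [compl_compl] at hVCo
  -- no nonzero vector is supported in the empty set, so `VY` is isometric everywhere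
  have hVYn' : ∀ v, ‖VY v‖ = ‖v‖ := fun v => hVYn v <| by
    rw [Submodule.mem_orthogonal]
    intro u hu
    rw [MY.nondegenerate u fun f => hu f (by simp), inner_zero_left]
  let T := VY.compLpL 2 lebesgue
  have hTn : ∀ h, ‖T h‖ = ‖h‖ := norm_compLpL_of_isometric hVYn'
  have hTe : ∀ (γ : Γ) h, T ((MY.U γ : K →L[ℂ] K).compLpL 2 lebesgue h) =
      (MY'.U γ : K' →L[ℂ] K').compLpL 2 lebesgue (T h) := by
    intro γ h
    refine Lp.ext ?_
    filter_upwards [VY.coeFn_compLpL (p := 2) ((MY.U γ : K →L[ℂ] K).compLpL 2 lebesgue h),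
      (MY.U γ : K →L[ℂ] K).coeFn_compLpL (p := 2) h,
      (MY'.U γ : K' →L[ℂ] K').coeFn_compLpL (p := 2) (T h),
      VY.coeFn_compLpL (p := 2) h] with t h1 h2 h3 h4
    rw [h1, h2, h3, h4, hVYe]
  let A' := ContinuousLinearMap.adjoint W'
  let χ := M.chi (E.part 0)
  -- the summands over the end and over its complement, which have orthogonal ranges
  let V₀ : H →L[ℂ] H' := A' ∘L (T ∘L W)
  let V₁ : H →L[ℂ] H' := VC ∘L (ContinuousLinearMap.id ℂ H - χ)
  have hV₀ : ∀ v, V₀ v = A' (T (W v)) := fun _ => rfl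
  have hV₁ : ∀ v, V₁ v = VC (v - χ v) := fun _ => rfl
  have hV₀mem : ∀ v, V₀ v ∈ M'.supportedIn (E'.part 0) := fun v =>
    M'.chi_eq_self.1 (hW'.chi_adjoint _)
  have hV₁mem : ∀ v, V₁ v ∈ (M'.supportedIn (E'.part 0))ᗮ := fun v => hVCo _
  have hnorm : ∀ v, ‖(V₀ + V₁) v‖ = ‖v‖ := by
    intro v
    rw [← sq_eq_sq₀ (norm_nonneg _) (norm_nonneg _), sq, sq, add_apply,
      norm_add_sq_eq_norm_sq_add_norm_sq_of_inner_eq_zero (𝕜 := ℂ) _ _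
        (Submodule.inner_right_of_mem_orthogonal (hV₀mem v) (hV₁mem v))]
    have h1 : ‖V₀ v‖ = ‖χ v‖ := by
      rw [hV₀, hW'.norm_adjoint, hTn, hW.norm_apply]
    have h2 : ‖V₁ v‖ = ‖v - χ v‖ := hVCn _ (M.sub_chi_mem _ v)
    rw [h1, h2, ← norm_add_sq_eq_norm_sq_add_norm_sq_of_inner_eq_zero (𝕜 := ℂ) _ _
      (Submodule.inner_right_of_mem_orthogonal (M.chi_mem _ v) (M.sub_chi_mem _ v)),
      add_sub_cancel]
  have hctrl : ∃ R, 0 < R ∧ Ctrl M.ρ M'.ρ (near f R) (V₀ + V₁) := by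
    obtain ⟨R, hR, hWc⟩ := hW.ctrl
    obtain ⟨R', hR', hWc'⟩ := hW'.ctrl
    obtain ⟨R₁, hR₁, h1⟩ := hWc.comp_near (E.nondeg_stdHom MY) hf.expansive hR hRY
      (ctrl_compLpL hfg hVYc)
    obtain ⟨R₂, hR₂, h2⟩ := h1.comp_near (E'.nondeg_stdHom MY') expansive_id hR₁ hR'
      hWc'.adjoint_near_id
    refine ⟨max R₂ RC, lt_max_of_lt_left hR₂, Ctrl.add ?_ ?_⟩
    · exact h2.mono fun x' x h => lt_of_lt_of_le h (le_max_left _ _)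
    · refine Ctrl.mono (r := near f RC) ?_ fun x' x h => lt_of_lt_of_le h (le_max_right _ _)
      -- `1 - χ` commutes with the action of functions
      intro F G hFG
      ext1 v
      have := DFunLike.congr_fun (hVCc F G hFG) (v - χ v)
      change M'.ρ F (VC (M.ρ G v - χ (M.ρ G v))) = 0
      rw [M.chi_rho, ← map_sub]
      exact this
  let V : H →ₗᵢ[ℂ] H' := ⟨(V₀ + V₁).toLinearMap, hnorm⟩
  have hVv : ∀ v, V v = V₀ v + V₁ v := fun _ => rfl
  refine ⟨V, fun γ v => ?_, ?_, fun s v => ?_⟩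
  · rw [hVv, hVv, map_add, hV₀, hV₁, hW.equivariant, hTe, hW'.adjoint_equivariant,
      M.chi_U fun γ z hz => E.smul_mem_part 0 γ hz, ← map_sub, hVCe]
    rfl
  · obtain ⟨R, hR, h⟩ := hctrl
    exact coversMap_of_ctrl hf.expansive hR h
  · -- the summand over the complement is killed by the translations on both sides, and over the
    -- end the identity is checked in `L²(ℝ₊; H_Y)`, where `1 ⊗ VY` commutes with translations
    have hPs : M.P s v ∈ M.supportedIn (E.part 0) :=
      M.supportedIn_mono (E.part_anti zero_le) (M.P_mem s v)
    have h1 : V₁ (M.P s v) = 0 := by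
      rw [hV₁, M.chi_eq_self.2 hPs, sub_self, map_zero]
    have h2 : M'.P s (V₁ v) = 0 := by
      rw [← M'.P_chi, M'.chi_eq_zero (hV₁mem v), map_zero]
    rw [hVv, hVv, map_add, h1, h2, add_zero, add_zero]
    refine hW'.eq_of_apply_eq (hV₀mem _)
      (M'.supportedIn_mono (E'.part_anti zero_le) (M'.P_mem s _)) ?_
    rw [hV₀, hW'.apply_adjoint]
    refine Lp.ext ?_
    filter_upwards [hW'.apply_P s (V₀ v), VY.coeFn_compLpL (p := 2) (W (M.P s v)),
      hW.apply_P s v, ae_sub_of_ae (VY.coeFn_compLpL (p := 2) (W v)) s] with t h1 h2 h3 h4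
    rw [h1, h2, h3, hV₀, hW'.apply_adjoint]
    split_ifs with hst
    · exact (h4 hst).symm
    · exact map_zero _

end existence

/-! ### Conjugation preserves the algebraic Roe algebras -/

/-- The operator `V T W^*` for isometries `V` and `W`. -/
def conjPair {H H' : Type*}
    [NormedAddCommGroup H] [InnerProductSpace ℂ H] [CompleteSpace H]
    [NormedAddCommGroup H'] [InnerProductSpace ℂ H'] [CompleteSpace H']
    (V W : H →ₗᵢ[ℂ] H') (T : H →L[ℂ] H) : H' →L[ℂ] H' :=
  V.toContinuousLinearMap ∘L T ∘L ContinuousLinearMap.adjoint W.toContinuousLinearMap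

section isometry

variable {H H' : Type*}
  [NormedAddCommGroup H] [InnerProductSpace ℂ H] [CompleteSpace H]
  [NormedAddCommGroup H'] [InnerProductSpace ℂ H'] [CompleteSpace H'] (V W : H →ₗᵢ[ℂ] H')

/-- The adjoint of an isometry. -/
def adj : H' →L[ℂ] H := ContinuousLinearMap.adjoint V.toContinuousLinearMap

lemma adj_inner_left (w : H') (v : H) : ⟪adj V w, v⟫_ℂ = ⟪w, V v⟫_ℂ :=
  ContinuousLinearMap.adjoint_inner_left _ _ _

lemma adj_inner_right (v : H) (w : H') : ⟪v, adj V w⟫_ℂ = ⟪V v, w⟫_ℂ :=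
  ContinuousLinearMap.adjoint_inner_right _ _ _

lemma adj_apply (v : H) : adj V (V v) = v :=
  ext_inner_right ℂ fun u => by rw [adj_inner_left, V.inner_map_map]

lemma norm_adj_le (w : H') : ‖adj V w‖ ≤ ‖w‖ := by
  refine (ContinuousLinearMap.le_opNorm _ _).trans (mul_le_of_le_one_left (norm_nonneg _) ?_)
  rw [adj, LinearIsometryEquiv.norm_map]
  exact V.norm_toContinuousLinearMap_le

lemma conjPair_apply (T : H →L[ℂ] H) (w : H') : conjPair V W T w = V (T (adj W w)) := rfl

end isometry

section parts

variable {Γ X H : Type*} [Group Γ] [MetricSpace X] [ProperSpace X] [MulAction Γ X]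
  [IsIsometricSMul Γ X] [ProperlyDiscontinuousSMul Γ X]
  [NormedAddCommGroup H] [InnerProductSpace ℂ H] [CompleteSpace H] {E : CylindricalEnd Γ X}
  (M : TailoredModule E H)

/-- The semigroup law of the translations. -/
lemma TailoredModule.P_P (s t : ℝ≥0) (v : H) : M.P s (M.P t v) = M.P (s + t) v := by
  obtain ⟨K, _, _, _, MY, W, hW⟩ := M.exists_isStandardForm
  have hmem : ∀ s v, M.P s v ∈ M.supportedIn (E.part 0) := fun s v =>
    M.supportedIn_mono (E.part_anti zero_le) (M.P_mem s v)
  refine hW.eq_of_apply_eq (hmem _ _) (hmem _ _) ?_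
  refine MeasureTheory.Lp.ext ?_
  filter_upwards [hW.apply_P s (M.P t v), hW.apply_P (s + t) v, ae_sub_of_ae (hW.apply_P t v) s]
    with r h1 h2 h3
  rw [h1, h2]
  split_ifs with hs hst hst
  · rw [h3 hs, if_pos (le_tsub_of_add_le_left hst), tsub_add_eq_tsub_tsub]
  · rw [h3 hs, if_neg fun h => hst ?_]
    rw [add_comm]
    exact (le_tsub_iff_right hs).1 h
  · exact absurd (le_self_add.trans hst) hs
  · rfl

/-- The translation by `s` moves supports in the end by `s`. -/
lemma TailoredModule.P_mem_part {R : ℝ≥0} {v : H} (hv : v ∈ M.supportedIn (E.part R)) (s : ℝ≥0) :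
    M.P s v ∈ M.supportedIn (E.part (R + s)) := by
  rw [← M.chi_eq_self.2 hv, ← M.P_star_P, M.P_P, add_comm]
  exact M.P_mem _ _

lemma TailoredModule.chi_star_P (s : ℝ≥0) (v : H) :
    M.chi (E.part 0) (star (M.P s) v) = star (M.P s) v := by
  refine ext_inner_right ℂ fun u => ?_
  rw [M.chi_inner, ContinuousLinearMap.star_eq_adjoint, ContinuousLinearMap.adjoint_inner_left,
    ContinuousLinearMap.adjoint_inner_left, M.P_chi]

lemma isCylindricalCoarseMap_id : IsCylindricalCoarseMap E E id where
  proper _ hB := hB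
  expansive := expansive_id
  equivariant _ _ := rfl
  mapsTo_compl _ hx := hx
  on_end := ⟨id, fun _ => rfl, fun _ _ => rfl⟩

end parts

section ctrl

variable {Γ X X' H H' : Type*} [Group Γ] [MetricSpace X] [ProperSpace X] [MulAction Γ X]
  [IsIsometricSMul Γ X] [ProperlyDiscontinuousSMul Γ X]
  [MetricSpace X'] [ProperSpace X'] [MulAction Γ X']
  [IsIsometricSMul Γ X'] [ProperlyDiscontinuousSMul Γ X']
  [NormedAddCommGroup H] [InnerProductSpace ℂ H] [CompleteSpace H]
  [NormedAddCommGroup H'] [InnerProductSpace ℂ H'] [CompleteSpace H']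
  {E : CylindricalEnd Γ X} {E' : CylindricalEnd Γ X'}
  {M : TailoredModule E H} {M' : TailoredModule E' H'} {f : X → X'}

/-- An operator controlled in the direction opposite to `f` moves supports far out in the end by
a bounded amount only. -/
lemma exists_part_shift (hf : IsCylindricalCoarseMap E E' f) {r : ℝ} {L : H' →L[ℂ] H}
    (hL : Ctrl M'.ρ M.ρ (fun x x' => dist (f x) x' < r) L) :
    ∃ c : ℝ≥0, ∀ Q, c ≤ Q → ∀ w ∈ M'.supportedIn (E'.part Q),
      L w ∈ M.supportedIn (E.part (Q - c)) := by
  obtain ⟨c₀, hc₀⟩ := E'.separated (r + 1)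
  obtain ⟨g, -, hfg⟩ := hf.on_end
  refine ⟨max c₀ (r + 1).toNNReal, fun Q hQ w hw => ?_⟩
  refine SuppOn.mono (hL.suppOn_apply M'.nondeg hw one_pos) ?_
  rintro x ⟨x', hx', hxx'⟩
  obtain ⟨_, ⟨y, t, ht, rfl⟩, hyt⟩ := Metric.mem_thickening_iff.1 hx'
  have hd : dist (E'.ι y t) (f x) < r + 1 := by
    have := dist_triangle_left (E'.ι y t) (f x) x'
    rw [dist_comm x' (f x)] at this
    linarith
  have h1 : f x ∈ E'.part 0 := by
    by_contra h
    refine absurd (hc₀ y t ((le_max_left _ _).trans (hQ.trans ht)) (f x) fun y' t' he => ?_)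
      (not_le.2 hd)
    exact h ⟨y', t', zero_le, he⟩
  have h2 : x ∈ E.part 0 := by
    by_contra h
    exact hf.mapsTo_compl x h h1
  obtain ⟨y₀, t₀, -, rfl⟩ := h2
  rw [hfg] at hd
  have h3 := (E'.dist_le' _ _ _ _).trans_lt hd
  rw [NNReal.dist_eq] at h3
  refine ⟨y₀, t₀, ?_, rfl⟩
  rw [tsub_le_iff_right]
  refine ht.trans (NNReal.coe_le_coe.1 ?_)
  have h4 : r + 1 ≤ ((max c₀ (r + 1).toNNReal : ℝ≥0) : ℝ) :=
    (Real.le_coe_toNNReal _).trans (NNReal.coe_le_coe.2 (le_max_right _ _))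
  have h5 := le_abs_self ((t : ℝ) - t₀)
  push_cast at h4 ⊢
  linarith

end ctrl

section finiteProp

variable {Γ Z H : Type*} [Group Γ] [MetricSpace Z] [MulAction Γ Z]
  [NormedAddCommGroup H] [InnerProductSpace ℂ H] [CompleteSpace H] {M : GeomModule Γ Z H}

lemma GeomModule.FinitePropagation.exists_ctrl {T : H →L[ℂ] H} (hT : M.FinitePropagation T) :
    ∃ R, 0 < R ∧ Ctrl M.ρ M.ρ (near id R) T := by
  obtain ⟨R, hR, h⟩ := hT
  refine ⟨R + 1, by positivity, fun F G hFG => h F G fun x hx y hy => ?_⟩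
  have := hFG x y hx hy
  simp only [near, id, not_lt] at this
  rw [dist_comm] at this
  linarith

lemma finitePropagation_of_ctrl {T : H →L[ℂ] H} {R : ℝ} (hR : 0 < R)
    (hT : Ctrl M.ρ M.ρ (near id R) T) : M.FinitePropagation T := by
  refine ⟨R, hR, fun F G h => hT F G fun x y hx hy hr => ?_⟩
  have := h x hx y hy
  simp only [near, id] at hr
  rw [dist_comm] at hr
  linarith

lemma GeomModule.equivariant_iff {T : H →L[ℂ] H} :
    M.Equivariant T ↔ ∀ γ v, T ((M.U γ : H →L[ℂ] H) v) = (M.U γ : H →L[ℂ] H) (T v) := by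
  have h1 : ∀ γ, star (M.U γ : H →L[ℂ] H) * (M.U γ : H →L[ℂ] H) = 1 := fun γ =>
    Unitary.coe_star_mul_self _
  have h2 : ∀ γ, (M.U γ : H →L[ℂ] H) * star (M.U γ : H →L[ℂ] H) = 1 := fun γ =>
    Unitary.coe_mul_star_self _
  constructor
  · intro h γ v
    have h3 : (M.U γ : H →L[ℂ] H) * T = T * (M.U γ : H →L[ℂ] H) := by
      conv_lhs => rw [h γ]
      rw [← mul_assoc, ← mul_assoc, h2, one_mul]
    exact (DFunLike.congr_fun h3 v).symm
  · intro h γ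
    have h3 : T * (M.U γ : H →L[ℂ] H) = (M.U γ : H →L[ℂ] H) * T :=
      ContinuousLinearMap.ext fun v => h γ v
    rw [mul_assoc, h3, ← mul_assoc, h1, one_mul]

end finiteProp

section conj

variable {Γ X X' H H' : Type*} [Group Γ] [MetricSpace X] [ProperSpace X] [MulAction Γ X]
  [IsIsometricSMul Γ X] [ProperlyDiscontinuousSMul Γ X]
  [MetricSpace X'] [ProperSpace X'] [MulAction Γ X']
  [IsIsometricSMul Γ X'] [ProperlyDiscontinuousSMul Γ X']
  [NormedAddCommGroup H] [InnerProductSpace ℂ H] [CompleteSpace H]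
  [NormedAddCommGroup H'] [InnerProductSpace ℂ H'] [CompleteSpace H']
  {E : CylindricalEnd Γ X} {E' : CylindricalEnd Γ X'}
  {M : TailoredModule E H} {M' : TailoredModule E' H'} {f : X → X'} {V W : H →ₗᵢ[ℂ] H'}

lemma Covers.exists_ctrl (hV : Covers M M' f V) (hf : IsCylindricalCoarseMap E E' f) :
    ∃ R, 0 < R ∧ Ctrl M.ρ M'.ρ (near f R) V.toContinuousLinearMap :=
  ctrl_of_coversMap hf.expansive hV.covers

lemma Covers.exists_ctrl_adj (hV : Covers M M' f V) (hf : IsCylindricalCoarseMap E E' f) :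
    ∃ R, 0 < R ∧ Ctrl M'.ρ M.ρ (fun x x' => dist (f x) x' < R) (adj V) := by
  obtain ⟨R, hR, h⟩ := hV.exists_ctrl hf
  exact ⟨R, hR, h.adjoint⟩

lemma Covers.adj_U (hV : Covers M M' f V) (γ : Γ) (w : H') :
    adj V ((M'.U γ : H' →L[ℂ] H') w) = (M.U γ : H →L[ℂ] H) (adj V w) :=
  ext_inner_right ℂ fun u => by
    rw [adj_inner_left, M'.inner_U_left, M.inner_U_left, adj_inner_left, hV.equivariant]

lemma Covers.apply_chi (hV : Covers M M' f V) (v : H) :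
    V (M.chi (E.part 0) v) = M'.chi (E'.part 0) (V v) := by
  rw [← M.P_zero, ← M'.P_zero, hV.intertwines]

lemma Covers.adj_chi (hV : Covers M M' f V) (w : H') :
    adj V (M'.chi (E'.part 0) w) = M.chi (E.part 0) (adj V w) :=
  ext_inner_right ℂ fun u => by
    rw [adj_inner_left, M'.chi_inner, M.chi_inner, adj_inner_left, hV.apply_chi]

lemma Covers.star_P_adj (hV : Covers M M' f V) (s : ℝ≥0) (w : H') :
    star (M.P s) (adj V w) = adj V (star (M'.P s) w) :=
  ext_inner_right ℂ fun u => by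
    rw [ContinuousLinearMap.star_eq_adjoint, ContinuousLinearMap.star_eq_adjoint,
      ContinuousLinearMap.adjoint_inner_left, adj_inner_left, adj_inner_left,
      ContinuousLinearMap.adjoint_inner_left, hV.intertwines]

/-- On vectors supported in `ι(Y × [s, ∞))`, the isometry intertwines the adjoints `P_s^*`. -/
lemma Covers.star_P_apply (hV : Covers M M' f V) {s : ℝ≥0} {v : H}
    (hv : v ∈ M.supportedIn (E.part s)) : star (M'.P s) (V v) = V (star (M.P s) v) := by
  have h : V v = M'.P s (V (star (M.P s) v)) := by
    rw [← hV.intertwines, M.P_star_P, M.chi_eq_self.2 hv]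
  rw [h, M'.star_P_P, ← hV.apply_chi, M.chi_star_P]

/-- Far out in the end, the adjoint intertwines the translations as well. -/
lemma Covers.adj_P (hV : Covers M M' f V) {s : ℝ≥0} {w : H'}
    (hw : adj V (M'.P s w) ∈ M.supportedIn (E.part s)) :
    adj V (M'.P s w) = M.P s (adj V w) := by
  rw [← M.chi_eq_self.2 hw, ← M.P_star_P, hV.star_P_adj, M'.star_P_P, hV.adj_chi, M.P_chi]

/-- Conjugation preserves asymptotic invariance: far out in the end the operators in question
move supports by a bounded amount, so that `V` and `W^*` intertwine the translations there. -/
lemma asymptoticallyInvariant_conjPair (hf : IsCylindricalCoarseMap E E' f)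
    (hV : Covers M M' f V) (hW : Covers M M' f W) {T : H →L[ℂ] H} (hT : M.FinitePropagation T)
    (h : M.AsymptoticallyInvariant T) : M'.AsymptoticallyInvariant (conjPair V W T) := by
  obtain ⟨r, -, hr⟩ := hW.exists_ctrl_adj hf
  obtain ⟨c, hc⟩ := exists_part_shift hf hr
  obtain ⟨r', -, hr'⟩ := hT.exists_ctrl
  obtain ⟨c', hc'⟩ := exists_part_shift (M := M) (M' := M) isCylindricalCoarseMap_id
    (hr'.mono fun x' x hx => show dist (id x') x < r' by
      simp only [near, id] at hx ⊢
      rwa [dist_comm])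
  intro ε hε
  obtain ⟨R₀, hR₀⟩ := h ε hε
  refine ⟨max R₀ c' + c, fun R hR s hs => ContinuousLinearMap.opNorm_le_bound _ hε.le fun w => ?_⟩
  have hcR : c ≤ R := le_add_self.trans hR
  have hR1 : max R₀ c' ≤ R - c := le_tsub_of_add_le_right hR
  have hw := M'.chi_mem (E'.part R) w
  set w' := M'.chi (E'.part R) w with hw'
  set u := adj W w' with hu
  have hum : u ∈ M.supportedIn (E.part (R - c)) := hc R hcR _ hw
  have hPu : adj W (M'.P s w') = M.P s u := by
    refine hW.adj_P (M.supportedIn_mono (E.part_anti ?_)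
      (hc _ (hcR.trans le_self_add) _ (M'.P_mem_part hw s)))
    rw [← tsub_add_eq_add_tsub hcR]
    exact le_add_self
  have hTPu : T (M.P s u) ∈ M.supportedIn (E.part s) := by
    have h1 : c' ≤ R - c := (le_max_right _ _).trans hR1
    refine M.supportedIn_mono (E.part_anti ?_)
      (hc' _ (h1.trans le_self_add) _ (M.P_mem_part hum s))
    rw [← tsub_add_eq_add_tsub h1]
    exact le_add_self
  have hkey : ((star (M'.P s) * conjPair V W T * M'.P s - conjPair V W T) * M'.chi (E'.part R)) w
      = V (((star (M.P s) * T * M.P s - T) * M.chi (E.part (R - c))) u) := by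
    change star (M'.P s) (V (T (adj W (M'.P s w')))) - V (T u) =
      V (star (M.P s) (T (M.P s (M.chi _ u))) - T (M.chi _ u))
    rw [hPu, hV.star_P_apply hTPu, M.chi_eq_self.2 hum, map_sub]
  rw [hkey, V.norm_map]
  refine (ContinuousLinearMap.le_of_opNorm_le _
    (hR₀ (R - c) ((le_max_left _ _).trans hR1) s hs) u).trans ?_
  refine mul_le_mul_of_nonneg_left ?_ hε.le
  exact (norm_adj_le W w').trans (Submodule.norm_starProjection_apply_le _ w)

lemma finitePropagation_conjPair (hf : IsCylindricalCoarseMap E E' f)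
    (hV : Covers M M' f V) (hW : Covers M M' f W) {T : H →L[ℂ] H} (hT : M.FinitePropagation T) :
    M'.FinitePropagation (conjPair V W T) := by
  obtain ⟨r, hr0, hr⟩ := hW.exists_ctrl_adj hf
  obtain ⟨r', hr0', hr'⟩ := hT.exists_ctrl
  obtain ⟨q, hq0, hq⟩ := hV.exists_ctrl hf
  obtain ⟨p, hp0, hp⟩ := hr'.comp_near M.nondeg hf.expansive hr0' hq0 hq
  obtain ⟨S, hS, hfS⟩ := hf.expansive 1 one_pos
  have h := hp.comp M.nondeg hr one_pos
  refine finitePropagation_of_ctrl (R := p + S + r) (by positivity) (Ctrl.mono (T :=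
    (V.toContinuousLinearMap ∘L T) ∘L adj W) h ?_)
  rintro z x ⟨y', y, h1, h2, h3⟩
  simp only [near, id, Function.comp] at h1 ⊢
  have h4 := hfS _ _ h2
  have h5 := dist_triangle4 x (f y) (f y') z
  rw [dist_comm x (f y), dist_comm (f y) (f y')] at h5
  linarith

/-- For compactly supported `F`, the operator `V^* ρ'(F)` takes values in vectors supported in a
fixed compact set, because `f` is proper. -/
lemma Covers.exists_cutoff_adj (hV : Covers M M' f V) (hf : IsCylindricalCoarseMap E E' f)
    {F : C₀(X', ℂ)} (hF : HasCompactSupport F) :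
    ∃ h : C₀(X, ℂ), star h = h ∧ ∀ w, M.ρ h (adj V (M'.ρ F w)) = adj V (M'.ρ F w) := by
  obtain ⟨r, hr0, hr⟩ := hV.exists_ctrl_adj hf
  have hB : Bornology.IsBounded (f ⁻¹' Metric.thickening r (Function.support F)) :=
    hf.proper _ ((hF.isCompact.isBounded.subset (subset_tsupport _)).thickening)
  obtain ⟨φ, h1, -, h3⟩ := exists_cutoff hB.isCompact_closure isClosed_empty
    (Set.disjoint_empty _)
  refine ⟨ofCompact φ φ.continuous h3, ?_, fun w => ?_⟩
  · ext z
    exact Complex.conj_ofReal _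
  · refine SuppOn.rep_eq_self M.nondeg (hr.suppOn_apply_rep F w) fun z hz => ?_
    obtain ⟨x, hx, hzx⟩ := hz
    have : φ z = 1 := h1 z (subset_closure (Metric.mem_thickening_iff.2 ⟨x, hx, hzx⟩))
    change ((φ z : ℝ) : ℂ) = 1
    rw [this, Complex.ofReal_one]

lemma locallyCompact_conjPair (hf : IsCylindricalCoarseMap E E' f)
    (hV : Covers M M' f V) (hW : Covers M M' f W) {T : H →L[ℂ] H} (hT : M.LocallyCompact T) :
    M'.LocallyCompact (conjPair V W T) := by
  intro F
  have hc := rep_continuous M'.ρ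
  constructor
  · have hcl : IsClosed {F | IsCompactOperator (conjPair V W T * M'.ρ F)} :=
      isClosed_setOfPred_isCompactOperator.preimage (continuous_const.mul hc)
    refine closure_minimal ?_ hcl (mem_closure_compact_support F)
    rintro G ⟨hG, -⟩
    obtain ⟨h, -, hh⟩ := hW.exists_cutoff_adj hf hG
    have : conjPair V W T * M'.ρ G =
        V.toContinuousLinearMap ∘L (T * M.ρ h) ∘L (adj W ∘L M'.ρ G) := by
      ext1 w
      change V (T (adj W (M'.ρ G w))) = V (T (M.ρ h (adj W (M'.ρ G w))))
      rw [hh]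
    rw [Set.mem_ofPred_eq, this]
    exact ((hT h).1.comp_clm _).clm_comp _
  · have hcl : IsClosed {F | IsCompactOperator (M'.ρ F * conjPair V W T)} :=
      isClosed_setOfPred_isCompactOperator.preimage (hc.mul continuous_const)
    refine closure_minimal ?_ hcl (mem_closure_compact_support F)
    rintro G ⟨hG, -⟩
    obtain ⟨h, hs, hh⟩ := hV.exists_cutoff_adj hf (F := star G)
      (hG.comp_left (g := star) (star_zero ℂ))
    have h2 : ∀ v, M'.ρ G (V v) = M'.ρ G (V (M.ρ h v)) := fun v =>
      ext_inner_right ℂ fun w => by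
        rw [rep_inner, rep_inner, ← adj_inner_right, ← adj_inner_right, rep_inner, hs, hh]
    have : M'.ρ G * conjPair V W T =
        (M'.ρ G ∘L V.toContinuousLinearMap) ∘L (M.ρ h * T) ∘L adj W := by
      ext1 w
      exact h2 _
    rw [Set.mem_ofPred_eq, this]
    exact ((hT h).2.comp_clm (adj W)).clm_comp (M'.ρ G ∘L V.toContinuousLinearMap)

theorem conjPair_mem_algRoeEnd (hf : IsCylindricalCoarseMap E E' f)
    (hV : Covers M M' f V) (hW : Covers M M' f W) {T : H →L[ℂ] H} (hT : T ∈ M.algRoeEnd) :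
    conjPair V W T ∈ M'.algRoeEnd := by
  obtain ⟨⟨h1, h2, h3⟩, h4⟩ := hT
  refine ⟨⟨locallyCompact_conjPair hf hV hW h1, finitePropagation_conjPair hf hV hW h2, ?_⟩,
    asymptoticallyInvariant_conjPair hf hV hW h2 h4⟩
  rw [GeomModule.equivariant_iff] at h3 ⊢
  intro γ w
  rw [conjPair_apply, conjPair_apply, hW.adj_U, h3, hV.equivariant]

end conj

/-! ### Conjugation on the quotient modules -/

section quot

variable {Γ Z H : Type*} [Group Γ] [MetricSpace Z] [ProperSpace Z] [MulAction Γ Z]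
  [IsIsometricSMul Γ Z] [ProperlyDiscontinuousSMul Γ Z]
  [NormedAddCommGroup H] [InnerProductSpace ℂ H] [CompleteSpace H] (M : GeomModule Γ Z H)

/-- The map `H_c → H_N` as a linear map. -/
def GeomModule.toQuotₗ (N : Subgroup Γ) : M.compactlySupported →ₗ[ℂ] M.Quot N where
  toFun v := M.toQuot v
  map_add' v w := UniformSpace.Completion.coe_add (α := M.PreQuot N) v w
  map_smul' c v := UniformSpace.Completion.coe_smul (X := M.PreQuot N) c v

lemma GeomModule.denseRange_toQuotₗ (N : Subgroup Γ) : DenseRange (M.toQuotₗ N) :=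
  UniformSpace.Completion.denseRange_coe (α := M.PreQuot N)

lemma GeomModule.inner_toQuot (N : Subgroup Γ) (v w : M.compactlySupported) :
    ⟪(M.toQuot v : M.Quot N), M.toQuot w⟫_ℂ = M.form N v w :=
  UniformSpace.Completion.inner_coe (𝕜 := ℂ) (E := M.PreQuot N) v w

variable {M}

/-- Continuous operators on `H_N` are determined on the image of `H_c`. -/
lemma GeomModule.quot_ext {N : Subgroup Γ} {B : Type*} [NormedAddCommGroup B] [NormedSpace ℂ B]
    {S T : M.Quot N →L[ℂ] B} (h : ∀ v : M.compactlySupported, S (M.toQuot v) = T (M.toQuot v)) :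
    S = T :=
  ContinuousLinearMap.ext fun x => congrFun
    ((M.denseRange_toQuotₗ N).equalizer S.continuous T.continuous (funext h)) x

lemma GeomModule.prod_ext {S T : M.QuotProd}
    (h : ∀ N, M.component S N = M.component T N) : S = T :=
  Subtype.ext (funext h)

lemma GeomModule.component_mul (S T : M.QuotProd) (N) :
    M.component (S * T) N = M.component S N * M.component T N := rfl

lemma GeomModule.component_star (S : M.QuotProd) (N) :
    M.component (star S) N = star (M.component S N) := rfl

/-- An operator on `H` induces at most one family of operators on the quotients `H_N`. -/
lemma GeomModule.Induces.unique {T : H →L[ℂ] H} {S S' : M.QuotProd} (h : M.Induces T S)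
    (h' : M.Induces T S') : S = S' :=
  GeomModule.prod_ext fun N => GeomModule.quot_ext fun v => by
    obtain ⟨_, h1⟩ := h v
    obtain ⟨_, h2⟩ := h' v
    rw [h1, h2]

lemma mem_compactlySupported_of_suppOn {B : Set Z} (hB : Bornology.IsBounded B) {v : H}
    (hv : SuppOn M.ρ B v) : v ∈ M.compactlySupported :=
  ⟨closure B, hB.isCompact_closure, hv.mono subset_closure⟩

end quot

/-- An equivariant isometry which, together with its adjoint, preserves compactly supported
vectors. -/
structure PreservesCompact {Γ Z Z' H H' : Type*} [Group Γ] [MetricSpace Z] [MulAction Γ Z]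
    [MetricSpace Z'] [MulAction Γ Z']
    [NormedAddCommGroup H] [InnerProductSpace ℂ H] [CompleteSpace H]
    [NormedAddCommGroup H'] [InnerProductSpace ℂ H'] [CompleteSpace H']
    (M : GeomModule Γ Z H) (M' : GeomModule Γ Z' H') (V : H →ₗᵢ[ℂ] H') : Prop where
  equivariant : ∀ γ v, V ((M.U γ : H →L[ℂ] H) v) = (M'.U γ : H' →L[ℂ] H') (V v)
  map_mem : ∀ v ∈ M.compactlySupported, V v ∈ M'.compactlySupported
  adj_mem : ∀ w ∈ M'.compactlySupported, adj V w ∈ M.compactlySupported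

section conj

variable {Γ Z Z' H H' : Type*} [Group Γ] [MetricSpace Z] [ProperSpace Z] [MulAction Γ Z]
  [IsIsometricSMul Γ Z] [ProperlyDiscontinuousSMul Γ Z]
  [MetricSpace Z'] [ProperSpace Z'] [MulAction Γ Z']
  [IsIsometricSMul Γ Z'] [ProperlyDiscontinuousSMul Γ Z']
  [NormedAddCommGroup H] [InnerProductSpace ℂ H] [CompleteSpace H]
  [NormedAddCommGroup H'] [InnerProductSpace ℂ H'] [CompleteSpace H']
  {M : GeomModule Γ Z H} {M' : GeomModule Γ Z' H'} {V W X : H →ₗᵢ[ℂ] H'}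

namespace PreservesCompact

/-- The restriction of the isometry to compactly supported vectors. -/
def mapₗ (hV : PreservesCompact M M' V) : M.compactlySupported →ₗ[ℂ] M'.compactlySupported :=
  V.toLinearMap.restrict hV.map_mem

/-- The restriction of the adjoint to compactly supported vectors. -/
def adjₗ (hV : PreservesCompact M M' V) : M'.compactlySupported →ₗ[ℂ] M.compactlySupported :=
  (adj V).toLinearMap.restrict hV.adj_mem

lemma adjₗ_mapₗ (hV : PreservesCompact M M' V) (v : M.compactlySupported) :
    hV.adjₗ (hV.mapₗ v) = v :=
  Subtype.ext (adj_apply V v)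

/-- The adjoint of `V` is also adjoint to `V` for the forms `⟨·, ·⟩_N`. -/
lemma form_adjₗ (hV : PreservesCompact M M' V) (N : Subgroup Γ) (w : M'.compactlySupported)
    (v : M.compactlySupported) : M.form N (hV.adjₗ w) v = M'.form N w (hV.mapₗ v) := by
  refine finsum_congr fun n => ?_
  change ⟪adj V w, _⟫_ℂ = ⟪(w : H'), (M'.U (n : Γ) : H' →L[ℂ] H') (V v)⟫_ℂ
  rw [adj_inner_left, hV.equivariant]

lemma norm_toQuot_mapₗ (hV : PreservesCompact M M' V) (N : Subgroup Γ)
    (v : M.compactlySupported) :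
    ‖(M'.toQuot (hV.mapₗ v) : M'.Quot N)‖ = ‖(M.toQuot v : M.Quot N)‖ := by
  rw [← sq_eq_sq₀ (norm_nonneg _) (norm_nonneg _), ← Complex.ofReal_inj]
  push_cast
  have h1 := inner_self_eq_norm_sq_to_K (𝕜 := ℂ) (M'.toQuot (hV.mapₗ v) : M'.Quot N)
  have h2 := inner_self_eq_norm_sq_to_K (𝕜 := ℂ) (M.toQuot v : M.Quot N)
  rw [M'.inner_toQuot, ← hV.form_adjₗ, hV.adjₗ_mapₗ] at h1
  rw [M.inner_toQuot] at h2
  exact h1.symm.trans h2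

/-- The isometry `V_N : H_N → H'_N` induced by `V`. -/
def quotMap (hV : PreservesCompact M M' V) (N : Subgroup Γ) : M.Quot N →L[ℂ] M'.Quot N :=
  (M'.toQuotₗ N ∘ₗ hV.mapₗ).extendOfNorm (M.toQuotₗ N)

lemma quotMap_bound (hV : PreservesCompact M M' V) (N : Subgroup Γ) (v : M.compactlySupported) :
    ‖(M'.toQuotₗ N ∘ₗ hV.mapₗ) v‖ ≤ 1 * ‖M.toQuotₗ N v‖ := by
  rw [one_mul]
  exact (hV.norm_toQuot_mapₗ N v).le

lemma quotMap_toQuot (hV : PreservesCompact M M' V) (N : Subgroup Γ)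
    (v : M.compactlySupported) : hV.quotMap N (M.toQuot v) = M'.toQuot (hV.mapₗ v) :=
  LinearMap.extendOfNorm_eq (M.denseRange_toQuotₗ N) ⟨1, hV.quotMap_bound N⟩ v

lemma norm_quotMap_le (hV : PreservesCompact M M' V) (N : Subgroup Γ) : ‖hV.quotMap N‖ ≤ 1 :=
  LinearMap.opNorm_extendOfNorm_le (M.denseRange_toQuotₗ N) zero_le_one (hV.quotMap_bound N)

lemma adjoint_quotMap_toQuot (hV : PreservesCompact M M' V) (N : Subgroup Γ)
    (w : M'.compactlySupported) :
    ContinuousLinearMap.adjoint (hV.quotMap N) (M'.toQuot w) = M.toQuot (hV.adjₗ w) := by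
  refine (innerSL_inj (𝕜 := ℂ)).1 (GeomModule.quot_ext fun v => ?_)
  rw [innerSL_apply_apply, innerSL_apply_apply, ContinuousLinearMap.adjoint_inner_left,
    hV.quotMap_toQuot, M.inner_toQuot, M'.inner_toQuot, hV.form_adjₗ]

lemma adjoint_quotMap_quotMap (hV : PreservesCompact M M' V) (N : Subgroup Γ) (x : M.Quot N) :
    ContinuousLinearMap.adjoint (hV.quotMap N) (hV.quotMap N x) = x := by
  have : ContinuousLinearMap.adjoint (hV.quotMap N) ∘L hV.quotMap N =
      ContinuousLinearMap.id ℂ _ := GeomModule.quot_ext fun v => by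
    change ContinuousLinearMap.adjoint (hV.quotMap N) (hV.quotMap N _) = _
    rw [hV.quotMap_toQuot, hV.adjoint_quotMap_toQuot, hV.adjₗ_mapₗ]
    rfl
  exact DFunLike.congr_fun this x

/-- The operator `V_N S W_N^*` on `H'_N`. -/
def quotConj (hV : PreservesCompact M M' V) (hW : PreservesCompact M M' W) (N : Subgroup Γ)
    (S : M.Quot N →L[ℂ] M.Quot N) : M'.Quot N →L[ℂ] M'.Quot N :=
  hV.quotMap N ∘L S ∘L ContinuousLinearMap.adjoint (hW.quotMap N)

lemma norm_quotConj_le (hV : PreservesCompact M M' V) (hW : PreservesCompact M M' W)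
    (N : Subgroup Γ) (S : M.Quot N →L[ℂ] M.Quot N) : ‖hV.quotConj hW N S‖ ≤ ‖S‖ := by
  have h1 : ‖ContinuousLinearMap.adjoint (hW.quotMap N)‖ ≤ 1 := by
    rw [LinearIsometryEquiv.norm_map]
    exact hW.norm_quotMap_le N
  refine (ContinuousLinearMap.opNorm_comp_le _ _).trans
    ((mul_le_of_le_one_left (norm_nonneg _) (hV.norm_quotMap_le N)).trans ?_)
  exact (ContinuousLinearMap.opNorm_comp_le _ _).trans (mul_le_of_le_one_right (norm_nonneg _) h1)

/-- The map `(S_N)_N ↦ (V_N S_N W_N^*)_N` of families of operators. -/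
def prodConj (hV : PreservesCompact M M' V) (hW : PreservesCompact M M' W) :
    M.QuotProd →L[ℂ] M'.QuotProd :=
  LinearMap.mkContinuous
    { toFun := fun S => ⟨fun N => hV.quotConj hW N.1 (M.component S N), by
        refine memℓp_infty ⟨‖S‖, ?_⟩
        rintro _ ⟨N, rfl⟩
        exact (hV.norm_quotConj_le hW _ _).trans (lp.norm_apply_le_norm ENNReal.top_ne_zero
          (E := fun N : {N : Subgroup Γ // N.Normal} => M.Quot N.1 →L[ℂ] M.Quot N.1) S N)⟩
      map_add' := fun S T => GeomModule.prod_ext fun N => by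
        change hV.quotConj hW N.1 (M.component S N + M.component T N) =
          hV.quotConj hW N.1 (M.component S N) + hV.quotConj hW N.1 (M.component T N)
        rw [quotConj, ContinuousLinearMap.add_comp, ContinuousLinearMap.comp_add]
        rfl
      map_smul' := fun c S => GeomModule.prod_ext fun N => by
        change hV.quotConj hW N.1 (c • M.component S N) =
          c • hV.quotConj hW N.1 (M.component S N)
        rw [quotConj, ContinuousLinearMap.smul_comp, ContinuousLinearMap.comp_smul]
        rfl }
    1 fun S => by
      rw [one_mul]
      exact lp.norm_le_of_forall_le (norm_nonneg S) fun N =>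
        (hV.norm_quotConj_le hW _ _).trans (lp.norm_apply_le_norm ENNReal.top_ne_zero
          (E := fun N : {N : Subgroup Γ // N.Normal} => M.Quot N.1 →L[ℂ] M.Quot N.1) S N)

lemma component_prodConj (hV : PreservesCompact M M' V) (hW : PreservesCompact M M' W)
    (S : M.QuotProd) (N) :
    M'.component (hV.prodConj hW S) N = hV.quotConj hW N.1 (M.component S N) := rfl

lemma prodConj_mul (hV : PreservesCompact M M' V) (hW : PreservesCompact M M' W)
    (hX : PreservesCompact M M' X) (S T : M.QuotProd) :
    hV.prodConj hW S * hW.prodConj hX T = hV.prodConj hX (S * T) := by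
  refine GeomModule.prod_ext fun N => ContinuousLinearMap.ext fun x => ?_
  rw [GeomModule.component_mul, component_prodConj, component_prodConj, component_prodConj,
    GeomModule.component_mul]
  change hV.quotMap N.1 (M.component S N (ContinuousLinearMap.adjoint (hW.quotMap N.1)
    (hW.quotMap N.1 _))) = _
  rw [hW.adjoint_quotMap_quotMap]
  rfl

lemma star_prodConj (hV : PreservesCompact M M' V) (hW : PreservesCompact M M' W)
    (S : M.QuotProd) : star (hV.prodConj hW S) = hW.prodConj hV (star S) := by
  refine GeomModule.prod_ext fun N => ?_
  rw [GeomModule.component_star, component_prodConj, component_prodConj,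
    GeomModule.component_star, ContinuousLinearMap.star_eq_adjoint,
    ContinuousLinearMap.star_eq_adjoint, quotConj, quotConj, ContinuousLinearMap.adjoint_comp,
    ContinuousLinearMap.adjoint_comp, ContinuousLinearMap.adjoint_adjoint]
  rfl

lemma induces_prodConj (hV : PreservesCompact M M' V) (hW : PreservesCompact M M' W)
    {T : H →L[ℂ] H} {S : M.QuotProd} (h : M.Induces T S) :
    M'.Induces (conjPair V W T) (hV.prodConj hW S) := by
  intro w
  obtain ⟨h1, h2⟩ := h (hW.adjₗ w)
  refine ⟨hV.map_mem _ h1, fun N => ?_⟩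
  rw [component_prodConj]
  change hV.quotMap N.1 (M.component S N
    (ContinuousLinearMap.adjoint (hW.quotMap N.1) (M'.toQuot w))) = _
  rw [hW.adjoint_quotMap_toQuot, h2, hV.quotMap_toQuot]
  rfl

end PreservesCompact

end conj

/-! ### The induced homomorphisms of Roe algebras -/

section roe

variable {Γ X X' H H' : Type*} [Group Γ] [MetricSpace X] [ProperSpace X] [MulAction Γ X]
  [IsIsometricSMul Γ X] [ProperlyDiscontinuousSMul Γ X]
  [MetricSpace X'] [ProperSpace X'] [MulAction Γ X']
  [IsIsometricSMul Γ X'] [ProperlyDiscontinuousSMul Γ X']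
  [NormedAddCommGroup H] [InnerProductSpace ℂ H] [CompleteSpace H]
  [NormedAddCommGroup H'] [InnerProductSpace ℂ H'] [CompleteSpace H']
  {E : CylindricalEnd Γ X} {E' : CylindricalEnd Γ X'}
  {M : TailoredModule E H} {M' : TailoredModule E' H'} {f : X → X'} {V W : H →ₗᵢ[ℂ] H'}

lemma Covers.preservesCompact (hV : Covers M M' f V) (hf : IsCylindricalCoarseMap E E' f) :
    PreservesCompact M.toGeomModule M'.toGeomModule V where
  equivariant := hV.equivariant
  map_mem := by
    rintro v ⟨K, hK, hv⟩
    obtain ⟨r, -, hr⟩ := hV.exists_ctrl hf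
    refine mem_compactlySupported_of_suppOn (B := {x' | ∃ x ∈ Metric.thickening 1 K,
      near f r x' x}) ?_ (hr.suppOn_apply M.nondeg hv one_pos)
    have hB : Bornology.IsBounded (f '' Metric.thickening 1 K) := by
      obtain ⟨C, hC⟩ := Metric.isBounded_iff.1 (hK.isBounded.thickening (δ := 1))
      obtain ⟨S, -, hS⟩ := hf.expansive (max C 0 + 1) (by positivity)
      refine Metric.isBounded_iff.2 ⟨S, ?_⟩
      rintro _ ⟨x, hx, rfl⟩ _ ⟨y, hy, rfl⟩
      exact (hS x y (((hC hx hy).trans (le_max_left _ _)).trans_lt (lt_add_one _))).le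
    refine (hB.thickening (δ := r)).subset ?_
    rintro x' ⟨x, hx, hxx'⟩
    refine Metric.mem_thickening_iff.2 ⟨f x, ⟨x, hx, rfl⟩, ?_⟩
    rw [dist_comm]
    exact hxx'
  adj_mem := by
    rintro w ⟨K, hK, hw⟩
    obtain ⟨r, -, hr⟩ := hV.exists_ctrl_adj hf
    refine mem_compactlySupported_of_suppOn (B := {x | ∃ x' ∈ Metric.thickening 1 K,
      dist (f x) x' < r}) ?_ (hr.suppOn_apply M'.nondeg hw one_pos)
    refine (hf.proper _ ((hK.isBounded.thickening (δ := 1)).thickening (δ := r))).subset ?_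
    rintro x ⟨x', hx', hxx'⟩
    exact Metric.mem_thickening_iff.2 ⟨x', hx', hxx'⟩

/-- The maps `S ↦ V_i S V_j^*` preserve the Roe algebras. All four are needed at the same time,
as `V_i S T V_j^* = (V_i S V_i^*) (V_i T V_j^*)`. -/
lemma prodConj_mem_roeSubalgebra (hf : IsCylindricalCoarseMap E E' f)
    {V : Bool → H →ₗᵢ[ℂ] H'} (hV : ∀ i, Covers M M' f (V i)) (i j : Bool) {S : M.QuotProd}
    (hS : S ∈ M.roeSubalgebra) :
    ((hV i).preservesCompact hf).prodConj ((hV j).preservesCompact hf) S ∈ M'.roeSubalgebra := by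
  have hadj : ∀ S ∈ NonUnitalStarAlgebra.adjoin ℂ
      {S : M.QuotProd | ∃ T ∈ M.algRoeEnd, M.Induces T S}, ∀ i j,
      ((hV i).preservesCompact hf).prodConj ((hV j).preservesCompact hf) S ∈
        NonUnitalStarAlgebra.adjoin ℂ
          {S : M'.QuotProd | ∃ T ∈ M'.algRoeEnd, M'.Induces T S} := by
    intro S hS
    induction hS using NonUnitalStarAlgebra.adjoin_induction with
    | mem S hS =>
      obtain ⟨T, hT, hTS⟩ := hS
      exact fun i j => NonUnitalStarAlgebra.subset_adjoin ℂ _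
        ⟨_, conjPair_mem_algRoeEnd hf (hV i) (hV j) hT,
          PreservesCompact.induces_prodConj _ _ hTS⟩
    | add S T _ _ hS hT =>
      intro i j
      rw [map_add]
      exact add_mem (hS i j) (hT i j)
    | zero =>
      intro i j
      rw [map_zero]
      exact zero_mem _
    | mul S T _ _ hS hT =>
      intro i j
      rw [← PreservesCompact.prodConj_mul _ ((hV i).preservesCompact hf) _]
      exact mul_mem (hS i i) (hT i j)
    | smul c S _ hS =>
      intro i j
      rw [map_smul]
      exact SMulMemClass.smul_mem c (hS i j)
    | star S _ hS =>
      intro i j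
      rw [← PreservesCompact.star_prodConj]
      exact star_mem (hS j i)
  exact map_mem_closure (ContinuousLinearMap.continuous _) hS fun S hS => hadj S hS i j

/-- The map `S ↦ V_i S V_j^*` of Roe algebras. -/
def roeConj (hf : IsCylindricalCoarseMap E E' f) {V : Bool → H →ₗᵢ[ℂ] H'}
    (hV : ∀ i, Covers M M' f (V i)) (i j : Bool) : M.Roe →L[ℂ] M'.Roe where
  toFun S := ⟨_, prodConj_mem_roeSubalgebra hf hV i j S.2⟩
  map_add' S T := Subtype.ext (map_add _ S.1 T.1)
  map_smul' c S := Subtype.ext (map_smul _ c S.1)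
  cont := ((ContinuousLinearMap.continuous _).comp continuous_subtype_val).subtype_mk _

lemma roeConj_mul (hf : IsCylindricalCoarseMap E E' f) {V : Bool → H →ₗᵢ[ℂ] H'}
    (hV : ∀ i, Covers M M' f (V i)) (i k j : Bool) (S T : M.Roe) :
    roeConj hf hV i k S * roeConj hf hV k j T = roeConj hf hV i j (S * T) :=
  Subtype.ext (PreservesCompact.prodConj_mul _ _ _ S.1 T.1)

lemma star_roeConj (hf : IsCylindricalCoarseMap E E' f) {V : Bool → H →ₗᵢ[ℂ] H'}
    (hV : ∀ i, Covers M M' f (V i)) (i j : Bool) (S : M.Roe) :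
    star (roeConj hf hV i j S) = roeConj hf hV j i (star S) :=
  Subtype.ext (PreservesCompact.star_prodConj _ _ S.1)

/-- The homomorphism `Ad_{V_i}`. -/
def roeHom (hf : IsCylindricalCoarseMap E E' f) {V : Bool → H →ₗᵢ[ℂ] H'}
    (hV : ∀ i, Covers M M' f (V i)) (i : Bool) : M.Roe →⋆ₙₐ[ℂ] M'.Roe where
  toFun := roeConj hf hV i i
  map_smul' c S := map_smul _ c S
  map_zero' := map_zero _
  map_add' S T := map_add _ S T
  map_mul' S T := (roeConj_mul hf hV i i i S T).symm
  map_star' S := (star_roeConj hf hV i i S).symm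

lemma isConjugation_roeHom (hf : IsCylindricalCoarseMap E E' f) {V : Bool → H →ₗᵢ[ℂ] H'}
    (hV : ∀ i, Covers M M' f (V i)) (i : Bool) :
    IsConjugation M M' (V i) (roeHom hf hV i) := fun _ _ _ hST =>
  PreservesCompact.induces_prodConj _ _ hST

/-- A `*`-homomorphism of Roe algebras is determined by its values on the algebraic Roe
algebra. -/
lemma IsConjugation.unique {Φ Ψ : M.Roe →⋆ₙₐ[ℂ] M'.Roe} (hΦ : IsConjugation M M' V Φ)
    (hΨ : IsConjugation M M' V Ψ) : Φ = Ψ := by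
  have hcont : ∀ φ : M.Roe →⋆ₙₐ[ℂ] M'.Roe, Continuous φ := fun φ =>
    AddMonoidHomClass.continuous_of_bound φ 1 fun a => by
      simpa using NonUnitalStarAlgHom.norm_apply_le φ a
  set A := NonUnitalStarAlgebra.adjoin ℂ {S : M.QuotProd | ∃ T ∈ M.algRoeEnd, M.Induces T S}
    with hA
  have hle : A ≤ M.roeSubalgebra := NonUnitalStarSubalgebra.le_topologicalClosure _
  let r : ∀ S ∈ A, M.Roe := fun S hS => ⟨S, hle hS⟩
  have hadj : ∀ (S : M.QuotProd) (hS : S ∈ A), Φ (r S hS) = Ψ (r S hS) := by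
    intro S hS
    induction hS using NonUnitalStarAlgebra.adjoin_induction with
    | mem S hS =>
      obtain ⟨T, hT, hTS⟩ := hS
      have hS' := NonUnitalStarAlgebra.subset_adjoin ℂ _
        (show S ∈ {S : M.QuotProd | ∃ T ∈ M.algRoeEnd, M.Induces T S} from ⟨T, hT, hTS⟩)
      exact Subtype.ext ((hΦ T hT (r S hS') hTS).unique (hΨ T hT (r S hS') hTS))
    | add S T hS hT h1 h2 =>
      exact (map_add Φ (r S hS) (r T hT)).trans
        ((congrArg₂ (· + ·) h1 h2).trans (map_add Ψ (r S hS) (r T hT)).symm)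
    | zero => exact (map_zero Φ).trans (map_zero Ψ).symm
    | mul S T hS hT h1 h2 =>
      exact (map_mul Φ (r S hS) (r T hT)).trans
        ((congrArg₂ (· * ·) h1 h2).trans (map_mul Ψ (r S hS) (r T hT)).symm)
    | smul c S hS h1 =>
      exact (map_smul Φ c (r S hS)).trans
        ((congrArg (c • ·) h1).trans (map_smul Ψ c (r S hS)).symm)
    | star S hS h1 =>
      exact (map_star Φ (r S hS)).trans
        ((congrArg star h1).trans (map_star Ψ (r S hS)).symm)
  have hdense : Dense {S : M.roeSubalgebra | S.1 ∈ A} := by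
    rw [Subtype.dense_iff]
    intro S hS
    refine closure_mono ?_ (show S ∈ closure (A : Set M.QuotProd) from hS)
    exact fun T hT => ⟨⟨T, hle hT⟩, hT, rfl⟩
  have heq : (Φ : M.Roe → M'.Roe) = Ψ := by
    refine Continuous.ext_on (s := {S : M.Roe | ∃ hS, S = r S.1 hS}) ?_ (hcont Φ)
      (hcont Ψ) ?_
    · exact hdense.mono fun S hS => ⟨hS, rfl⟩
    · rintro S ⟨hS, hSr⟩
      rw [hSr]
      exact hadj S.1 hS
  exact DFunLike.coe_injective heq

/-- Isometries covering the same map induce the same homomorphism in K-theory. -/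
theorem KMap_eq_of_isConjugation (hf : IsCylindricalCoarseMap E E' f) (hV : Covers M M' f V)
    (hW : Covers M M' f W) {Φ Ψ : M.Roe →⋆ₙₐ[ℂ] M'.Roe} (hΦ : IsConjugation M M' V Φ)
    (hΨ : IsConjugation M M' W Ψ) (n : ℕ) : KTheory.KMap n Φ = KTheory.KMap n Ψ := by
  let U : Bool → H →ₗᵢ[ℂ] H' := fun b => cond b W V
  have hU : ∀ i, Covers M M' f (U i) := fun i => by
    cases i
    · exact hV
    · exact hW
  rw [hΦ.unique (isConjugation_roeHom hf hU false), hΨ.unique (isConjugation_roeHom hf hU true)]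
  exact KTheory.KMap_eq_of_linking (roeConj_mul hf hU) (star_roeConj hf hU) (roeHom hf hU)
    (fun _ _ => rfl) n

theorem existsUnique_isConjugation (hf : IsCylindricalCoarseMap E E' f) (hV : Covers M M' f V) :
    ∃! Φ : M.Roe →⋆ₙₐ[ℂ] M'.Roe, IsConjugation M M' V Φ :=
  ⟨roeHom hf (V := fun _ => V) (fun _ => hV) true,
    isConjugation_roeHom hf (V := fun _ => V) (fun _ => hV) true,
    fun _ hΨ => hΨ.unique (isConjugation_roeHom hf (V := fun _ => V) (fun _ => hV) true)⟩

end roe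

section functoriality

variable {Γ X H H₁ H₂ : Type*} [Group Γ] [MetricSpace X] [ProperSpace X] [MulAction Γ X]
  [IsIsometricSMul Γ X] [ProperlyDiscontinuousSMul Γ X]
  [NormedAddCommGroup H] [InnerProductSpace ℂ H] [CompleteSpace H]
  [NormedAddCommGroup H₁] [InnerProductSpace ℂ H₁] [CompleteSpace H₁]
  [NormedAddCommGroup H₂] [InnerProductSpace ℂ H₂] [CompleteSpace H₂]
  {E : CylindricalEnd Γ X}
  {M : TailoredModule E H} {M₁ : TailoredModule E H₁} {M₂ : TailoredModule E H₂}

lemma covers_id (M : TailoredModule E H) : Covers M M id LinearIsometry.id where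
  equivariant _ _ := rfl
  covers := by
    refine coversMap_of_ctrl expansive_id one_pos fun F G hFG => ?_
    ext1 v
    change M.ρ F (M.ρ G v) = 0
    rw [← rep_mul_apply, show F * G = 0 from ?_, map_zero]
    · rfl
    · ext z
      rw [ZeroAtInftyContinuousMap.mul_apply]
      by_contra h
      obtain ⟨h1, h2⟩ := mul_ne_zero_iff.1 h
      exact hFG z z h1 h2 (by simp [near])
  intertwines _ _ := rfl

lemma Covers.comp_id {V : H →ₗᵢ[ℂ] H₁} {W : H₁ →ₗᵢ[ℂ] H₂} (hW : Covers M₁ M₂ id W)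
    (hV : Covers M M₁ id V) : Covers M M₂ id (W.comp V) where
  equivariant γ v := by
    change W (V _) = _
    rw [hV.equivariant, hW.equivariant]
    rfl
  covers := by
    obtain ⟨r, hr, h1⟩ := hV.exists_ctrl isCylindricalCoarseMap_id
    obtain ⟨s, hs, h2⟩ := hW.exists_ctrl isCylindricalCoarseMap_id
    obtain ⟨R, hR, h⟩ := h1.comp_near M₁.nondeg expansive_id hr hs h2
    exact coversMap_of_ctrl expansive_id hR h
  intertwines s v := by
    change W (V _) = _
    rw [hV.intertwines, hW.intertwines]
    rfl

lemma adj_comp (W : H₁ →ₗᵢ[ℂ] H₂) (V : H →ₗᵢ[ℂ] H₁) (w : H₂) :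
    adj (W.comp V) w = adj V (adj W w) :=
  ext_inner_right ℂ fun u => by
    rw [adj_inner_left, adj_inner_left, adj_inner_left]
    rfl

lemma IsConjugation.comp_id {V : H →ₗᵢ[ℂ] H₁} {W : H₁ →ₗᵢ[ℂ] H₂}
    {Φ : M.Roe →⋆ₙₐ[ℂ] M₁.Roe} {Ψ : M₁.Roe →⋆ₙₐ[ℂ] M₂.Roe} (hΨ : IsConjugation M₁ M₂ W Ψ)
    (hV : Covers M M₁ id V) (hΦ : IsConjugation M M₁ V Φ) :
    IsConjugation M M₂ (W.comp V) (Ψ.comp Φ) := by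
  intro T hT S hTS
  have h := hΨ _ (conjPair_mem_algRoeEnd isCylindricalCoarseMap_id hV hV hT) _ (hΦ T hT S hTS)
  have he : conj (W.comp V) T = conj W (conj V T) := by
    ext1 w
    exact congrArg (fun u => W (V (T u))) (adj_comp W V w)
  rw [he]
  exact h

lemma isConjugation_id (M : TailoredModule E H) :
    IsConjugation M M LinearIsometry.id (NonUnitalStarAlgHom.id ℂ M.Roe) := by
  intro T hT S hTS
  have he : conj (LinearIsometry.id : H →ₗᵢ[ℂ] H) T = T := by
    ext1 w
    exact congrArg T (adj_apply LinearIsometry.id w)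
  rw [he]
  exact hTS

/-- Isometries covering the identity in opposite directions induce mutually inverse maps in
K-theory, as their compositions cover the identity like the identity operators do. -/
lemma KMap_KMap_eq_self {V : H →ₗᵢ[ℂ] H₁} {W : H₁ →ₗᵢ[ℂ] H}
    {Φ : M.Roe →⋆ₙₐ[ℂ] M₁.Roe} {Ψ : M₁.Roe →⋆ₙₐ[ℂ] M.Roe} (hV : Covers M M₁ id V)
    (hW : Covers M₁ M id W) (hΦ : IsConjugation M M₁ V Φ) (hΨ : IsConjugation M₁ M W Ψ) (n : ℕ)
    (x : KTheory.K n M.Roe) : KTheory.KMap n Ψ (KTheory.KMap n Φ x) = x := by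
  rw [← KTheory.KMap_comp, KMap_eq_of_isConjugation isCylindricalCoarseMap_id (hW.comp_id hV)
    (covers_id M) (hΨ.comp_id hV hΦ) (isConjugation_id M) n, KTheory.KMap_id]

end functoriality

end Coarse

end

theorem mainTheorem11 {Γ X X' H H₂ H' : Type*} [Group Γ]
    [MetricSpace X] [ProperSpace X] [MulAction Γ X] [IsIsometricSMul Γ X]
    [ProperlyDiscontinuousSMul Γ X]
    [MetricSpace X'] [ProperSpace X'] [MulAction Γ X'] [IsIsometricSMul Γ X']
    [ProperlyDiscontinuousSMul Γ X']
    (hfree : ∀ (γ : Γ) (x : X), γ • x = x → γ = 1)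
    (hfree' : ∀ (γ : Γ) (x : X'), γ • x = x → γ = 1)
    (hX : Coarse.BoundedGeometry X) (hX' : Coarse.BoundedGeometry X')
    (E : Coarse.CylindricalEnd Γ X) (E' : Coarse.CylindricalEnd Γ X')
    (f : X → X') (hf : Coarse.IsCylindricalCoarseMap E E' f)
    [NormedAddCommGroup H] [InnerProductSpace ℂ H] [CompleteSpace H]
    [TopologicalSpace.SeparableSpace H]
    [NormedAddCommGroup H₂] [InnerProductSpace ℂ H₂] [CompleteSpace H₂]
    [TopologicalSpace.SeparableSpace H₂]
    [NormedAddCommGroup H'] [InnerProductSpace ℂ H'] [CompleteSpace H']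
    [TopologicalSpace.SeparableSpace H']
    (M : Coarse.TailoredModule E H) (M₂ : Coarse.TailoredModule E H₂)
    (M' : Coarse.TailoredModule E' H') :
    -- there is an isometry covering `f`
    (∃ V : H →ₗᵢ[ℂ] H', Coarse.Covers M M' f V) ∧
    -- conjugation by any such isometry gives a `*`-homomorphism of Roe algebras
    (∀ V : H →ₗᵢ[ℂ] H', Coarse.Covers M M' f V →
      (∀ T ∈ M.algRoeEnd, Coarse.conj V T ∈ M'.algRoeEnd) ∧
      ∃! Φ : M.Roe →⋆ₙₐ[ℂ] M'.Roe, Coarse.IsConjugation M M' V Φ) ∧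
    -- the induced homomorphism in K-theory does not depend on the isometry
    (∀ n : ℕ, ∃! θ : KTheory.K n M.Roe →+ KTheory.K n M'.Roe,
      ∀ (V : H →ₗᵢ[ℂ] H') (Φ : M.Roe →⋆ₙₐ[ℂ] M'.Roe),
        Coarse.Covers M M' f V → Coarse.IsConjugation M M' V Φ → KTheory.KMap n Φ = θ) ∧
    -- the K-theory does not depend on the module, up to canonical isomorphism
    (∀ n : ℕ, ∃! θ : KTheory.K n M.Roe ≃+ KTheory.K n M₂.Roe,
      ∀ (V : H →ₗᵢ[ℂ] H₂) (Φ : M.Roe →⋆ₙₐ[ℂ] M₂.Roe),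
        Coarse.Covers M M₂ id V → Coarse.IsConjugation M M₂ V Φ →
          KTheory.KMap n Φ = θ.toAddMonoidHom) := by
  have hid := Coarse.isCylindricalCoarseMap_id (E := E)
  obtain ⟨V₀, hV₀⟩ := Coarse.exists_covers hfree' M M' hf
  obtain ⟨Φ₀, hΦ₀, -⟩ := Coarse.existsUnique_isConjugation hf hV₀
  obtain ⟨V₁, hV₁⟩ := Coarse.exists_covers hfree M M₂ hid
  obtain ⟨Φ₁, hΦ₁, -⟩ := Coarse.existsUnique_isConjugation hid hV₁
  obtain ⟨V₂, hV₂⟩ := Coarse.exists_covers hfree M₂ M hid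
  obtain ⟨Φ₂, hΦ₂, -⟩ := Coarse.existsUnique_isConjugation hid hV₂
  refine ⟨⟨V₀, hV₀⟩, fun V hV => ⟨fun T hT => Coarse.conjPair_mem_algRoeEnd hf hV hV hT,
    Coarse.existsUnique_isConjugation hf hV⟩, fun n => ?_, fun n => ?_⟩
  · exact ⟨KTheory.KMap n Φ₀,
      fun V Φ hV hΦ => Coarse.KMap_eq_of_isConjugation hf hV hV₀ hΦ hΦ₀ n,
      fun θ hθ => (hθ V₀ Φ₀ hV₀ hΦ₀).symm⟩
  · refine ⟨{ KTheory.KMap n Φ₁ with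
        invFun := KTheory.KMap n Φ₂
        left_inv := Coarse.KMap_KMap_eq_self hV₁ hV₂ hΦ₁ hΦ₂ n
        right_inv := Coarse.KMap_KMap_eq_self hV₂ hV₁ hΦ₂ hΦ₁ n },
      fun V Φ hV hΦ => ?_, fun θ hθ => ?_⟩
    · exact Coarse.KMap_eq_of_isConjugation hid hV hV₁ hΦ hΦ₁ n
    · exact AddEquiv.ext fun x => (DFunLike.congr_fun (hθ V₁ Φ₁ hV₁ hΦ₁) x).symm
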